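/- Let $p$ be a prime and $R$ an $F$-finite noetherian commutative ring of characteristic $p$ (so $F_*R$ is a finitely generated $R$-module, where $F^e_*M$ denotes $M$ with $R$ acting through $x\mapsto x^{p^e}$). For a complete local noetherian ring $S$ and a finitely generated $S$-module $N$ let $\mathcal J(N)$ be the set of isomorphism classes of indecomposable modules occurring in a decomposition of $N$ into a finite direct sum of indecomposables. Assume that $R$ has complete local finite $F$-representation type, i.e. for every prime $\mathfrak p\subseteq R$ the set $\bigcup_{e\ge 0}\mathcal J(F^e_*\widehat{R_{\mathfrak p}})$ is finite, and let $a\ge 0$, $b>0$ be integers such that $\mathcal J(F^{a+eb}_*\widehat{R_{\mathfrak p}})=\mathcal J(F^{a}_*\widehat{R_{\mathfrak p}})$ for all $e\ge 0$ and all primes $\mathfrak p$. Put $F^{(e)}=F^{a+eb}$, $\mathcal D^{(0)}=\operatorname{End}_R(F^{(0)}_*R)$, and let $$\mathcal D^{(0)}\langle\Phi\rangle=\bigoplus_{e\ge 0}\operatorname{Hom}_R(F^{(0)}_*R,F^{(e)}_*R),$$ a ring under composition of additive maps $R\to R$. Left $\mathcal D^{(0)}\langle\Phi\rangle$-modules are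 $R$-modules through $R\to\mathcal D^{(0)}$, $r\mapsto(\text{multiplication by }r)$. A left $\mathcal D^{(0)}\langle\Phi\rangle$-module $M$ is called unit if the natural map $$\operatorname{Hom}_R(F^{(0)}_*R,F^{(1)}_*R)\otimes_{\mathcal D^{(0)}}M\to M,\qquad \alpha\otimes m\mapsto \alpha\cdot m,$$ is an isomorphism, and finitely generated unit if it is moreover finitely generated over $\mathcal D^{(0)}\langle\Phi\rangle$. Then: (1) $R$, with the action $\alpha\cdot x=\alpha(x)$, is a finitely generated unit left $\mathcal D^{(0)}\langle\Phi\rangle$-module. (2) Let $M$ be a left $\mathcal D^{(0)}\langle\Phi\rangle$-module and $W\subseteq R$ a multiplicative subset. There is a unique left $\mathcal D^{(0)}\langle\Phi\rangle$-module structure on $W^{-1}M$ that extends its $R$-module structure and for which $M\to W^{-1}M$ is $\mathcal D^{(0)}\langle\Phi\rangle$-linear. If $M$ is unit, then so is $W^{-1}M$. (3) If $M$ is a finitely generated unit left $\mathcal D^{(0)}\langle\Phi\rangle$-module and $f\in R$, then $M[1/f]$ is finitely generated unit. (4) Let $M$ be a left $\mathcal D^{(0)}\langle\Phi\rangle$-module,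 $I=(f_1,\dots,f_n)\subseteq R$ an ideal and $i\ge 0$. By (2), the Čech complex of $M$ on $f_1,\dots,f_n$ is a complex of left $\mathcal D^{(0)}\langle\Phi\rangle$-modules. The local cohomology module $H^i_I(M)=\varinjlim_t\operatorname{Ext}^i_R(R/I^t,M)$ admits a left $\mathcal D^{(0)}\langle\Phi\rangle$-module structure, extending its $R$-module structure, with which it is isomorphic to the $i$-th cohomology of this Čech complex; and if $M$ is finitely generated unit, then so is $H^i_I(M)$ with this structure. -/

import Mathlib

universe u v

noncomputable section

namespace FRep

open DirectSum TensorProduct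

/-! ### Frobenius pushforwards and finite `F`-representation type -/

section FFRT

variable (p : ℕ) [Fact p.Prime]

/-- `F^e_* M`: the abelian group `M` with `S` acting through the `e`-th iterate of Frobenius. -/
def FrobPush (_p _e : ℕ) (M : Type u) : Type u := M

instance (e : ℕ) (M : Type u) [AddCommGroup M] : AddCommGroup (FrobPush p e M) :=
  inferInstanceAs (AddCommGroup M)

instance (S : Type v) [CommRing S] [CharP S p] (e : ℕ) (M : Type u) [AddCommGroup M]
    [Module S M] : Module S (FrobPush p e M) :=
  Module.compHom (R := S) M (iterateFrobenius S p e)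

/-- A module is indecomposable if it is nonzero and is not the direct sum of two nonzero
submodules. -/
def IsIndecomposable (S : Type u) [CommRing S] (N : Type u) [AddCommGroup N] [Module S N] : Prop :=
  Nontrivial N ∧ ∀ A B : Submodule S N, IsCompl A B → A = ⊥ ∨ B = ⊥

/-- `𝒥(M)`, as an isomorphism-closed class: the finitely generated indecomposable modules `X` that
occur (up to isomorphism) in a decomposition of `M` as a finite direct sum of finitely generated
indecomposable modules. -/
def indecs (S : Type u) [CommRing S] (M : Type u) [AddCommGroup M] [Module S M] :
    Set (ModuleCat.{u} S) :=
  {X | ∃ (n : ℕ) (N : Fin n → ModuleCat.{u} S),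
    (∀ j, Module.Finite S (N j) ∧ IsIndecomposable S (N j)) ∧
    Nonempty (M ≃ₗ[S] (∀ j, N j)) ∧ ∃ j, Nonempty (X ≃ₗ[S] N j)}

/-- Finite `F`-representation type (for a complete local `F`-finite ring `S`): up to isomorphism
only finitely many modules occur in `⋃ₑ 𝒥(F^e_* S)`. -/
def HasFFRT (S : Type u) [CommRing S] [CharP S p] : Prop :=
  ∃ (n : ℕ) (N : Fin n → ModuleCat.{u} S),
    ∀ e : ℕ, ∀ X ∈ indecs S (FrobPush p e S), ∃ j, Nonempty (X ≃ₗ[S] N j)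

/-- The completion of the local ring `R_P` at its maximal ideal. -/
abbrev complStalk (R : Type u) [CommRing R] (P : Ideal R) [P.IsPrime] : Type u :=
  AdicCompletion (IsLocalRing.maximalIdeal (Localization.AtPrime P)) (Localization.AtPrime P)

instance (R : Type u) [CommRing R] (P : Ideal R) [P.IsPrime] : Nontrivial (complStalk R P) :=
  (AdicCompletion.evalOneₐ
    (IsLocalRing.maximalIdeal (Localization.AtPrime P))).toRingHom.domain_nontrivial

instance (R : Type u) [CommRing R] [CharP R p] (P : Ideal R) [P.IsPrime] :
    CharP (complStalk R P) p :=
  CharP.of_ringHom_of_ne_zero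
    (((algebraMap (Localization.AtPrime P) (complStalk R P)).comp
      (algebraMap R (Localization.AtPrime P))).comp (ZMod.castHom (dvd_refl p) R))
    p (Fact.out : p.Prime).ne_zero

/-- `F`-finite rings: noetherian with module-finite Frobenius. -/
def IsFFinite (R : Type u) [CommRing R] [CharP R p] : Prop :=
  IsNoetherianRing R ∧ (frobenius R p).Finite

/-- Complete local finite `F`-representation type. -/
def IsCLFFRT (R : Type u) [CommRing R] [CharP R p] : Prop :=
  ∀ (P : Ideal R) [P.IsPrime], HasFFRT p (complStalk R P)

/-- The choice of `a ≥ 0`, `b > 0`: for all primes `P`,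
`𝒥(F^a_* S) = 𝒥(F^(a+b)_* S) = 𝒥(F^(a+2b)_* S) = ⋯`, where `S` is the completion of `R_P`. -/
def IsSetup (R : Type u) [CommRing R] [CharP R p] (a b : ℕ) : Prop :=
  0 < b ∧ ∀ (P : Ideal R) [P.IsPrime] (e : ℕ),
    indecs (complStalk R P) (FrobPush p (a + e * b) (complStalk R P)) =
      indecs (complStalk R P) (FrobPush p a (complStalk R P))

end FFRT

/-! ### The ring `𝒟⁽⁰⁾⟨Φ⟩` -/

section Ring

variable (p : ℕ) (R : Type u) [CommRing R]

/-- `Hom_R(F^i_* R, F^j_* R)`, as a subgroup of `End_ℤ(R)`. -/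
def frobHom (i j : ℕ) : AddSubgroup (AddMonoid.End R) where
  carrier := {φ | ∀ x u : R, φ (x ^ p ^ i * u) = x ^ p ^ j * φ u}
  zero_mem' := fun x u => by simp
  add_mem' := fun {φ ψ} hφ hψ x u => by
    change φ _ + ψ _ = _ * (φ u + ψ u)
    rw [hφ, hψ, mul_add]
  neg_mem' := fun {φ} hφ x u => by
    change -φ _ = _ * -φ u
    rw [hφ, mul_neg]

/-- `frobHom` consists of the `R`-linear maps between Frobenius pushforwards. -/
theorem mem_frobHom_iff [Fact p.Prime] [CharP R p] (i j : ℕ) (φ : AddMonoid.End R) :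
    φ ∈ frobHom p R i j ↔
      ∃ ψ : FrobPush p i R →ₗ[R] FrobPush p j R, ∀ u : R, ψ u = φ u := by
  constructor
  · intro h
    exact ⟨{ toFun := φ, map_add' := φ.map_add, map_smul' := fun x u => h x u }, fun _ => rfl⟩
  · rintro ⟨ψ, hψ⟩ x u
    rw [← hψ, ← hψ]
    exact ψ.map_smul x u

variable (a b : ℕ)

/-- `Hom_R(F⁽⁰⁾_* R, F⁽ᵉ⁾_* R)`, where `F⁽ᵉ⁾ = F^(a+eb)`. For `e = 0` it is `𝒟⁽⁰⁾`. -/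
def piece (e : ℕ) : AddSubgroup (AddMonoid.End R) := frobHom p R a (a + e * b)

theorem piece_apply {e : ℕ} (α : piece p R a b e) (x u : R) :
    (α : AddMonoid.End R) (x ^ p ^ a * u) = x ^ p ^ (a + e * b) * (α : AddMonoid.End R) u :=
  α.2 x u

theorem piece_apply' {e : ℕ} (α : piece p R a b e) (k : ℕ) (x u : R) :
    (α : AddMonoid.End R) (x ^ p ^ (a + k * b) * u)
      = x ^ p ^ (a + (e + k) * b) * (α : AddMonoid.End R) u := by
  have := piece_apply p R a b α (x ^ p ^ (k * b)) u
  rw [← pow_mul, ← pow_mul, ← pow_add, ← pow_add] at this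
  rw [show a + k * b = k * b + a by ring, this]
  congr 3
  ring

instance : SetLike.GradedMonoid (piece p R a b) where
  one_mem := fun x u => by simp
  mul_mem := fun {i j} β α hβ hα x u => by
    change β (α (x ^ p ^ a * u)) = x ^ _ * β (α u)
    rw [hα x u]
    exact piece_apply' p R a b ⟨β, hβ⟩ j x (α u)

/-- The ring `𝒟⁽⁰⁾⟨Φ⟩ = ⨁ₑ Hom_R(F⁽⁰⁾_* R, F⁽ᵉ⁾_* R)`, with multiplication given by
composition. -/
def DPhi : Type u := ⨁ e : ℕ, piece p R a b e

instance : Ring (DPhi p R a b) := inferInstanceAs (Ring (⨁ e : ℕ, piece p R a b e))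

/-- The inclusion of the `e`-th summand. -/
def DPhi.of (e : ℕ) : piece p R a b e →+ DPhi p R a b :=
  DirectSum.of (fun e => piece p R a b e) e

theorem DPhi.of_congr {i j : ℕ} (h : i = j) (α : piece p R a b i) (β : piece p R a b j)
    (hαβ : (α : AddMonoid.End R) = β) : DPhi.of p R a b i α = DPhi.of p R a b j β := by
  subst h
  rw [Subtype.ext hαβ]

theorem DPhi.of_mul_of {i j : ℕ} (α : piece p R a b i) (β : piece p R a b j) :
    DPhi.of p R a b i α * DPhi.of p R a b j β =
      DPhi.of p R a b (i + j) ⟨(α : AddMonoid.End R) * β, SetLike.mul_mem_graded α.2 β.2⟩ :=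
  DirectSum.of_mul_of (A := fun e => piece p R a b e) α β

/-- Multiplication by `r`, as an element of `𝒟⁽⁰⁾`. -/
def mulPiece (r : R) : piece p R a b 0 :=
  ⟨Module.toAddMonoidEnd R R r, fun x u => by
    change r * (x ^ p ^ a * u) = x ^ p ^ (a + 0 * b) * (r * u)
    rw [zero_mul, add_zero, mul_left_comm]⟩

/-- The ring homomorphism `R → 𝒟⁽⁰⁾ ⊆ 𝒟⁽⁰⁾⟨Φ⟩` sending `r` to multiplication by `r`. -/
def DPhi.ofR : R →+* DPhi p R a b where
  toFun r := DPhi.of p R a b 0 (mulPiece p R a b r)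
  map_one' := DPhi.of_congr p R a b rfl _ ⟨1, SetLike.GradedOne.one_mem⟩ (by simp [mulPiece])
  map_zero' := by
    rw [← map_zero (DPhi.of p R a b 0)]
    exact DPhi.of_congr p R a b rfl _ _ (by simp [mulPiece])
  map_add' r s := by
    rw [← map_add]
    exact DPhi.of_congr p R a b rfl _ _ (by simp [mulPiece])
  map_mul' r s := by
    rw [DPhi.of_mul_of]
    exact DPhi.of_congr p R a b rfl _ _ (by simp [mulPiece])

/-- `R` acts on `𝒟⁽⁰⁾⟨Φ⟩` by left multiplication. A left `𝒟⁽⁰⁾⟨Φ⟩`-module `M` is an `R`-module by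
restriction along `R → 𝒟⁽⁰⁾⟨Φ⟩`; that a given `R`-module structure on `M` is this one is expressed
by `IsScalarTower R (DPhi p R a b) M`. -/
instance : Module R (DPhi p R a b) := Module.compHom (R := DPhi p R a b) _ (DPhi.ofR p R a b)

theorem DPhi.smul_def (r : R) (d : DPhi p R a b) : r • d = DPhi.ofR p R a b r * d := rfl

/-- `𝒟⁽⁰⁾⟨Φ⟩` acts on `R` by `α · x = α(x)`. -/
instance : Module (DPhi p R a b) R :=
  Module.compHom (R := AddMonoid.End R) R
    (DirectSum.toSemiring (A := fun e => piece p R a b e) (fun e => (piece p R a b e).subtype)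
      rfl (fun _ _ => rfl) : DPhi p R a b →+* AddMonoid.End R)

theorem DPhi.of_smul_self (e : ℕ) (α : piece p R a b e) (x : R) :
    DPhi.of p R a b e α • x = (α : AddMonoid.End R) x := by
  exact congrArg (fun φ : AddMonoid.End R => φ x)
    (DirectSum.toSemiring_of (A := fun e => piece p R a b e) (fun e => (piece p R a b e).subtype)
      rfl (fun _ _ => rfl) e α)

instance : IsScalarTower R (DPhi p R a b) R where
  smul_assoc r d x := by
    rw [DPhi.smul_def, mul_smul]
    exact DPhi.of_smul_self p R a b 0 (mulPiece p R a b r) (d • x)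

end Ring

/-! ### Unit modules -/

section UnitModules

variable (p : ℕ) (R : Type u) [CommRing R] (a b : ℕ)
variable (M : Type v) [AddCommGroup M] [Module (DPhi p R a b) M]

/-- The relations `(h ∘ d) ⊗ m = h ⊗ (d • m)`, for `d ∈ 𝒟⁽⁰⁾`. -/
def phiRel : AddSubgroup (piece p R a b 1 ⊗[ℤ] M) :=
  AddSubgroup.closure
    {z | ∃ (h : piece p R a b 1) (d : piece p R a b 0) (m : M),
      z = (⟨(h : AddMonoid.End R) * d, SetLike.mul_mem_graded (i := 1) (j := 0) h.2 d.2⟩ :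
          piece p R a b 1) ⊗ₜ[ℤ] m - h ⊗ₜ[ℤ] (DPhi.of p R a b 0 d • m)}

/-- `Φ^*(M) = Hom_R(F⁽⁰⁾_* R, F⁽¹⁾_* R) ⊗_{𝒟⁽⁰⁾} M`, the tensor product over the noncommutative
ring `𝒟⁽⁰⁾`. -/
abbrev PhiPullback : Type (max u v) := (piece p R a b 1 ⊗[ℤ] M) ⧸ phiRel p R a b M

/-- The map `Hom_R(F⁽⁰⁾_* R, F⁽¹⁾_* R) ⊗_ℤ M → M`, `h ⊗ m ↦ h • m`. -/
def preMap : piece p R a b 1 ⊗[ℤ] M →+ M :=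
  TensorProduct.liftAddHom
    ((Module.toAddMonoidEnd (DPhi p R a b) M).toAddMonoidHom.comp (DPhi.of p R a b 1))
    (fun n h m => by
      change DPhi.of p R a b 1 (n • h) • m = DPhi.of p R a b 1 h • (n • m)
      rw [map_zsmul, smul_comm, smul_assoc])

theorem preMap_tmul (h : piece p R a b 1) (m : M) :
    preMap p R a b M (h ⊗ₜ m) = DPhi.of p R a b 1 h • m :=
  rfl

/-- The natural map `ψ_M : Φ^*(M) → M`, `h ⊗ m ↦ h • m`. -/
def phiMap : PhiPullback p R a b M →+ M :=
  QuotientAddGroup.lift (phiRel p R a b M) (preMap p R a b M) <| by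
    rw [phiRel, AddSubgroup.closure_le]
    rintro _ ⟨h, d, m, rfl⟩
    simp only [SetLike.mem_coe, AddMonoidHom.mem_ker, map_sub, preMap_tmul, ← mul_smul,
      DPhi.of_mul_of]
    exact sub_self _

/-- `M` is unit if `ψ_M` is an isomorphism. -/
def IsUnitModule : Prop := Function.Bijective (phiMap p R a b M)

/-- Finitely generated unit modules. -/
def IsFGU : Prop := Module.Finite (DPhi p R a b) M ∧ IsUnitModule p R a b M

end UnitModules

/-! ### Localization -/

section Localization

variable (p : ℕ) (R : Type u) [CommRing R] (a b : ℕ)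
variable (M : Type v) [AddCommGroup M] [Module R M] [Module (DPhi p R a b) M]
variable [IsScalarTower R (DPhi p R a b) M]

theorem ofR_smul (r : R) (m : M) : DPhi.ofR p R a b r • m = r • m := by
  have h := smul_assoc r (1 : DPhi p R a b) m
  rwa [DPhi.smul_def, mul_one, one_smul] at h

theorem of_smul_pow {e : ℕ} (α : piece p R a b e) (k : ℕ) (x : R) (m : M) :
    DPhi.of p R a b e α • (x ^ p ^ (a + k * b) • m)
      = x ^ p ^ (a + (e + k) * b) • (DPhi.of p R a b e α • m) := by
  rw [← ofR_smul p R a b, ← ofR_smul p R a b, ← mul_smul, ← mul_smul]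
  congr 1
  change _ * DPhi.of p R a b 0 _ = DPhi.of p R a b 0 _ * _
  rw [DPhi.of_mul_of, DPhi.of_mul_of]
  refine DPhi.of_congr p R a b (add_comm _ _) _ _ ?_
  ext u
  exact piece_apply' p R a b α k x u

theorem of_smul_pow' {e : ℕ} (α : piece p R a b e) (x : R) (m : M) :
    DPhi.of p R a b e α • (x ^ p ^ a • m)
      = x ^ p ^ (a + e * b) • (DPhi.of p R a b e α • m) := by
  simpa using of_smul_pow p R a b M α 0 x m

theorem map_smul_of_homogeneous {N N' : Type*} [AddCommGroup N] [AddCommGroup N']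
    [Module (DPhi p R a b) N] [Module (DPhi p R a b) N'] (g : N →+ N')
    (h : ∀ (e : ℕ) (α : piece p R a b e) (x : N),
      g (DPhi.of p R a b e α • x) = DPhi.of p R a b e α • g x)
    (d : DPhi p R a b) (x : N) : g (d • x) = d • g x := by
  let l : DPhi p R a b →+ N' := g.comp ((smulAddHom (DPhi p R a b) N).flip x)
  let r : DPhi p R a b →+ N' := (smulAddHom (DPhi p R a b) N').flip (g x)
  have : l = r := DirectSum.addHom_ext (β := fun e => piece p R a b e) fun e α => h e α x
  exact DFunLike.congr_fun this d

variable [Fact p.Prime] (W : Submonoid R)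

theorem pow_pred_mul (n : ℕ) (x : R) : x ^ (p ^ n - 1) * x = x ^ p ^ n := by
  rw [← pow_succ, Nat.sub_add_cancel (Nat.pow_pos (Fact.out : p.Prime).pos)]

/-- The action of `α ∈ Hom_R(F⁽⁰⁾_* R, F⁽ᵉ⁾_* R)` on `W⁻¹M`:
`α • (m / w) = (α • w ^ (p ^ a - 1) m) / w ^ (p ^ (a + e b))`. -/
def locFun {e : ℕ} (α : piece p R a b e) (x : LocalizedModule W M) : LocalizedModule W M :=
  x.liftOn (fun y => LocalizedModule.mk
    (DPhi.of p R a b e α • ((y.2 : R) ^ (p ^ a - 1) • y.1)) (y.2 ^ p ^ (a + e * b))) <| by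
    rintro ⟨m, s⟩ ⟨m', s'⟩ ⟨u, hu⟩
    rw [LocalizedModule.mk_eq]
    refine ⟨u ^ p ^ (a + e * b), ?_⟩
    simp only [Submonoid.smul_def, SubmonoidClass.coe_pow] at hu ⊢
    rw [← of_smul_pow', ← of_smul_pow', ← of_smul_pow', ← of_smul_pow']
    congr 1
    rw [← pow_pred_mul p R a u, ← pow_pred_mul p R a s, ← pow_pred_mul p R a s']
    have := congrArg (fun z => ((u : R) ^ (p ^ a - 1) * (s : R) ^ (p ^ a - 1) *
      (s' : R) ^ (p ^ a - 1)) • z) hu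
    simp only [smul_smul] at this ⊢
    convert this using 2 <;> ring

theorem locFun_mk {e : ℕ} (α : piece p R a b e) (m : M) (s : W) :
    locFun p R a b M W α (LocalizedModule.mk m s) = LocalizedModule.mk
      (DPhi.of p R a b e α • ((s : R) ^ (p ^ a - 1) • m)) (s ^ p ^ (a + e * b)) :=
  LocalizedModule.liftOn_mk _ _ _

theorem locFun_add {e : ℕ} (α : piece p R a b e) (x y : LocalizedModule W M) :
    locFun p R a b M W α (x + y) = locFun p R a b M W α x + locFun p R a b M W α y := by
  induction x, y using LocalizedModule.induction_on₂ with
  | h m m' s s' =>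
    rw [LocalizedModule.mk_add_mk, locFun_mk, locFun_mk, locFun_mk, LocalizedModule.mk_add_mk]
    rw [mul_pow]
    congr 1
    simp only [Submonoid.smul_def, SubmonoidClass.coe_pow, Submonoid.coe_mul]
    rw [← of_smul_pow', ← of_smul_pow', ← smul_add]
    congr 1
    rw [← pow_pred_mul p R a s, ← pow_pred_mul p R a s', smul_add]
    simp only [smul_smul]
    congr 2 <;> ring

/-- The action of a homogeneous element of `𝒟⁽⁰⁾⟨Φ⟩` on `W⁻¹M`, additive in both variables. -/
def locHom (e : ℕ) : piece p R a b e →+ AddMonoid.End (LocalizedModule W M) :=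
  AddMonoidHom.mk' (fun α => AddMonoidHom.mk' (locFun p R a b M W α) (locFun_add p R a b M W α))
    (fun α β => by
      ext x
      change locFun p R a b M W (α + β) x = locFun p R a b M W α x + locFun p R a b M W β x
      induction x with
      | h m s =>
        rw [locFun_mk, locFun_mk, locFun_mk, map_add, add_smul, LocalizedModule.mk_add_mk,
          LocalizedModule.mk_eq]
        refine ⟨1, ?_⟩
        simp only [smul_add, smul_smul])

/-- The action of `𝒟⁽⁰⁾⟨Φ⟩` on `W⁻¹M`. -/
def locAct : DPhi p R a b →+* AddMonoid.End (LocalizedModule W M) :=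
  DirectSum.toSemiring (A := fun e => piece p R a b e) (locHom p R a b M W)
    (by
      ext x
      change locFun p R a b M W _ x = x
      induction x with
      | h m s =>
        rw [locFun_mk]
        change LocalizedModule.mk ((1 : DPhi p R a b) • _) _ = _
        rw [one_smul, LocalizedModule.mk_eq]
        refine ⟨1, ?_⟩
        simp only [Submonoid.smul_def, SubmonoidClass.coe_pow, smul_smul]
        congr 1
        rw [zero_mul, add_zero, ← pow_pred_mul p R a s]
        simp [mul_comm])
    (fun {i j} α β => by
      ext x
      change locFun p R a b M W _ x = locFun p R a b M W α (locFun p R a b M W β x)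
      induction x with
      | h m s =>
        rw [locFun_mk, locFun_mk, locFun_mk]
        change LocalizedModule.mk (DPhi.of p R a b (i + j) ⟨(α : AddMonoid.End R) * β, _⟩ • _) _ = _
        rw [← DPhi.of_mul_of, mul_smul, LocalizedModule.mk_eq]
        refine ⟨1, ?_⟩
        simp only [Submonoid.smul_def, SubmonoidClass.coe_pow, one_smul]
        rw [← pow_mul, ← pow_mul, mul_comm (p ^ (a + j * b)) (p ^ a - 1), pow_mul _ (p ^ a - 1),
          of_smul_pow, smul_smul (_ : R) (_ : R), ← pow_mul, ← pow_add]
        congr 2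
        obtain ⟨q, hq⟩ : ∃ q, p ^ a = q + 1 :=
          ⟨p ^ a - 1, (Nat.sub_add_cancel (Nat.pow_pos (Fact.out : p.Prime).pos)).symm⟩
        simp only [pow_add, add_mul, hq, Nat.add_sub_cancel]
        ring)

theorem locAct_of {e : ℕ} (α : piece p R a b e) :
    locAct p R a b M W (DPhi.of p R a b e α) = locHom p R a b M W e α := by
  unfold locAct
  exact DirectSum.toSemiring_of (A := fun e => piece p R a b e) (locHom p R a b M W) _ _ e α

/-- `inst` is a `𝒟⁽⁰⁾⟨Φ⟩`-module structure on `W⁻¹M` which extends its `R`-module structure and for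
which the localization map `M → W⁻¹M` is `𝒟⁽⁰⁾⟨Φ⟩`-linear. -/
def IsLocStructure (inst : Module (DPhi p R a b) (LocalizedModule W M)) : Prop :=
  (∀ (r : R) (x : LocalizedModule W M), DPhi.ofR p R a b r • x = r • x) ∧
  ∀ (d : DPhi p R a b) (m : M),
    d • LocalizedModule.mkLinearMap W M m = LocalizedModule.mkLinearMap W M (d • m)

/-- The `𝒟⁽⁰⁾⟨Φ⟩`-module `W⁻¹M`. -/
instance locModule : Module (DPhi p R a b) (LocalizedModule W M) :=
  Module.compHom (R := AddMonoid.End (LocalizedModule W M)) _ (locAct p R a b M W)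

theorem of_smul_mk {e : ℕ} (α : piece p R a b e) (m : M) (s : W) :
    DPhi.of p R a b e α • LocalizedModule.mk m s = LocalizedModule.mk
      (DPhi.of p R a b e α • ((s : R) ^ (p ^ a - 1) • m)) (s ^ p ^ (a + e * b)) := by
  rw [← locFun_mk]
  exact congrArg (fun φ : AddMonoid.End (LocalizedModule W M) => φ (LocalizedModule.mk m s))
    (locAct_of p R a b M W α)

instance : IsScalarTower R (DPhi p R a b) (LocalizedModule W M) where
  smul_assoc r d x := by
    rw [DPhi.smul_def, mul_smul]
    generalize d • x = y
    change DPhi.of p R a b 0 _ • y = r • y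
    induction y with
    | h m s =>
      rw [of_smul_mk, LocalizedModule.smul'_mk, LocalizedModule.mk_eq]
      refine ⟨1, ?_⟩
      change (1 : W) • s • (DPhi.ofR p R a b r • _) = _
      simp only [ofR_smul, Submonoid.smul_def, SubmonoidClass.coe_pow, smul_smul, zero_mul,
        add_zero, ← pow_pred_mul p R a]
      congr 1
      ring

/-- The localization map `W⁻¹M → W'⁻¹M`, when `W` acts invertibly on `W'⁻¹M`. -/
def locMap (W' : Submonoid R)
    (h : ∀ w : W, IsUnit (algebraMap R (Module.End R (LocalizedModule W' M)) w)) :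
    LocalizedModule W M →ₗ[DPhi p R a b] LocalizedModule W' M where
  toFun := LocalizedModule.lift W (LocalizedModule.mkLinearMap W' M) h
  map_add' := map_add _
  map_smul' d x := by
    refine map_smul_of_homogeneous p R a b
      (LocalizedModule.lift W (LocalizedModule.mkLinearMap W' M) h).toAddMonoidHom ?_ d x
    intro e α x
    set g := LocalizedModule.lift W (LocalizedModule.mkLinearMap W' M) h with hg
    have hgmk (m : M) : g (LocalizedModule.mk m 1) = LocalizedModule.mk m 1 := by
      have := LinearMap.congr_fun
        (LocalizedModule.lift_comp W (LocalizedModule.mkLinearMap W' M) h) m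
      exact this
    have hmk1 (V : Submonoid R) (m : M) :
        DPhi.of p R a b e α • (LocalizedModule.mk m 1 : LocalizedModule V M)
          = LocalizedModule.mk (DPhi.of p R a b e α • m) 1 := by
      rw [of_smul_mk]; simp
    change g _ = _ • g x
    induction x with
    | h m s =>
      have key : Function.Injective
          (fun y : LocalizedModule W' M => (s : R) ^ p ^ (a + e * b) • y) := by
        exact ((Module.End.isUnit_iff _).1 (h (s ^ p ^ (a + e * b)))).1
      apply key
      have h1 : (s : R) • (LocalizedModule.mk m s : LocalizedModule W M)
          = LocalizedModule.mk m 1 := by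
        rw [LocalizedModule.smul'_mk]
        exact LocalizedModule.mk_cancel s m
      change (s : R) ^ p ^ (a + e * b) • g _ = (s : R) ^ p ^ (a + e * b) • _
      rw [← map_smul, ← of_smul_pow', ← of_smul_pow', ← map_smul, ← pow_pred_mul p R a, mul_smul,
        h1, LocalizedModule.smul'_mk, hmk1, hgmk, hgmk, hmk1]

end Localization

/-! ### The Čech complex -/

section Cech

variable (p : ℕ) [Fact p.Prime] {R : Type u} [CommRing R] (a b : ℕ)
variable {n : ℕ} (f : Fin n → R)
variable (M : Type v) [AddCommGroup M] [Module R M] [Module (DPhi p R a b) M]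
variable [IsScalarTower R (DPhi p R a b) M]

/-- `M[1 / f_S]`, where `f_S = ∏_{i ∈ S} f_i`. -/
abbrev CechLoc (S : Finset (Fin n)) : Type (max u v) :=
  LocalizedModule (Submonoid.powers (∏ i ∈ S, f i)) M

theorem cech_isUnit {S T : Finset (Fin n)} (h : S ⊆ T) (w : Submonoid.powers (∏ i ∈ S, f i)) :
    IsUnit (algebraMap R (Module.End R (CechLoc f M T)) w) := by
  obtain ⟨_, k, rfl⟩ := w
  have hT := IsLocalizedModule.map_units (LocalizedModule.mkLinearMap
    (Submonoid.powers (∏ i ∈ T, f i)) M) ⟨∏ i ∈ T, f i, Submonoid.mem_powers _⟩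
  obtain ⟨c, hc⟩ := Finset.prod_dvd_prod_of_subset S T f h
  have hT' : IsUnit (algebraMap R (Module.End R (CechLoc f M T)) (∏ i ∈ S, f i) *
      algebraMap R (Module.End R (CechLoc f M T)) c) := by
    rw [← map_mul, ← hc]
    exact hT
  have hc : Commute (algebraMap R (Module.End R (CechLoc f M T)) (∏ i ∈ S, f i))
      (algebraMap R (Module.End R (CechLoc f M T)) c) := Algebra.commutes _ _
  have := (hc.isUnit_mul_iff.1 hT').1
  change IsUnit (algebraMap R (Module.End R (CechLoc f M T)) ((∏ i ∈ S, f i) ^ k))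
  rw [map_pow]
  exact this.pow k

/-- The `k`-th term of the Čech complex: the product of the `M[1 / f_S]` over all
`S ⊆ {1, …, n}` with `k` elements. -/
abbrev CechTerm (k : ℕ) : Type (max u v) :=
  (S : {S : Finset (Fin n) // S.card = k}) → CechLoc f M S.1

/-- The Čech differential,
`(d x)_T = ∑_{j ∈ T} (-1) ^ #{i ∈ T | i < j} • (the image of x_{T \ {j}} in M[1 / f_T])`. -/
def cechD (k : ℕ) : CechTerm f M k →ₗ[DPhi p R a b] CechTerm f M (k + 1) :=
  LinearMap.pi fun T => ∑ j : T.1, (-1 : ℤ) ^ (T.1.filter (· < j.1)).card •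
    (locMap p R a b M _ _ (cech_isUnit f M (Finset.erase_subset j.1 T.1)) ∘ₗ
      LinearMap.proj (φ := fun S : {S : Finset (Fin n) // S.card = k} => CechLoc f M S.1)
        ⟨T.1.erase j.1, by rw [Finset.card_erase_of_mem j.2, T.2, Nat.add_sub_cancel]⟩)

/-- The image of the differential into the `k`-th term. -/
def cechB : (k : ℕ) → Submodule (DPhi p R a b) (CechTerm f M k)
  | 0 => ⊥
  | k + 1 => LinearMap.range (cechD p a b f M k)

/-- The `k`-th cohomology of the Čech complex, as a `𝒟⁽⁰⁾⟨Φ⟩`-module. -/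
abbrev CechCohomology (k : ℕ) : Type (max u v) :=
  LinearMap.ker (cechD p a b f M k) ⧸
    (cechB p a b f M k).comap (LinearMap.ker (cechD p a b f M k)).subtype

end Cech

end FRep

end

/-!
Write `F⁽ᵉ⁾ = F^(a+eb)`.

The whole argument rests on one consequence of the hypotheses: `F⁽¹⁾_* R` is a direct summand of a
finite power of `F⁽⁰⁾_* R` (`FRep.nonempty_frobSplitting`). This is so over every completed stalk
`S`, because `F⁽¹⁾_* S` decomposes into indecomposables, each of which is a summand of `F⁽⁰⁾_* S`.
Since `F^e_*` commutes with localization and, `R` being `F`-finite, with completion, and since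
`Hom` commutes with flat base change, the ideal of those `r ∈ R` for which `r • id` is a sum of
endomorphisms of `F⁽¹⁾_* R` factoring through `F⁽⁰⁾_* R` is not contained in any maximal ideal.

Thus there are `φᵢ : F⁽⁰⁾_* R → F⁽¹⁾_* R` and `ψᵢ : F⁽¹⁾_* R → F⁽⁰⁾_* R` with `∑ φᵢ ψᵢ = 1`. A
module `M` is unit if and only if it carries operators `Ψᵢ` with `Ψᵢ (h • m) = (ψᵢ h) • m` for `h`
of degree one and `∑ φᵢ • Ψᵢ m = m` (`FRep.isUnitModule_iff_nonempty_descent`). In this form it is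
plain that `R` is unit; that unit modules are stable under localization, the `Ψᵢ` being `R`-linear
maps `F⁽¹⁾_* M → F⁽⁰⁾_* M`; and, since linear maps commute with the `Ψᵢ`, that they are stable
under finite products, kernels, images and the quotients occurring in cohomology.

Finite generation is controlled by a root: a `𝒟⁽⁰⁾`-submodule `L` of `M`, finitely generated over
`R`, stable under the `Ψᵢ`, and whose multiples by elements of `𝒟⁽⁰⁾⟨Φ⟩` exhaust `M`
(`FRep.Descent.exists_root`). A submodule of `M` stable under the `Ψᵢ` is generated by its
intersection with `L`, because the `Ψᵢ` lower the degree in which an element is obtained from `L`;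
so it is finitely generated (`FRep.Descent.finite_submodule`). The fractions `l / f ^ (p ^ a)` with
`l ∈ L` generate `M[1/f]` (`FRep.Descent.finite_away`). Hence the terms of the Čech complex of a
finitely generated unit module, and then its cohomology modules, are finitely generated unit.

It remains to identify local cohomology with Čech cohomology `R`-linearly
(`FRep.nonempty_localCohomology_equiv_cech`), after which the module structure is transported. Both
are the `I`-power torsion in degree `0`, and both allow dimension shifting along
`0 → M → E → C → 0` with `E` injective: for `Ext` this is immediate, and for the Čech complex it
holds because the Čech complex of an injective module over a noetherian ring is exact in positive
degrees (`FRep.ker_cechL_le_of_baer`).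
-/

noncomputable section
namespace FRep
open DirectSum TensorProduct

/-! ### Splittings of the Frobenius and unit modules -/

section Splitting

variable (p : ℕ) (R : Type u) [CommRing R] (a b : ℕ)

variable {p R} in
theorem frobHom_add {i j : ℕ} {β : AddMonoid.End R} (hβ : β ∈ frobHom p R i j) (c : ℕ) :
    β ∈ frobHom p R (i + c) (j + c) := fun x u => by
  have := hβ (x ^ p ^ c) u
  rwa [← pow_mul, ← pow_mul, ← pow_add, ← pow_add, add_comm c, add_comm c] at this

variable {p R} in
theorem frobHom_mul {i j k : ℕ} {β α : AddMonoid.End R} (hβ : β ∈ frobHom p R j k)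
    (hα : α ∈ frobHom p R i j) : β * α ∈ frobHom p R i k := fun x u => by
  change β (α _) = _ * β (α u)
  rw [hα, hβ]

/-- A finite family of pairs of maps `ψᵢ : F⁽¹⁾_* R → F⁽⁰⁾_* R` and `φᵢ : F⁽⁰⁾_* R → F⁽¹⁾_* R` with
`∑ φᵢ ∘ ψᵢ = 1`; it exhibits `F⁽¹⁾_* R` as a direct summand of a finite power of `F⁽⁰⁾_* R`. -/
structure FrobSplitting where
  n : ℕ
  φ : Fin n → piece p R a b 1
  ψ : Fin n → AddMonoid.End R
  ψ_mem : ∀ i, ψ i ∈ frobHom p R (a + 1 * b) a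
  sum_eq : ∑ i, (φ i : AddMonoid.End R) * ψ i = 1

variable {p R a b}

namespace FrobSplitting

variable (σ : FrobSplitting p R a b)

/-- Composition with `ψᵢ`, as a map `Hom(F⁽⁰⁾_* R, F⁽ᵉ⁺¹⁾_* R) → Hom(F⁽⁰⁾_* R, F⁽ᵉ⁾_* R)`. -/
def lower (i : Fin σ.n) (e : ℕ) : piece p R a b (e + 1) →+ piece p R a b e :=
  AddMonoidHom.mk' (fun h => ⟨σ.ψ i * h, by
    refine frobHom_mul (frobHom_add (σ.ψ_mem i) (e * b)) ?_
    have := h.2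
    change _ ∈ frobHom p R a (a + (e + 1) * b) at this
    rwa [show a + (e + 1) * b = a + 1 * b + e * b by ring] at this⟩) (fun g h => by
      ext1
      exact mul_add _ _ _)

theorem coe_lower (i : Fin σ.n) (e : ℕ) (h : piece p R a b (e + 1)) :
    (σ.lower i e h : AddMonoid.End R) = σ.ψ i * h := rfl

/-- `Hom(F⁽⁰⁾_* R, F⁽ᵉ⁺¹⁾_* R)` is generated on the left by the `φᵢ` over
`Hom(F⁽⁰⁾_* R, F⁽ᵉ⁾_* R)`. -/
theorem sum_of_mul_lower {e : ℕ} (h : piece p R a b (e + 1)) :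
    ∑ i, DPhi.of p R a b 1 (σ.φ i) * DPhi.of p R a b e (σ.lower i e h) =
      DPhi.of p R a b (e + 1) h := by
  simp only [DPhi.of_mul_of]
  rw [← map_sum]
  refine DPhi.of_congr p R a b (add_comm 1 e) _ _ ?_
  rw [AddSubgroup.val_finsetSum]
  simp only [coe_lower, ← mul_assoc]
  rw [← Finset.sum_mul, σ.sum_eq, one_mul]

end FrobSplitting

end Splitting

section Descent

variable {p : ℕ} {R : Type u} [CommRing R] {a b : ℕ}

/-- Operators `Ψᵢ` on `M` playing the role of the action of `ψᵢ : F⁽¹⁾_* R → F⁽⁰⁾_* R`. Such a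
family exists precisely when `M` is unit. -/
structure Descent (σ : FrobSplitting p R a b) (M : Type v) [AddCommGroup M]
    [Module (DPhi p R a b) M] where
  Ψ : Fin σ.n → M →+ M
  Ψ_smul : ∀ i (h : piece p R a b 1) (m : M),
    Ψ i (DPhi.of p R a b 1 h • m) = DPhi.of p R a b 0 (σ.lower i 0 h) • m
  sum_smul : ∀ m, ∑ i, DPhi.of p R a b 1 (σ.φ i) • Ψ i m = m

variable (σ : FrobSplitting p R a b) {M N : Type v} [AddCommGroup M] [AddCommGroup N]
variable [Module (DPhi p R a b) M] [Module (DPhi p R a b) N]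

/-- The map `Hom(F⁽⁰⁾_* R, F⁽¹⁾_* R) ⊗ M → M`, `h ⊗ m ↦ (ψᵢ ∘ h) • m`. -/
def lowerMap (i : Fin σ.n) : PhiPullback p R a b M →+ M :=
  QuotientAddGroup.lift (phiRel p R a b M) (TensorProduct.liftAddHom
    (((Module.toAddMonoidEnd (DPhi p R a b) M).toAddMonoidHom.comp (DPhi.of p R a b 0)).comp
      (σ.lower i 0))
    (fun n h m => by
      change DPhi.of p R a b 0 (σ.lower i 0 (n • h)) • m =
        DPhi.of p R a b 0 (σ.lower i 0 h) • (n • m)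
      rw [map_zsmul, map_zsmul, smul_comm, smul_assoc])) <| by
    rw [phiRel, AddSubgroup.closure_le]
    rintro _ ⟨h, d, m, rfl⟩
    rw [SetLike.mem_coe, AddMonoidHom.mem_ker, map_sub, sub_eq_zero]
    change DPhi.of p R a b 0 (σ.lower i 0 _) • m =
      DPhi.of p R a b 0 (σ.lower i 0 h) • (DPhi.of p R a b 0 d • m)
    rw [← mul_smul, DPhi.of_mul_of]
    congr 1

theorem lowerMap_mk (i : Fin σ.n) (h : piece p R a b 1) (m : M) :
    lowerMap σ i (QuotientAddGroup.mk (h ⊗ₜ m)) = DPhi.of p R a b 0 (σ.lower i 0 h) • m := rfl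

theorem phiMap_mk (h : piece p R a b 1) (m : M) :
    phiMap p R a b M (QuotientAddGroup.mk (h ⊗ₜ m)) = DPhi.of p R a b 1 h • m := rfl

/-- In `Φ^* M` one has `h ⊗ m = ∑ φᵢ ⊗ (ψᵢ ∘ h) • m`. -/
theorem sum_mk_lowerMap (x : PhiPullback p R a b M) :
    ∑ i, (QuotientAddGroup.mk (σ.φ i ⊗ₜ[ℤ] lowerMap σ i x) : PhiPullback p R a b M) = x := by
  let g : PhiPullback p R a b M →+ PhiPullback p R a b M :=
    ∑ i, (QuotientAddGroup.mk' (phiRel p R a b M)).comp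
      (((TensorProduct.mk ℤ (piece p R a b 1) M (σ.φ i)).toAddMonoidHom).comp (lowerMap σ i))
  suffices g = AddMonoidHom.id _ by
    have h := DFunLike.congr_fun this x
    simpa [g] using h
  apply QuotientAddGroup.addMonoidHom_ext
  apply AddMonoidHom.toIntLinearMap_injective
  apply TensorProduct.ext'
  intro h m
  have h1 : g (QuotientAddGroup.mk (h ⊗ₜ m)) = ∑ i, (QuotientAddGroup.mk
      (σ.φ i ⊗ₜ[ℤ] (DPhi.of p R a b 0 (σ.lower i 0 h) • m)) : PhiPullback p R a b M) := by
    simp [g, lowerMap_mk]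
  change g (QuotientAddGroup.mk (h ⊗ₜ m)) = (QuotientAddGroup.mk (h ⊗ₜ m))
  rw [h1]
  have h2 (i : Fin σ.n) : (QuotientAddGroup.mk
      (σ.φ i ⊗ₜ[ℤ] (DPhi.of p R a b 0 (σ.lower i 0 h) • m)) : PhiPullback p R a b M) =
      QuotientAddGroup.mk ((⟨(σ.φ i : AddMonoid.End R) * σ.lower i 0 h,
        SetLike.mul_mem_graded (i := 1) (j := 0) (σ.φ i).2 (σ.lower i 0 h).2⟩ :
          piece p R a b 1) ⊗ₜ[ℤ] m) := by
    rw [eq_comm, QuotientAddGroup.eq_iff_sub_mem]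
    exact AddSubgroup.subset_closure ⟨_, _, _, rfl⟩
  simp only [h2]
  rw [← QuotientAddGroup.mk_sum, ← TensorProduct.sum_tmul]
  congr 2
  ext1
  rw [AddSubgroup.val_finsetSum]
  simp only [FrobSplitting.coe_lower, ← mul_assoc]
  rw [← Finset.sum_mul, σ.sum_eq, one_mul]

variable (M) in
/-- `M` is unit if and only if it has operators `Ψᵢ`: on a unit module they are induced by the maps
`h ⊗ m ↦ (ψᵢ ∘ h) • m`, and conversely `m ↦ ∑ φᵢ ⊗ Ψᵢ m` inverts the natural map. -/
theorem isUnitModule_iff_nonempty_descent :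
    IsUnitModule p R a b M ↔ Nonempty (Descent σ M) := by
  constructor
  · intro h
    obtain ⟨e, he⟩ : ∃ e : PhiPullback p R a b M ≃+ M, ∀ x, e x = phiMap p R a b M x :=
      ⟨AddEquiv.ofBijective _ h, fun x => AddEquiv.ofBijective_apply _ _ x⟩
    refine ⟨⟨fun i => (lowerMap σ i).comp e.symm.toAddMonoidHom, fun i g m => ?_, fun m => ?_⟩⟩
    · change lowerMap σ i (e.symm _) = _
      rw [← lowerMap_mk, ← phiMap_mk, ← he, e.symm_apply_apply]
    · obtain ⟨x, rfl⟩ := e.surjective m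
      conv_rhs => rw [← sum_mk_lowerMap σ x]
      simp only [map_sum]
      refine Finset.sum_congr rfl fun i _ => ?_
      change DPhi.of p R a b 1 (σ.φ i) • lowerMap σ i (e.symm (e x)) = _
      rw [e.symm_apply_apply, he, phiMap_mk]
  · rintro ⟨D⟩
    have key (i : Fin σ.n) (x : PhiPullback p R a b M) :
        D.Ψ i (phiMap p R a b M x) = lowerMap σ i x := by
      suffices (D.Ψ i).comp (phiMap p R a b M) = lowerMap σ i from DFunLike.congr_fun this x
      apply QuotientAddGroup.addMonoidHom_ext
      apply AddMonoidHom.toIntLinearMap_injective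
      apply TensorProduct.ext'
      intro h m
      exact D.Ψ_smul i h m
    constructor
    · intro x y hxy
      rw [← sum_mk_lowerMap σ x, ← sum_mk_lowerMap σ y]
      simp only [← key, hxy]
    · intro m
      refine ⟨∑ i, QuotientAddGroup.mk (σ.φ i ⊗ₜ[ℤ] D.Ψ i m), ?_⟩
      simp only [map_sum, phiMap_mk]
      exact D.sum_smul m

namespace Descent

variable {σ}

/-- Linear maps between unit modules commute with the operators `Ψᵢ`. -/
theorem map_Ψ (D : Descent σ M) (E : Descent σ N) (f : M →ₗ[DPhi p R a b] N) (i : Fin σ.n)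
    (m : M) : f (D.Ψ i m) = E.Ψ i (f m) := by
  conv_lhs => rw [← D.sum_smul m]
  conv_rhs => rw [← D.sum_smul m]
  simp only [map_sum, map_smul, Ψ_smul]

/-- The compatibility of the `Ψᵢ` with the elements of degree one extends to all positive degrees,
as these are generated by the `φᵢ` over the elements of degree one less. -/
theorem Ψ_of_succ_smul (D : Descent σ M) (i : Fin σ.n) {e : ℕ} (h : piece p R a b (e + 1))
    (m : M) : D.Ψ i (DPhi.of p R a b (e + 1) h • m) = DPhi.of p R a b e (σ.lower i e h) • m := by
  rw [← σ.sum_of_mul_lower h, Finset.sum_smul, map_sum]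
  simp only [mul_smul, Ψ_smul]
  simp only [← mul_smul, DPhi.of_mul_of]
  rw [← Finset.sum_smul, ← map_sum]
  congr 1
  refine DPhi.of_congr p R a b (zero_add e) _ _ ?_
  rw [AddSubgroup.val_finsetSum]
  simp only [FrobSplitting.coe_lower, mul_assoc]
  rw [← Finset.mul_sum]
  simp only [← mul_assoc]
  rw [← Finset.sum_mul, σ.sum_eq, one_mul]

/-- A submodule stable under the `Ψᵢ` is unit. -/
def restrict (D : Descent σ M) (K : Submodule (DPhi p R a b) M)
    (hK : ∀ i, ∀ m ∈ K, D.Ψ i m ∈ K) : Descent σ K where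
  Ψ i := ((D.Ψ i).comp K.subtype.toAddMonoidHom).codRestrict K.toAddSubgroup
    (fun m => hK i m m.2)
  Ψ_smul i h m := Subtype.ext (D.Ψ_smul i h m)
  sum_smul m := Subtype.ext (by
    rw [AddSubmonoidClass.coe_finsetSum]
    exact D.sum_smul m)

/-- The quotient by a submodule stable under the `Ψᵢ` is unit. -/
def quotient (D : Descent σ M) (K : Submodule (DPhi p R a b) M)
    (hK : ∀ i, ∀ m ∈ K, D.Ψ i m ∈ K) : Descent σ (M ⧸ K) where
  Ψ i := QuotientAddGroup.map K.toAddSubgroup K.toAddSubgroup (D.Ψ i) (fun m hm => hK i m hm)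
  Ψ_smul i h m := by
    obtain ⟨m, rfl⟩ := K.mkQ_surjective m
    exact congrArg K.mkQ (D.Ψ_smul i h m)
  sum_smul m := by
    obtain ⟨m, rfl⟩ := K.mkQ_surjective m
    conv_rhs => rw [← D.sum_smul m]
    rw [map_sum]
    rfl

/-- Finite products of unit modules are unit. -/
def pi {ι : Type*} {M : ι → Type v} [∀ i, AddCommGroup (M i)] [∀ i, Module (DPhi p R a b) (M i)]
    (D : ∀ j, Descent σ (M j)) : Descent σ (∀ j, M j) where
  Ψ i := AddMonoidHom.mk' (fun m j => (D j).Ψ i (m j)) (fun x y => by ext; simp)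
  Ψ_smul i h m := funext fun j => (D j).Ψ_smul i h (m j)
  sum_smul m := funext fun j => by
    rw [Finset.sum_apply]
    exact (D j).sum_smul (m j)

/-- Transport along an isomorphism. -/
def ofEquiv (D : Descent σ M) (e : M ≃ₗ[DPhi p R a b] N) : Descent σ N where
  Ψ i := (e.toLinearMap.toAddMonoidHom.comp (D.Ψ i)).comp e.symm.toLinearMap.toAddMonoidHom
  Ψ_smul i h m := by
    change e (D.Ψ i (e.symm (_ • m))) = _
    rw [map_smul, D.Ψ_smul, map_smul, e.apply_symm_apply]
  sum_smul m := by
    change ∑ i, _ • e (D.Ψ i (e.symm m)) = m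
    simp only [← map_smul]
    rw [← map_sum, D.sum_smul, e.apply_symm_apply]

end Descent

end Descent

/-- `R` is unit: its operators `Ψᵢ` are the `ψᵢ` themselves. -/
def Descent.self {p : ℕ} {R : Type u} [CommRing R] {a b : ℕ} (σ : FrobSplitting p R a b) :
    Descent σ R where
  Ψ := σ.ψ
  Ψ_smul i h x := by
    rw [DPhi.of_smul_self, DPhi.of_smul_self]
    rfl
  sum_smul x := by
    simp only [DPhi.of_smul_self]
    have := congrArg (fun φ : AddMonoid.End R => φ x) σ.sum_eq
    refine Eq.trans ?_ this
    exact (AddMonoidHom.finsetSum_apply (N := R)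
      (fun i => (σ.φ i : AddMonoid.End R) * σ.ψ i) Finset.univ x).symm

theorem isFGU_self {p : ℕ} {R : Type u} [CommRing R] {a b : ℕ} (σ : FrobSplitting p R a b) :
    IsFGU p R a b R := by
  refine ⟨⟨{1}, ?_⟩, (isUnitModule_iff_nonempty_descent σ R).2 ⟨.self σ⟩⟩
  rw [eq_top_iff]
  intro r _
  have h := (Submodule.span (DPhi p R a b) {(1 : R)}).smul_mem (DPhi.ofR p R a b r)
    (Submodule.mem_span_singleton_self 1)
  rw [ofR_smul, smul_eq_mul, mul_one] at h
  simpa using h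

end FRep
end

noncomputable section
namespace FRep
open DirectSum TensorProduct

/-! ### Finite generation of unit modules -/

section Composition

variable {p : ℕ} {R : Type u} [CommRing R] {a b : ℕ}

/-- Composition of homogeneous elements. -/
def compPiece {i j k : ℕ} (h : i + j = k) (α : piece p R a b i) (β : piece p R a b j) :
    piece p R a b k :=
  ⟨(α : AddMonoid.End R) * β, h ▸ SetLike.mul_mem_graded α.2 β.2⟩

theorem of_mul_of_eq {i j k : ℕ} (h : i + j = k) (α : piece p R a b i) (β : piece p R a b j) :
    DPhi.of p R a b i α * DPhi.of p R a b j β = DPhi.of p R a b k (compPiece h α β) := by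
  subst h
  exact DPhi.of_mul_of p R a b α β

theorem of_smul_of_smul {M : Type v} [AddCommGroup M] [Module (DPhi p R a b) M] {i j k : ℕ}
    (h : i + j = k) (α : piece p R a b i) (β : piece p R a b j) (m : M) :
    DPhi.of p R a b i α • DPhi.of p R a b j β • m =
      DPhi.of p R a b k (compPiece h α β) • m := by
  rw [← mul_smul, of_mul_of_eq h]

theorem smul_of_smul {M : Type v} [AddCommGroup M] [Module R M] [Module (DPhi p R a b) M]
    [IsScalarTower R (DPhi p R a b) M] {e : ℕ} (r : R) (α : piece p R a b e) (m : M) :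
    r • DPhi.of p R a b e α • m =
      DPhi.of p R a b e (compPiece (zero_add e) (mulPiece p R a b r) α) • m := by
  rw [← ofR_smul p R a b, ← of_smul_of_smul (zero_add e)]
  rfl

end Composition

section PieceMul

variable {p : ℕ} {R : Type u} [CommRing R] {a b : ℕ}
variable {M : Type v} [AddCommGroup M] [Module (DPhi p R a b) M]

/-- The subgroup generated by the `h • l`, with `h` homogeneous of degree `e` and `l ∈ L`. -/
def pieceMul (p : ℕ) (R : Type u) [CommRing R] (a b : ℕ) [Module (DPhi p R a b) M]
    (e : ℕ) (L : Set M) : AddSubgroup M :=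
  AddSubgroup.closure {z | ∃ (α : piece p R a b e), ∃ l ∈ L, DPhi.of p R a b e α • l = z}

theorem of_smul_mem_pieceMul {e : ℕ} {L : Set M} (α : piece p R a b e) {l : M} (hl : l ∈ L) :
    DPhi.of p R a b e α • l ∈ pieceMul p R a b e L :=
  AddSubgroup.subset_closure ⟨α, l, hl, rfl⟩

theorem smul_mem_pieceMul [Module R M] [IsScalarTower R (DPhi p R a b) M] {e : ℕ} {L : Set M}
    (r : R) {m : M} (hm : m ∈ pieceMul p R a b e L) : r • m ∈ pieceMul p R a b e L := by
  induction hm using AddSubgroup.closure_induction with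
  | mem x hx =>
    obtain ⟨α, l, hl, rfl⟩ := hx
    rw [smul_of_smul]
    exact of_smul_mem_pieceMul _ hl
  | zero => rw [smul_zero]; exact zero_mem _
  | add x y _ _ hx hy => rw [smul_add]; exact add_mem hx hy
  | neg x _ hx => rw [smul_neg]; exact neg_mem hx

variable {σ : FrobSplitting p R a b}

theorem pieceMul_mono (D : Descent σ M) {L : Set M} (hL : ∀ i, ∀ l ∈ L, D.Ψ i l ∈ L) {e e' : ℕ}
    (h : e ≤ e') : pieceMul p R a b e L ≤ pieceMul p R a b e' L := by
  induction e', h using Nat.le_induction with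
  | base => exact le_rfl
  | succ e' _ ih =>
    refine ih.trans ((AddSubgroup.closure_le _).2 ?_)
    rintro _ ⟨α, l, hl, rfl⟩
    rw [← D.sum_smul l, Finset.smul_sum]
    refine sum_mem fun i _ => ?_
    rw [of_smul_of_smul rfl]
    exact of_smul_mem_pieceMul _ (hL i l hl)

/-- The operators `Ψᵢ` lower the degree by one. -/
theorem Descent.Ψ_mem_pieceMul (D : Descent σ M) {L : Set M} (i : Fin σ.n) {e : ℕ} {m : M}
    (hm : m ∈ pieceMul p R a b (e + 1) L) : D.Ψ i m ∈ pieceMul p R a b e L := by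
  induction hm using AddSubgroup.closure_induction with
  | mem x hx =>
    obtain ⟨α, l, hl, rfl⟩ := hx
    rw [D.Ψ_of_succ_smul]
    exact of_smul_mem_pieceMul _ hl
  | zero => rw [map_zero]; exact zero_mem _
  | add x y _ _ hx hy => rw [map_add]; exact add_mem hx hy
  | neg x _ hx => rw [map_neg]; exact neg_mem hx

end PieceMul

section Finite

theorem finite_linearMap {R : Type*} [CommRing R] [IsNoetherianRing R] (M N : Type*)
    [AddCommGroup M] [AddCommGroup N] [Module R M] [Module R N] [Module.Finite R M]
    [Module.Finite R N] : Module.Finite R (M →ₗ[R] N) := by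
  obtain ⟨n, f, hf⟩ := Module.Finite.exists_fin' R M
  let g : (M →ₗ[R] N) →ₗ[R] (Fin n → N) :=
    ((LinearMap.pi fun i => LinearMap.applyₗ (Pi.single i (1 : R)) :
      ((Fin n → R) →ₗ[R] N) →ₗ[R] (Fin n → N))) ∘ₗ (LinearMap.lcomp R N f)
  have hg : Function.Injective g := by
    intro α β h
    refine LinearMap.cancel_right hf |>.1 (LinearMap.pi_ext' fun i => LinearMap.ext_ring ?_)
    exact congrFun h i
  have := isNoetherian_of_injective g hg
  infer_instance

variable {p : ℕ} [Fact p.Prime] {R : Type u} [CommRing R] [CharP R p] {a b : ℕ}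

theorem finite_frobPush (hF : IsFFinite p R) (e : ℕ) : Module.Finite R (FrobPush p e R) := by
  have h : (iterateFrobenius R p e).Finite := by
    induction e with
    | zero => rw [iterateFrobenius_zero]; exact RingHom.Finite.id R
    | succ e ih =>
      have : iterateFrobenius R p (e + 1) = (iterateFrobenius R p e).comp (frobenius R p) := by
        ext x
        simp [iterateFrobenius_def, frobenius_def, pow_succ', pow_mul]
      rw [this]
      exact ih.comp hF.2
  exact h

/-- The elements of `Hom(F⁽⁰⁾_* R, F⁽ᵉ⁾_* R)` are combinations of finitely many of them. -/
theorem exists_piece_generators (hF : IsFFinite p R) (e : ℕ) :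
    ∃ (k : ℕ) (α : Fin k → piece p R a b e), ∀ h : piece p R a b e, ∃ r : Fin k → R,
      ∑ i, compPiece (zero_add e) (mulPiece p R a b (r i ^ p ^ (a + e * b))) (α i) = h := by
  have := hF.1
  have := finite_frobPush hF a
  have := finite_frobPush hF (a + e * b)
  have := finite_linearMap (R := R) (FrobPush p a R) (FrobPush p (a + e * b) R)
  obtain ⟨k, s, hs⟩ := Module.Finite.exists_fin (R := R)
    (M := FrobPush p a R →ₗ[R] FrobPush p (a + e * b) R)
  refine ⟨k, fun i => ⟨(s i).toAddMonoidHom,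
    (mem_frobHom_iff p R _ _ _).2 ⟨s i, fun _ => rfl⟩⟩, fun h => ?_⟩
  obtain ⟨g, hg⟩ := (mem_frobHom_iff p R _ _ _).1 h.2
  have hg' : g ∈ Submodule.span R (Set.range s) := hs ▸ Submodule.mem_top
  obtain ⟨r, hr⟩ := (Submodule.mem_span_range_iff_exists_fun R).1 hg'
  refine ⟨r, Subtype.ext ?_⟩
  rw [AddSubgroup.val_finsetSum]
  refine AddMonoidHom.ext fun x => ?_
  refine (AddMonoidHom.finsetSum_apply (N := R) _ Finset.univ x).trans (Eq.trans ?_ (hg x))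
  rw [← hr]
  exact (LinearMap.sum_apply Finset.univ (fun i => r i • s i) (show FrobPush p a R from x)).symm

variable {M : Type v} [AddCommGroup M] [Module R M] [Module (DPhi p R a b) M]

theorem pieceMul_zero_subset (L : Submodule R (FrobPush p a M))
    (hL : ∀ (d : piece p R a b 0) (l : M), l ∈ L → DPhi.of p R a b 0 d • l ∈ L) (m : M)
    (hm : m ∈ pieceMul p R a b 0 {x : M | x ∈ L}) : m ∈ L := by
  induction hm using AddSubgroup.closure_induction with
  | mem x hx =>
    obtain ⟨α, l, hl, rfl⟩ := hx
    exact hL α l hl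
  | zero => exact zero_mem L
  | add x y _ _ hx hy => exact add_mem hx hy
  | neg x _ hx => exact neg_mem hx

variable [IsScalarTower R (DPhi p R a b) M]

variable (p R a b) in
/-- The elements `h • m` with `h` homogeneous of degree `e`, as an `R`-submodule of `F^a_* M`. -/
def pieceSpan (e : ℕ) (m : M) : Submodule R (FrobPush p a M) where
  carrier := {x | ∃ α : piece p R a b e, DPhi.of p R a b e α • m = x}
  zero_mem' := ⟨0, by rw [map_zero, zero_smul]; rfl⟩
  add_mem' := by
    rintro _ _ ⟨α, rfl⟩ ⟨β, rfl⟩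
    exact ⟨α + β, by rw [map_add, add_smul]; rfl⟩
  smul_mem' := by
    rintro r _ ⟨α, rfl⟩
    refine ⟨compPiece (zero_add e) (mulPiece p R a b (r ^ p ^ a)) α, ?_⟩
    exact (smul_of_smul (r ^ p ^ a) α m).symm

theorem fg_pieceSpan (hF : IsFFinite p R) (e : ℕ) (m : M) : (pieceSpan p R a b e m).FG := by
  have := hF.1
  obtain ⟨k, α, hα⟩ := exists_piece_generators (a := a) (b := b) hF e
  let t : Set (FrobPush p a M) := Set.range fun i => DPhi.of p R a b e (α i) • m
  have ht : IsNoetherian R (Submodule.span R t) :=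
    isNoetherian_span_of_finite R (Set.finite_range _)
  refine isNoetherian_submodule.1 ht _ ?_
  rintro _ ⟨h, rfl⟩
  obtain ⟨r, rfl⟩ := hα h
  rw [map_sum, Finset.sum_smul]
  refine Submodule.sum_mem (Submodule.span R t) fun i _ => ?_
  rw [← smul_of_smul]
  have h1 := (Submodule.span R t).smul_mem (r i ^ p ^ (e * b)) (Submodule.subset_span ⟨i, rfl⟩)
  have h2 : r i ^ p ^ (a + e * b) = (r i ^ p ^ (e * b)) ^ p ^ a := by
    rw [← pow_mul, ← pow_add, add_comm]
  rw [h2]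
  exact h1

variable {σ : FrobSplitting p R a b}

/-- A root of a finitely generated unit module: a finitely generated `𝒟⁽⁰⁾`-submodule stable under
the operators `Ψᵢ` (that is, contained in the subgroup its elements generate in degree one) whose
translates exhaust the module. Finite generation over `𝒟⁽⁰⁾` is expressed over `R`, which acts
through `r ↦ r ^ (p ^ a)`. -/
theorem Descent.exists_root (hF : IsFFinite p R) (D : Descent σ M)
    [hM : Module.Finite (DPhi p R a b) M] :
    ∃ L : Submodule R (FrobPush p a M), L.FG ∧
      (∀ (d : piece p R a b 0) (l : M), l ∈ L → DPhi.of p R a b 0 d • l ∈ L) ∧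
      (∀ i, ∀ l ∈ L, D.Ψ i l ∈ L) ∧ ∀ m : M, ∃ e, m ∈ pieceMul p R a b e {x : M | x ∈ L} := by
  obtain ⟨s, hs⟩ := hM.fg_top
  let L (k : ℕ) : Submodule R (FrobPush p a M) :=
    ⨆ j : Fin (k + 1) × s, pieceSpan p R a b j.1 (j.2 : M)
  have hmem {k e : ℕ} (he : e ≤ k) {m : M} (hm : m ∈ s) (α : piece p R a b e) :
      DPhi.of p R a b e α • m ∈ L k :=
    Submodule.mem_iSup_of_mem (R := R) (M := FrobPush p a M)
      (p := fun j : Fin (k + 1) × s => pieceSpan p R a b j.1 (j.2 : M))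
      (⟨⟨e, Nat.lt_succ_of_le he⟩, ⟨m, hm⟩⟩ : Fin (k + 1) × s) ⟨α, rfl⟩
  have hind (k : ℕ) (P : M → Prop) (h0 : P 0) (hadd : ∀ x y, P x → P y → P (x + y))
      (hP : ∀ e ≤ k, ∀ m ∈ s, ∀ α : piece p R a b e, P (DPhi.of p R a b e α • m))
      (x : M) (hx : x ∈ L k) : P x := by
    refine Submodule.iSup_induction (R := R) (M := FrobPush p a M)
      (fun j : Fin (k + 1) × s => pieceSpan p R a b j.1 (j.2 : M))
      (motive := fun y => P y) hx ?_ h0 hadd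
    rintro ⟨e, m⟩ _ ⟨α, rfl⟩
    exact hP _ (Nat.le_of_lt_succ e.2) _ m.2 α
  have hmono {k k' : ℕ} (h : k ≤ k') {x : M} (hx : x ∈ L k) : x ∈ L k' :=
    hind k (· ∈ L k') (zero_mem _) (fun _ _ => add_mem)
      (fun e he m hm α => hmem (he.trans h) hm α) x hx
  have hsmul {k e : ℕ} (α : piece p R a b e) {x : M} (hx : x ∈ L k) :
      DPhi.of p R a b e α • x ∈ L (e + k) := by
    refine hind k (fun x => DPhi.of p R a b e α • x ∈ L (e + k)) ?_ ?_ ?_ x hx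
    · rw [smul_zero]; exact zero_mem _
    · intro x y hx hy
      rw [smul_add]
      exact add_mem hx hy
    · intro e' he' m hm β
      rw [of_smul_of_smul rfl]
      exact hmem (by omega) hm _
  have hone (m : M) : DPhi.of p R a b 0 (mulPiece p R a b 1) • m = m := by
    have := ofR_smul p R a b M (1 : R) m
    rwa [one_smul] at this
  have hex (x : M) : ∃ k, x ∈ L k := by
    have hx : x ∈ Submodule.span (DPhi p R a b) (s : Set M) := hs ▸ Submodule.mem_top
    induction hx using Submodule.span_induction with
    | mem m hm =>
      refine ⟨0, ?_⟩
      rw [← hone m]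
      exact hmem le_rfl hm _
    | zero => exact ⟨0, zero_mem _⟩
    | add x y _ _ hx hy =>
      obtain ⟨k, hk⟩ := hx
      obtain ⟨l, hl⟩ := hy
      exact ⟨max k l, add_mem (hmono (le_max_left _ _) hk) (hmono (le_max_right _ _) hl)⟩
    | smul d x _ hx =>
      obtain ⟨k, hk⟩ := hx
      refine DirectSum.induction_on (β := fun e => piece p R a b e)
        (motive := fun d => ∃ k, (show DPhi p R a b from d) • x ∈ L k) d ?_ ?_ ?_
      · refine ⟨0, ?_⟩
        change (0 : DPhi p R a b) • x ∈ L 0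
        rw [zero_smul]
        exact zero_mem _
      · intro e α
        exact ⟨_, hsmul α hk⟩
      · rintro c d ⟨k, hk⟩ ⟨l, hl⟩
        refine ⟨max k l, ?_⟩
        change ((show DPhi p R a b from c) + (show DPhi p R a b from d)) • x ∈ _
        rw [add_smul]
        exact add_mem (hmono (le_max_left _ _) hk) (hmono (le_max_right _ _) hl)
  -- the finitely many elements `Ψᵢ m`, for `m` in the generating set, lie in a common `L k`
  have hcommon : ∃ k, ∀ i, ∀ m ∈ s, D.Ψ i m ∈ L k := by
    choose k hk using fun j : Fin σ.n × s => hex (D.Ψ j.1 j.2)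
    refine ⟨Finset.univ.sup k, fun i m hm => ?_⟩
    exact hmono (Finset.le_sup (Finset.mem_univ (i, (⟨m, hm⟩ : s)))) (hk (i, ⟨m, hm⟩))
  obtain ⟨k, hk⟩ := hcommon
  have hΨ (i : Fin σ.n) (l : M) (hl : l ∈ L k) : D.Ψ i l ∈ L k := by
    refine hind k (fun l => D.Ψ i l ∈ L k) ?_ ?_ ?_ l hl
    · rw [map_zero]; exact zero_mem _
    · intro x y hx hy
      rw [map_add]
      exact add_mem hx hy
    · rintro (_ | e) he m hm α
      · rw [← D.sum_smul m, Finset.smul_sum, map_sum]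
        refine Submodule.sum_mem (L k) fun j _ => ?_
        rw [of_smul_of_smul (zero_add 1), D.Ψ_smul]
        have := hsmul (σ.lower i 0 (compPiece (zero_add 1) α (σ.φ j))) (hk j m hm)
        rwa [zero_add] at this
      · rw [D.Ψ_of_succ_smul]
        exact hmem (by omega) hm _
  refine ⟨L k, Submodule.fg_iSup _ fun j => fg_pieceSpan hF _ _, fun d l hl => ?_, hΨ,
    fun m => ?_⟩
  · have := hsmul d hl
    rwa [zero_add] at this
  · obtain ⟨e, he⟩ := hex m
    refine ⟨e, hind e (· ∈ pieceMul p R a b e {x : M | x ∈ L k}) (zero_mem _)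
      (fun _ _ => add_mem) (fun e' he' m hm α => ?_) m he⟩
    refine pieceMul_mono D hΨ he' (of_smul_mem_pieceMul _ ?_)
    rw [← hone m]
    exact hmem (Nat.zero_le _) hm _

/-- Submodules of finitely generated unit modules which are themselves unit are finitely
generated: such a submodule is generated by its intersection with a root, which is finitely
generated because `R` is noetherian. -/
theorem Descent.finite_submodule (hF : IsFFinite p R) (D : Descent σ M)
    [hM : Module.Finite (DPhi p R a b) M] (K : Submodule (DPhi p R a b) M)
    (hK : ∀ i, ∀ m ∈ K, D.Ψ i m ∈ K) : Module.Finite (DPhi p R a b) K := by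
  have := hF.1
  obtain ⟨L, hfg, hL0, hΨ, hex⟩ := D.exists_root hF
  have hsm (r : R) (x : M) (hx : x ∈ K) : r • x ∈ K := by
    rw [← ofR_smul p R a b]
    exact K.smul_mem _ hx
  let K' : Submodule R (FrobPush p a M) :=
    { carrier := (K : Set M)
      zero_mem' := K.zero_mem
      add_mem' := K.add_mem
      smul_mem' := fun r x hx => hsm (r ^ p ^ a) x hx }
  have hnoeth : IsNoetherian R L := isNoetherian_of_fg_of_noetherian L hfg
  obtain ⟨t, ht⟩ := isNoetherian_submodule.1 hnoeth (K' ⊓ L) inf_le_right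
  have htw (x : M) (hx : x ∈ K' ⊓ L) : x ∈ Submodule.span (DPhi p R a b) {x : M | x ∈ t} := by
    rw [← ht] at hx
    refine Submodule.span_induction (M := FrobPush p a M) (p := fun x _ =>
      (show M from x) ∈ Submodule.span (DPhi p R a b) {x : M | x ∈ t})
      (fun x hx => Submodule.subset_span hx)
      (zero_mem _) (fun _ _ _ _ hx hy => add_mem hx hy) (fun r x _ hx => ?_) hx
    have := (Submodule.span (DPhi p R a b) {x : M | x ∈ t}).smul_mem
      (DPhi.ofR p R a b (r ^ p ^ a)) hx
    rwa [ofR_smul] at this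
  have hle (e : ℕ) : ∀ x ∈ K, x ∈ pieceMul p R a b e {x : M | x ∈ L} →
      x ∈ Submodule.span (DPhi p R a b) {x : M | x ∈ t} := by
    induction e with
    | zero => exact fun x hx hxL => htw x ⟨hx, pieceMul_zero_subset L hL0 x hxL⟩
    | succ e ih =>
      intro x hx hxL
      rw [← D.sum_smul x]
      exact sum_mem fun i _ => Submodule.smul_mem _ _
        (ih _ (hK i x hx) (D.Ψ_mem_pieceMul i hxL))
  have hspan : K = Submodule.span (DPhi p R a b) {x : M | x ∈ t} := by
    refine le_antisymm (fun x hx => ?_) (Submodule.span_le.2 fun x hx => ?_)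
    · obtain ⟨e, he⟩ := hex x
      exact hle e x hx he
    · have : x ∈ K' ⊓ L := ht ▸ Submodule.subset_span hx
      exact this.1
  rw [Module.Finite.iff_fg]
  exact ⟨t, hspan.symm⟩

end Finite

end FRep
end

noncomputable section
namespace FRep
open DirectSum TensorProduct

/-! ### Localization of unit modules -/

section FrobPushMap

variable {p : ℕ} [Fact p.Prime] {R : Type u} [CommRing R] [CharP R p]

/-- `F^e_* g`. -/
def FrobPush.map (e : ℕ) {M N : Type*} [AddCommGroup M] [AddCommGroup N] [Module R M] [Module R N]
    (g : M →ₗ[R] N) : FrobPush p e M →ₗ[R] FrobPush p e N where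
  toFun := g
  map_add' := g.map_add
  map_smul' r x := g.map_smul (r ^ p ^ e) x

/-- `F^e_*` commutes with localization. -/
theorem isLocalizedModule_frobPush (W : Submonoid R) (e : ℕ) {M N : Type*} [AddCommGroup M]
    [AddCommGroup N] [Module R M] [Module R N] (g : M →ₗ[R] N) [IsLocalizedModule W g] :
    IsLocalizedModule W (FrobPush.map (p := p) e g) := by
  have hinj (w : W) : Function.Bijective (fun x : N => (w : R) ^ p ^ e • x) :=
    (Module.End.isUnit_iff _).1 (IsLocalizedModule.map_units g (w ^ p ^ e))
  refine ⟨fun w => (Module.End.isUnit_iff _).2 (hinj w), fun y => ?_, fun {x x'} h => ?_⟩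
  · obtain ⟨⟨m, w⟩, h⟩ := IsLocalizedModule.surj W g (show N from y)
    refine ⟨⟨(show FrobPush p e M from (w : R) ^ (p ^ e - 1) • m), w⟩, ?_⟩
    change (w : R) ^ p ^ e • (show N from y) = g ((w : R) ^ (p ^ e - 1) • m)
    rw [map_smul, ← h, Submonoid.smul_def, smul_smul, pow_pred_mul p R]
  · obtain ⟨w, hw⟩ := IsLocalizedModule.exists_of_eq (S := W) (f := g) (x₁ := (show M from x))
      (x₂ := (show M from x')) h
    refine ⟨w, ?_⟩
    change (w : R) ^ p ^ e • (show M from x) = (w : R) ^ p ^ e • (show M from x')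
    rw [Submonoid.smul_def, Submonoid.smul_def] at hw
    rw [← pow_pred_mul p R, mul_smul, mul_smul, hw]

end FrobPushMap

section Localization

variable (p : ℕ) (R : Type u) [CommRing R] (a b : ℕ)
variable (M : Type v) [AddCommGroup M] [Module R M] [Module (DPhi p R a b) M]
variable [IsScalarTower R (DPhi p R a b) M] [Fact p.Prime] (W : Submonoid R)

theorem of_smul_mk_one {e : ℕ} (α : piece p R a b e) (m : M) :
    DPhi.of p R a b e α • LocalizedModule.mkLinearMap W M m
      = LocalizedModule.mkLinearMap W M (DPhi.of p R a b e α • m) := by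
  change _ • LocalizedModule.mk m 1 = LocalizedModule.mk _ 1
  rw [of_smul_mk]
  simp

theorem isLocStructure_locModule : IsLocStructure p R a b M W (locModule p R a b M W) :=
  ⟨fun r x => ofR_smul p R a b _ r x, fun d m =>
    (map_smul_of_homogeneous p R a b (LocalizedModule.mkLinearMap W M).toAddMonoidHom
      (fun _ α x => (of_smul_mk_one p R a b M W α x).symm) d m).symm⟩

variable {R M W}

theorem smul_left_injective_of_mem (w : W) :
    Function.Injective (fun x : LocalizedModule W M => (w : R) • x) :=
  ((Module.End.isUnit_iff _).1
    (IsLocalizedModule.map_units (LocalizedModule.mkLinearMap W M) w)).1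

variable (M) in
theorem exists_smul_pow_eq (k : ℕ) (x : LocalizedModule W M) :
    ∃ (w : W) (m : M), (w : R) ^ p ^ k • x = LocalizedModule.mkLinearMap W M m := by
  obtain ⟨⟨m, w⟩, h⟩ := IsLocalizedModule.surj W (LocalizedModule.mkLinearMap W M) x
  refine ⟨w, (w : R) ^ (p ^ k - 1) • m, ?_⟩
  rw [map_smul, ← h, Submonoid.smul_def, smul_smul, pow_pred_mul p R]

variable (R M W)

/-- A `𝒟⁽⁰⁾⟨Φ⟩`-action on `W⁻¹M` is determined on fractions: `w ^ (p ^ (a + e b)) • (α • (m / w))`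
equals `α • w ^ (p ^ a - 1) m`. -/
theorem eq_locModule (inst : Module (DPhi p R a b) (LocalizedModule W M))
    (h : IsLocStructure p R a b M W inst) : inst = locModule p R a b M W := by
  have key (i : Module (DPhi p R a b) (LocalizedModule W M))
      (hi : IsLocStructure p R a b M W i) {e : ℕ} (α : piece p R a b e)
      (w : R) (m : M) (x : LocalizedModule W M)
      (hx : w ^ p ^ a • x = LocalizedModule.mkLinearMap W M m) :
      w ^ p ^ (a + e * b) • (i.smul (DPhi.of p R a b e α) x) =
        LocalizedModule.mkLinearMap W M (DPhi.of p R a b e α • m) := by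
    have : IsScalarTower R (DPhi p R a b) (LocalizedModule W M) :=
      ⟨fun r d x => by rw [DPhi.smul_def, mul_smul, hi.1]⟩
    have h1 := of_smul_pow' p R a b (LocalizedModule W M) α w x
    rw [hx, hi.2] at h1
    exact h1.symm
  refine Module.ext' _ _ fun d x => ?_
  refine DirectSum.induction_on (β := fun e => piece p R a b e)
    (motive := fun d => inst.smul d x = (locModule p R a b M W).smul d x) d ?_ ?_ ?_
  · exact (inst.zero_smul x).trans ((locModule p R a b M W).zero_smul x).symm
  · intro e α
    obtain ⟨w, m, hw⟩ := exists_smul_pow_eq p M a x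
    refine smul_left_injective_of_mem (w ^ p ^ (a + e * b)) ?_
    exact (key inst h α w m x hw).trans
      (key _ (isLocStructure_locModule p R a b M W) α w m x hw).symm
  · intro c d hc hd
    refine (inst.add_smul c d x).trans (Eq.trans ?_
      ((locModule p R a b M W).add_smul c d x).symm)
    exact congrArg₂ (· + ·) hc hd

end Localization

section Descent

variable {p : ℕ} [Fact p.Prime] {R : Type u} [CommRing R] [CharP R p] {a b : ℕ}
variable {M : Type v} [AddCommGroup M] [Module R M] [Module (DPhi p R a b) M]
variable [IsScalarTower R (DPhi p R a b) M] {σ : FrobSplitting p R a b}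

/-- `Ψᵢ` is `R`-linear as a map `F^(a+b)_* M → F^a_* M`. -/
def Descent.linearΨ (D : Descent σ M) (i : Fin σ.n) :
    FrobPush p (a + 1 * b) M →ₗ[R] FrobPush p a M where
  toFun := D.Ψ i
  map_add' := (D.Ψ i).map_add
  map_smul' r m := by
    change D.Ψ i (r ^ p ^ (a + 1 * b) • (show M from m)) = r ^ p ^ a • D.Ψ i m
    generalize (show M from m) = m
    conv_lhs => rw [← D.sum_smul m]
    conv_rhs => rw [← D.sum_smul m]
    simp only [map_sum, Finset.smul_sum]
    refine Finset.sum_congr rfl fun j _ => ?_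
    rw [← of_smul_pow', D.Ψ_smul, D.Ψ_smul, of_smul_pow', zero_mul, add_zero]

/-- The operators `Ψᵢ` extend to `W⁻¹M` because `F^e_*` commutes with localization. -/
def Descent.localize (D : Descent σ M) (W : Submonoid R) : Descent σ (LocalizedModule W M) := by
  have := isLocalizedModule_frobPush (p := p) W (a + 1 * b) (LocalizedModule.mkLinearMap W M)
  have := isLocalizedModule_frobPush (p := p) W a (LocalizedModule.mkLinearMap W M)
  let Ψ (i : Fin σ.n) :
      FrobPush p (a + 1 * b) (LocalizedModule W M) →ₗ[R] FrobPush p a (LocalizedModule W M) :=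
    IsLocalizedModule.map W
      (FrobPush.map (p := p) (a + 1 * b) (LocalizedModule.mkLinearMap W M))
      (FrobPush.map (p := p) a (LocalizedModule.mkLinearMap W M)) (D.linearΨ i)
  have h1 (i : Fin σ.n) (m : M) : Ψ i (LocalizedModule.mkLinearMap W M m) =
      LocalizedModule.mkLinearMap W M (D.Ψ i m) :=
    IsLocalizedModule.map_apply W
      (FrobPush.map (p := p) (a + 1 * b) (LocalizedModule.mkLinearMap W M))
      (FrobPush.map (p := p) a (LocalizedModule.mkLinearMap W M)) (D.linearΨ i) m
  have h2 (i : Fin σ.n) (r : R) (x : LocalizedModule W M) :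
      Ψ i (r ^ p ^ (a + 1 * b) • x) = r ^ p ^ a • (show LocalizedModule W M from Ψ i x) :=
    (Ψ i).map_smul r x
  exact
  { Ψ := fun i => (Ψ i).toAddMonoidHom
    Ψ_smul := fun i h x => by
      obtain ⟨w, m, hw⟩ := exists_smul_pow_eq p M a x
      refine smul_left_injective_of_mem (w ^ p ^ a) ?_
      change (w : R) ^ p ^ a • (show LocalizedModule W M from Ψ i _) = (w : R) ^ p ^ a • _
      have h3 := of_smul_pow' p R a b (LocalizedModule W M) (σ.lower i 0 h) (w : R) x
      rw [zero_mul, add_zero] at h3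
      rw [← h2, ← h3, ← of_smul_pow', hw, of_smul_mk_one, of_smul_mk_one, ← D.Ψ_smul]
      exact h1 i _
    sum_smul := fun x => by
      obtain ⟨w, m, hw⟩ := exists_smul_pow_eq p M (a + 1 * b) x
      refine smul_left_injective_of_mem (w ^ p ^ (a + 1 * b)) ?_
      change (w : R) ^ p ^ (a + 1 * b) • (∑ i, _) = (w : R) ^ p ^ (a + 1 * b) • x
      rw [hw, Finset.smul_sum]
      conv_rhs => rw [← D.sum_smul m, map_sum]
      refine Finset.sum_congr rfl fun i _ => ?_
      rw [← of_smul_pow', ← of_smul_mk_one, ← h1, ← hw]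
      congr 1
      exact (h2 i w x).symm }

/-- Localization at one element preserves finite generation: if `L` is a root of `M`, then the
elements `l / f ^ (p ^ a)` with `l ∈ L` generate `M[1/f]`, since `h • (l / f ^ (p ^ a))` is
`(h • l) / f ^ (p ^ (a + e b))` for `h` of degree `e`. -/
theorem Descent.finite_away (hF : IsFFinite p R) (hb : 0 < b) (D : Descent σ M)
    [Module.Finite (DPhi p R a b) M] (f : R) :
    Module.Finite (DPhi p R a b) (LocalizedModule (Submonoid.powers f) M) := by
  obtain ⟨L, ⟨t, ht⟩, hL0, hΨ, hex⟩ := D.exists_root hF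
  let W := Submonoid.powers f
  let w : W := ⟨f, Submonoid.mem_powers f⟩
  let g (m : M) : LocalizedModule W M := LocalizedModule.mk m (w ^ p ^ a)
  have hg (m : M) : f ^ p ^ a • g m = LocalizedModule.mkLinearMap W M m := by
    change f ^ p ^ a • LocalizedModule.mk m (w ^ p ^ a) = LocalizedModule.mk m 1
    rw [LocalizedModule.smul'_mk]
    exact LocalizedModule.mk_cancel (w ^ p ^ a) m
  have hginj {k : ℕ} {x y : LocalizedModule W M} (h : f ^ k • x = f ^ k • y) : x = y :=
    smul_left_injective_of_mem (w ^ k) h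
  have hgadd (x y : M) : g (x + y) = g x + g y := by
    refine hginj (k := p ^ a) ?_
    rw [smul_add, hg, hg, hg, map_add]
  have hgsmul (r : R) (x : M) : g (r • x) = r • g x := by
    refine hginj (k := p ^ a) ?_
    rw [smul_comm, hg, hg, map_smul]
  have hg0 : g 0 = 0 := LocalizedModule.zero_mk _
  let S : Submodule (DPhi p R a b) (LocalizedModule W M) :=
    Submodule.span (DPhi p R a b) (g '' {x : M | x ∈ t})
  have hSR (r : R) {x : LocalizedModule W M} (hx : x ∈ S) : r • x ∈ S := by
    rw [← ofR_smul p R a b]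
    exact S.smul_mem _ hx
  have hgL (l : M) (hl : l ∈ L) : g l ∈ S := by
    rw [← ht] at hl
    refine Submodule.span_induction (M := FrobPush p a M)
      (p := fun x _ => g (show M from x) ∈ S) (fun x hx => Submodule.subset_span ⟨x, hx, rfl⟩)
      ?_ (fun x y _ _ hx hy => ?_) (fun r x _ hx => ?_) hl
    · change g 0 ∈ S
      rw [hg0]
      exact zero_mem _
    · change g ((show M from x) + (show M from y)) ∈ S
      rw [hgadd]
      exact add_mem hx hy
    · change g (r ^ p ^ a • (show M from x)) ∈ S
      rw [hgsmul]
      exact hSR _ hx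
  have hpiece (e : ℕ) (m : M) (hm : m ∈ pieceMul p R a b e {x : M | x ∈ L}) :
      ∃ s ∈ S, f ^ p ^ (a + e * b) • s = LocalizedModule.mkLinearMap W M m := by
    induction hm using AddSubgroup.closure_induction with
    | mem x hx =>
      obtain ⟨α, l, hl, rfl⟩ := hx
      refine ⟨DPhi.of p R a b e α • g l, S.smul_mem _ (hgL l hl), ?_⟩
      rw [← of_smul_pow', hg, of_smul_mk_one]
    | zero => exact ⟨0, zero_mem _, by simp⟩
    | add x y _ _ hx hy =>
      obtain ⟨s, hs, hs'⟩ := hx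
      obtain ⟨s', ht, ht'⟩ := hy
      exact ⟨s + s', add_mem hs ht, by rw [smul_add, hs', ht', map_add]⟩
    | neg x _ hx =>
      obtain ⟨s, hs, hs'⟩ := hx
      exact ⟨-s, neg_mem hs, by rw [smul_neg, hs', map_neg]⟩
  refine ⟨⟨(t.finite_toSet.image g).toFinset, ?_⟩⟩
  rw [Set.Finite.coe_toFinset, eq_top_iff]
  rintro x -
  change x ∈ S
  obtain ⟨⟨m, ⟨_, k, rfl⟩⟩, hx⟩ :=
    IsLocalizedModule.surj W (LocalizedModule.mkLinearMap W M) x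
  change f ^ k • x = _ at hx
  obtain ⟨e, he⟩ := hex m
  let e' := max e k
  have hk : k ≤ p ^ (a + e' * b) := by
    refine le_trans ?_ (Nat.lt_pow_self (Fact.out : p.Prime).one_lt).le
    calc k ≤ e' := le_max_right _ _
      _ ≤ e' * b := Nat.le_mul_of_pos_right _ hb
      _ ≤ a + e' * b := Nat.le_add_left _ _
  obtain ⟨s, hs, hs'⟩ := hpiece e' (f ^ (p ^ (a + e' * b) - k) • m)
    (smul_mem_pieceMul _ (pieceMul_mono D hΨ (le_max_left e k) he))
  have : x = s := by
    refine hginj (k := p ^ (a + e' * b)) ?_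
    rw [hs', map_smul, ← hx, smul_smul, ← pow_add, Nat.sub_add_cancel hk]
  exact this ▸ hs

end Descent

end FRep
end

noncomputable section
namespace FRep
open DirectSum TensorProduct

/-! ### Direct summands are detected on completed stalks -/

section Summand

variable {R : Type*} [CommRing R] (M N : Type*) [AddCommGroup M] [AddCommGroup N] [Module R M]
  [Module R N]

variable (R) in
/-- The span of the endomorphisms of `M` that factor through `N`. -/
def factorSpan : Submodule R (Module.End R M) :=
  Submodule.span R {χ | ∃ (φ : M →ₗ[R] N) (ψ : N →ₗ[R] M), ψ ∘ₗ φ = χ}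

variable (R) in
/-- The ideal of those `r` for which `r • id` is a sum of endomorphisms factoring through `N`. It
is the unit ideal if and only if `M` is a direct summand of a finite power of `N`. -/
def factorIdeal : Ideal R :=
  (factorSpan R M N).comap (LinearMap.toSpanSingleton R (Module.End R M) 1)

/-- If `M` becomes a direct summand of a finite power of `N` after a flat base change to `S`, then
`factorIdeal R M N` generates the unit ideal of `S`, that is, it is not contained in the contraction
of a proper ideal `Q`: the formation of `Hom` commutes with flat base change for finitely presented
modules, so the formation of `factorSpan` and `factorIdeal` does too. -/
theorem not_factorIdeal_le (S : Type*) [CommRing S] [Algebra R S] [Module.Flat R S]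
    [Module.FinitePresentation R M] [Module.FinitePresentation R N] (Q : Ideal S) (hQ : Q ≠ ⊤)
    {k : ℕ} (Φ : Fin k → S ⊗[R] M →ₗ[S] S ⊗[R] N) (Ψ : Fin k → S ⊗[R] N →ₗ[S] S ⊗[R] M)
    (h : ∑ i, Ψ i ∘ₗ Φ i = LinearMap.id) : ¬ factorIdeal R M N ≤ Q.comap (algebraMap R S) := by
  intro hle
  let T := factorSpan R M N
  -- the flat base changes of the three modules of homomorphisms
  let hMN := Module.FinitePresentation.isBaseChange_map R M N S
  let hNM := Module.FinitePresentation.isBaseChange_map R N M S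
  let hMM := Module.FinitePresentation.isBaseChange_map R M M S
  let U : Submodule S (S ⊗[R] M →ₗ[S] S ⊗[R] M) :=
    Submodule.span S ((fun χ => LinearMap.baseChangeHom R S M M χ) '' (T : Set (M →ₗ[R] M)))
  -- every endomorphism of `S ⊗ M` factoring through `S ⊗ N` is in the `S`-span of `T`
  have hU (Φ : S ⊗[R] M →ₗ[S] S ⊗[R] N) (Ψ : S ⊗[R] N →ₗ[S] S ⊗[R] M) : Ψ ∘ₗ Φ ∈ U := by
    refine hMN.inductionOn Φ (fun Φ => Ψ ∘ₗ Φ ∈ U) ?_ (fun φ => ?_) (fun s Φ hΦ => ?_)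
      (fun Φ Φ' h h' => ?_)
    · rw [LinearMap.comp_zero]
      exact zero_mem _
    · refine hNM.inductionOn Ψ (fun Ψ => Ψ ∘ₗ _ ∈ U) ?_ (fun ψ => ?_) (fun s Ψ hΨ => ?_)
        (fun Ψ Ψ' h h' => ?_)
      · rw [LinearMap.zero_comp]
        exact zero_mem _
      · refine Submodule.subset_span ⟨ψ ∘ₗ φ, Submodule.subset_span ⟨φ, ψ, rfl⟩, ?_⟩
        exact LinearMap.baseChange_comp _ _
      · rw [LinearMap.smul_comp]
        exact U.smul_mem s hΨ
      · rw [LinearMap.add_comp]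
        exact add_mem h h'
    · rw [LinearMap.comp_smul]
      exact U.smul_mem s hΦ
    · rw [LinearMap.comp_add]
      exact add_mem h h'
  have hid : (LinearMap.id : S ⊗[R] M →ₗ[S] S ⊗[R] M) ∈ U :=
    h ▸ sum_mem fun i _ => hU _ _
  let G : (S ⊗[R] M →ₗ[S] S ⊗[R] M) →ₗ[S] S ⊗[R] ((M →ₗ[R] M) ⧸ T) :=
    (T.mkQ.baseChange S) ∘ₗ hMM.equiv.symm.toLinearMap
  have hG (χ : M →ₗ[R] M) : G (LinearMap.baseChangeHom R S M M χ) = 1 ⊗ₜ T.mkQ χ := by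
    change T.mkQ.baseChange S (hMM.equiv.symm _) = _
    rw [hMM.equiv_symm_apply, LinearMap.baseChange_tmul]
  have hGU : U ≤ LinearMap.ker G := by
    rw [Submodule.span_le]
    rintro _ ⟨χ, hχ, rfl⟩
    change G _ = 0
    rw [hG, Submodule.mkQ_apply, (Submodule.Quotient.mk_eq_zero T).2 hχ, tmul_zero]
  -- so the class of the identity in `End M ⧸ T` dies in `S ⊗ (End M ⧸ T)`
  have h1 : (1 : S) ⊗ₜ[R] T.mkQ (1 : M →ₗ[R] M) = 0 := by
    rw [← hG]
    refine Eq.trans ?_ (hGU hid)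
    congr 1
    exact LinearMap.baseChange_id
  -- as `S` is flat, so does `1 ∈ S ⊗ (R ⧸ J)`
  let J := factorIdeal R M N
  let j : (R ⧸ J) →ₗ[R] ((M →ₗ[R] M) ⧸ T) :=
    J.mapQ T (LinearMap.toSpanSingleton R (Module.End R M) 1) le_rfl
  have hj : Function.Injective j := by
    rw [← LinearMap.ker_eq_bot, eq_bot_iff]
    intro x hx
    obtain ⟨r, rfl⟩ := J.mkQ_surjective x
    exact (Submodule.Quotient.mk_eq_zero J).2 ((Submodule.Quotient.mk_eq_zero T).1 hx)
  have h2 : (1 : S) ⊗ₜ[R] (J.mkQ 1) = 0 := by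
    apply Module.Flat.lTensor_preserves_injective_linearMap (M := S) j hj
    rw [map_zero, LinearMap.lTensor_tmul, ← h1]
    congr 1
    exact congrArg T.mkQ (one_smul R _)
  have hJ : J ≤ LinearMap.ker (Q.mkQ.restrictScalars R ∘ₗ Algebra.linearMap R S) := fun r hr =>
    (Submodule.Quotient.mk_eq_zero Q).2 (hle hr)
  have h3 := congrArg ((J.liftQ _ hJ).liftBaseChange S) h2
  rw [LinearMap.liftBaseChange_tmul, map_zero, one_smul] at h3
  refine hQ ((Ideal.eq_top_iff_one Q).2 ((Submodule.Quotient.mk_eq_zero Q).1 ?_))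
  refine Eq.trans ?_ h3
  exact congrArg Q.mkQ (map_one (algebraMap R S)).symm

theorem exists_sum_comp_eq_id (h : factorIdeal R M N = ⊤) :
    ∃ (k : ℕ) (φ : Fin k → M →ₗ[R] N) (ψ : Fin k → N →ₗ[R] M),
      ∑ i, ψ i ∘ₗ φ i = LinearMap.id := by
  have h1 : (1 : Module.End R M) ∈ factorSpan R M N := by
    have : (1 : R) ∈ factorIdeal R M N := h ▸ Submodule.mem_top
    have h2 : LinearMap.toSpanSingleton R (Module.End R M) 1 1 ∈ factorSpan R M N := this
    rwa [LinearMap.toSpanSingleton_apply, one_smul] at h2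
  obtain ⟨k, c, g, hg⟩ := Submodule.mem_span_set'.1 h1
  choose φ ψ hφψ using fun i => (g i).2
  refine ⟨k, fun i => c i • φ i, ψ, ?_⟩
  simp only [LinearMap.comp_smul, hφψ]
  exact hg

end Summand

/-! ### Frobenius pushforwards and completion -/

section Completion

variable {p : ℕ} [Fact p.Prime] {R : Type u} [CommRing R] [CharP R p]

instance {S : Type u} [CommRing S] [CharP S p] [Algebra R S] {N : Type v} [AddCommGroup N]
    [Module R N] [Module S N] [IsScalarTower R S N] (e : ℕ) :
    IsScalarTower R S (FrobPush p e N) where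
  smul_assoc r s x := by
    change (r • s) ^ p ^ e • (show N from x) = r ^ p ^ e • s ^ p ^ e • (show N from x)
    rw [smul_pow, smul_assoc]

variable (p R) in
/-- The natural map `F^e_* R → F^e_* S`, for an `R`-algebra `S`. -/
abbrev frobAlg (S : Type u) [CommRing S] [Algebra R S] (e : ℕ) :
    FrobPush p e R →ₗ[R] FrobPush p e S :=
  FrobPush.map e (Algebra.linearMap R S)

theorem isBaseChange_frobAlg_localization (P : Ideal R) [P.IsPrime]
    [CharP (Localization.AtPrime P) p] (e : ℕ) :
    IsBaseChange (Localization.AtPrime P) (frobAlg p R (Localization.AtPrime P) e) := by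
  have := isLocalizedModule_frobPush (p := p) P.primeCompl e
    (Algebra.linearMap R (Localization.AtPrime P))
  exact (isLocalizedModule_iff_isBaseChange P.primeCompl _ _).1 this

/-- High powers of `I` are contained in `Iⁿ F^e_* R = (Iⁿ)^[p ^ e]`. -/
theorem pow_mem_pow_smul_top (I : Ideal R) (hI : I.FG) (e n : ℕ) :
    ∃ N, ∀ x ∈ I ^ N,
      (show FrobPush p e R from x) ∈ (I ^ n • ⊤ : Submodule R (FrobPush p e R)) := by
  -- `K` contains the `p ^ e`-th powers of the elements of `I ^ n`
  let K : Ideal R :=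
    { carrier := {x : R | (show FrobPush p e R from x) ∈
        (I ^ n • ⊤ : Submodule R (FrobPush p e R))}
      zero_mem' := zero_mem (I ^ n • ⊤ : Submodule R (FrobPush p e R))
      add_mem' := fun {x y} h h' => (I ^ n • ⊤ : Submodule R (FrobPush p e R)).add_mem h h'
      smul_mem' := fun c x hx => by
        let μ : FrobPush p e R →ₗ[R] FrobPush p e R := FrobPush.map e (LinearMap.mulLeft R c)
        have h1 : (I ^ n • ⊤ : Submodule R (FrobPush p e R)) ≤ (I ^ n • ⊤ :
            Submodule R (FrobPush p e R)).comap μ := by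
          rw [← Submodule.map_le_iff_le_comap, Submodule.map_smul'']
          exact Submodule.smul_mono le_rfl le_top
        exact h1 hx }
  have hK : I ^ n ≤ K.radical := fun r hr => ⟨p ^ e, by
    have : r • (show FrobPush p e R from (1 : R)) ∈ (I ^ n • ⊤ : Submodule R (FrobPush p e R)) :=
      Submodule.smul_mem_smul hr Submodule.mem_top
    have h2 : r • (show FrobPush p e R from (1 : R)) = (show FrobPush p e R from r ^ p ^ e) :=
      mul_one (r ^ p ^ e)
    rw [h2] at this
    exact this⟩
  obtain ⟨k, hk⟩ := Ideal.exists_pow_le_of_le_radical_of_fg hK (hI.pow)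
  exact ⟨n * k, fun x hx => hk (by rwa [← pow_mul])⟩

open AdicCompletion in
/-- `F^e_*` commutes with completion, because the filtrations of `R` by the powers `Iⁿ` and by the
`(Iⁿ)^[p ^ e]` are cofinal. -/
theorem isBaseChange_frobAlg_completion [IsNoetherianRing R] (I : Ideal R)
    [CharP (AdicCompletion I R) p] (e : ℕ) [Module.Finite R (FrobPush p e R)] :
    IsBaseChange (AdicCompletion I R) (frobAlg p R (AdicCompletion I R) e) := by
  let S := AdicCompletion I R
  let E := ofTensorProductEquivOfFiniteNoetherian I (FrobPush p e R)
  have hE (t) : E t = ofTensorProduct I (FrobPush p e R) t := rfl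
  let γ : S ⊗[R] FrobPush p e R →ₗ[S] FrobPush p e S := (frobAlg p R S e).liftBaseChange S
  let g (n : ℕ) : FrobPush p e R →ₗ[R] FrobPush p e (R ⧸ I ^ n) := FrobPush.map e (I ^ n).mkQ
  have hg (n : ℕ) : (I ^ n • ⊤ : Submodule R (FrobPush p e R)) ≤ LinearMap.ker (g n) := by
    rw [Submodule.smul_le]
    intro r hr x _
    have : (r ^ p ^ e * (show R from x)) ∈ I ^ n :=
      Ideal.mul_mem_right _ _ (Ideal.pow_mem_of_mem _ hr _ (Nat.pow_pos (Fact.out : p.Prime).pos))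
    exact (Submodule.Quotient.mk_eq_zero (I ^ n)).2 this
  let χ (n : ℕ) : (FrobPush p e R ⧸ (I ^ n • ⊤ : Submodule R (FrobPush p e R))) →ₗ[R]
    FrobPush p e (R ⧸ I ^ n) := Submodule.liftQ _ (g n) (hg n)
  -- compare `E` and `γ` modulo `I ^ n`
  have key (n : ℕ) (t : S ⊗[R] FrobPush p e R) :
      χ n ((E t).val n) = evalₐ I n (show S from γ t) := by
    induction t using TensorProduct.induction_on with
    | zero =>
      rw [_root_.map_zero, _root_.map_zero, val_zero_apply, _root_.map_zero]
      exact (_root_.map_zero (evalₐ I n)).symm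
    | add x y hx hy =>
      rw [map_add, map_add, val_add_apply, map_add, hx, hy]
      exact (map_add (evalₐ I n) _ _).symm
    | tmul s x =>
      obtain ⟨s, rfl⟩ := AdicCompletion.mk_surjective I R s
      rw [hE, ofTensorProduct_tmul]
      have h1 : (show S from γ (AdicCompletion.mk I R s ⊗ₜ x)) =
          (AdicCompletion.mk I R s) ^ p ^ e * algebraMap R S (show R from x) := rfl
      rw [h1, map_mul, map_pow, evalₐ_mk, AlgHom.commutes]
      rfl
  refine IsBaseChange.of_equiv (LinearEquiv.ofBijective γ ⟨?_, fun y => ?_⟩) fun x => ?_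
  · rw [← LinearMap.ker_eq_bot, eq_bot_iff]
    intro t ht
    refine E.injective (AdicCompletion.ext fun n => ?_)
    rw [_root_.map_zero, val_zero_apply]
    obtain ⟨N, hN⟩ := pow_mem_pow_smul_top (p := p) I (IsNoetherian.noetherian I) e n
    have h1 := key (max N n) t
    rw [show γ t = 0 from ht] at h1
    rw [← (E t).2 (le_max_right N n)]
    change transitionMap I _ _ ((E t).val _) = 0
    obtain ⟨y, hy⟩ := Submodule.mkQ_surjective _ ((E t).val (max N n))
    rw [← hy] at h1 ⊢
    have h2 : (show R from y) ∈ I ^ (max N n) :=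
      (Submodule.Quotient.mk_eq_zero (I ^ (max N n))).1
        (h1.trans (_root_.map_zero (evalₐ I (max N n))))
    exact (Submodule.Quotient.mk_eq_zero _).2
      (hN _ (Ideal.pow_le_pow_right (le_max_left _ _) h2))
  · obtain ⟨f, hf⟩ := AdicCompletion.mk_surjective I R (show S from y)
    choose N hN using fun n =>
      pow_mem_pow_smul_top (p := p) I (IsNoetherian.noetherian I) e n
    let N' (n : ℕ) : ℕ := ∑ i ∈ Finset.range (n + 1), N i + n
    have hN' (n : ℕ) : N n ≤ N' n :=
      (Finset.single_le_sum (f := N) (fun _ _ => Nat.zero_le _)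
        (Finset.self_mem_range_succ n)).trans (Nat.le_add_right _ _)
    have hN'n (n : ℕ) : n ≤ N' n := Nat.le_add_left _ _
    have hmono (n : ℕ) : N' n ≤ N' (n + 1) := by
      simp only [N', Finset.sum_range_succ _ (n + 1)]
      omega
    -- the terms `f (N' n)` of a Cauchy sequence of `R` form a Cauchy sequence of `F^e_* R`
    let c : AdicCauchySequence I (FrobPush p e R) := AdicCauchySequence.mk I _
      (fun n => (show FrobPush p e R from f (N' n))) fun n => by
        have h1 := f.2 (hmono n)
        rw [SModEq.sub_mem] at h1 ⊢
        rw [smul_eq_mul, Ideal.mul_top] at h1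
        exact hN n _ (Ideal.pow_le_pow_right (hN' n) h1)
    obtain ⟨t, ht⟩ := E.surjective (AdicCompletion.mk I _ c)
    refine ⟨t, ?_⟩
    refine AdicCompletion.ext_evalₐ (I := I) (x := (show S from γ t)) (y := (show S from y))
      fun n => ?_
    rw [← key, ht, ← hf, evalₐ_mk]
    change Ideal.Quotient.mk (I ^ n) (f (N' n)) = Ideal.Quotient.mk (I ^ n) (f n)
    have h1 := f.2 (hN'n n)
    rw [SModEq.sub_mem] at h1
    rw [eq_comm, Ideal.Quotient.eq]
    simpa using h1
  · exact LinearMap.liftBaseChange_one_tmul S (frobAlg p R S e) x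

variable (p) in
theorem charP_localization (P : Ideal R) [P.IsPrime] : CharP (Localization.AtPrime P) p :=
  CharP.of_ringHom_of_ne_zero
    ((algebraMap R (Localization.AtPrime P)).comp (ZMod.castHom (dvd_refl p) R))
    p (Fact.out : p.Prime).ne_zero

theorem isBaseChange_frobAlg_comp {A S : Type u} [CommRing A] [CommRing S] [CharP A p]
    [CharP S p] [Algebra R A] [Algebra A S] [Algebra R S] [IsScalarTower R A S] (e : ℕ)
    (h1 : IsBaseChange A (frobAlg p R A e)) (h2 : IsBaseChange S (frobAlg p A S e)) :
    IsBaseChange S (frobAlg p R S e) := by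
  have h3 : (frobAlg p A S e).restrictScalars R ∘ₗ frobAlg p R A e = frobAlg p R S e :=
    LinearMap.ext fun x => (IsScalarTower.algebraMap_apply R A S x).symm
  exact h3 ▸ h1.comp h2

theorem isBaseChange_frobAlg_complStalk (hF : IsFFinite p R) (P : Ideal R) [P.IsPrime] (e : ℕ) :
    IsBaseChange (complStalk R P) (frobAlg p R (complStalk R P) e) := by
  have := hF.1
  have := charP_localization p P
  have : IsNoetherianRing (Localization.AtPrime P) :=
    IsLocalization.isNoetherianRing P.primeCompl _ inferInstance
  have h1 := isBaseChange_frobAlg_localization (p := p) P e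
  have := finite_frobPush hF e
  have : Module.Finite (Localization.AtPrime P) (FrobPush p e (Localization.AtPrime P)) :=
    Module.Finite.equiv h1.equiv
  have h2 := isBaseChange_frobAlg_completion (p := p)
    (IsLocalRing.maximalIdeal (Localization.AtPrime P)) e
  exact isBaseChange_frobAlg_comp e h1 h2

end Completion

/-! ### Decompositions into indecomposables -/

section Decomposition

open IsLocalRing in
/-- Over a local ring, finitely generated modules are finite direct sums of indecomposables, by
induction on the minimal number of generators. -/
theorem exists_indecomposable_decomposition {S : Type u} [CommRing S] [IsLocalRing S]
    (N : Type u) [AddCommGroup N] [Module S N] [Module.Finite S N] :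
    ∃ (ι : Type) (_ : Fintype ι) (X : ι → ModuleCat.{u} S),
      (∀ j, Module.Finite S (X j) ∧ IsIndecomposable S (X j)) ∧
        Nonempty (N ≃ₗ[S] (∀ j, X j)) := by
  induction h : Module.finrank (ResidueField S) (ResidueField S ⊗[S] N)
    using Nat.strong_induction_on generalizing N with
  | _ d ih =>
    rcases subsingleton_or_nontrivial N with hN | hN
    · exact ⟨Empty, inferInstance, fun j => j.elim, fun j => j.elim,
        ⟨{ toFun := fun _ j => j.elim
           map_add' := fun _ _ => funext fun j => j.elim
           map_smul' := fun _ _ => funext fun j => j.elim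
           invFun := fun _ => 0
           left_inv := fun _ => Subsingleton.elim _ _
           right_inv := fun _ => funext fun j => j.elim }⟩⟩
    by_cases hi : IsIndecomposable S N
    · exact ⟨Unit, inferInstance, fun _ => ModuleCat.of S N,
        fun _ => ⟨inferInstanceAs (Module.Finite S N), hi⟩,
        ⟨(LinearEquiv.funUnique Unit S N).symm⟩⟩
    · simp only [IsIndecomposable, not_and, not_forall, not_or] at hi
      obtain ⟨A, B, hAB, hA, hB⟩ := hi hN
      let e := A.prodEquivOfIsCompl B hAB
      have : Module.Finite S (A × B) := Module.Finite.equiv e.symm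
      have hfA : Module.Finite S A := Module.Finite.of_surjective (LinearMap.fst S A B)
        LinearMap.fst_surjective
      have hfB : Module.Finite S B := Module.Finite.of_surjective (LinearMap.snd S A B)
        LinearMap.snd_surjective
      have hpos (A : Submodule S N) (hA : A ≠ ⊥) [Module.Finite S A] :
          0 < Module.finrank (ResidueField S) (ResidueField S ⊗[S] A) := by
        have : Nontrivial A := Submodule.nontrivial_iff_ne_bot.2 hA
        have : Nontrivial (ResidueField S ⊗[S] A) := by
          rw [← not_subsingleton_iff_nontrivial, subsingleton_tensorProduct]
          exact not_subsingleton A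
        exact Module.finrank_pos
      have hd : Module.finrank (ResidueField S) (ResidueField S ⊗[S] A) +
          Module.finrank (ResidueField S) (ResidueField S ⊗[S] B) = d := by
        rw [← h, ← Module.finrank_prod]
        exact ((TensorProduct.prodRight S (ResidueField S) (ResidueField S) A B).symm ≪≫ₗ
          (e.baseChange S (ResidueField S) _ _)).finrank_eq
      obtain ⟨ι, _, X, hX, ⟨eX⟩⟩ := ih _ (by have := hpos B hB; omega) A rfl
      obtain ⟨κ, _, Y, hY, ⟨eY⟩⟩ := ih _ (by have := hpos A hA; omega) B rfl
      refine ⟨ι ⊕ κ, inferInstance, Sum.elim X Y, ?_, ⟨e.symm ≪≫ₗ (eX.prodCongr eY) ≪≫ₗ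
        (LinearEquiv.sumPiEquivProdPi S ι κ fun j => (Sum.elim X Y j : ModuleCat S)).symm⟩⟩
      rintro (j | j)
      · exact hX j
      · exact hY j

end Decomposition

section Existence

variable {p : ℕ} [Fact p.Prime] {R : Type u} [CommRing R] [CharP R p] {a b : ℕ}

/-- Over the completed stalks, `F⁽¹⁾_*` is a direct summand of a finite power of `F⁽⁰⁾_*`, as both
have the same indecomposable summands. -/
theorem exists_complStalk_splitting (hF : IsFFinite p R) (hab : IsSetup p R a b) (P : Ideal R)
    [P.IsPrime] : ∃ (k : ℕ)
      (Φ : Fin k → FrobPush p (a + 1 * b) (complStalk R P) →ₗ[complStalk R P]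
        FrobPush p a (complStalk R P))
      (Ψ : Fin k → FrobPush p a (complStalk R P) →ₗ[complStalk R P]
        FrobPush p (a + 1 * b) (complStalk R P)),
      ∑ i, Ψ i ∘ₗ Φ i = LinearMap.id := by
  have := hF.1
  have : IsNoetherianRing (Localization.AtPrime P) :=
    IsLocalization.isNoetherianRing P.primeCompl _ inferInstance
  have := finite_frobPush hF (a + 1 * b)
  have : Module.Finite (complStalk R P) (FrobPush p (a + 1 * b) (complStalk R P)) :=
    Module.Finite.equiv (isBaseChange_frobAlg_complStalk hF P (a + 1 * b)).equiv
  obtain ⟨ι, _, X', hX', ⟨e'⟩⟩ := exists_indecomposable_decomposition (S := complStalk R P)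
    (FrobPush p (a + 1 * b) (complStalk R P))
  let k := Fintype.card ι
  let σ : Fin k ≃ ι := (Fintype.equivFin ι).symm
  let X (j : Fin k) : ModuleCat (complStalk R P) := X' (σ j)
  let e : FrobPush p (a + 1 * b) (complStalk R P) ≃ₗ[complStalk R P] (∀ j, X j) :=
    e' ≪≫ₗ (LinearEquiv.piCongrLeft (complStalk R P) (fun i => (X' i : Type u)) σ).symm
  have hX (j : Fin k) : X j ∈ indecs (complStalk R P) (FrobPush p a (complStalk R P)) := by
    rw [← hab.2 P 1]
    exact ⟨k, X, fun j => hX' (σ j), ⟨e⟩, j, ⟨LinearEquiv.refl _ _⟩⟩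
  choose k' N hN eN j' eX using hX
  refine ⟨k, fun j => (eN j).some.symm.toLinearMap ∘ₗ
      LinearMap.single (complStalk R P) (fun i => N j i) (j' j) ∘ₗ
      (eX j).some.toLinearMap ∘ₗ LinearMap.proj j ∘ₗ e.toLinearMap,
    fun j => e.symm.toLinearMap ∘ₗ LinearMap.single (complStalk R P) (fun i => X i) j ∘ₗ
      (eX j).some.symm.toLinearMap ∘ₗ LinearMap.proj (j' j) ∘ₗ (eN j).some.toLinearMap, ?_⟩
  refine LinearMap.ext fun x => ?_
  rw [LinearMap.sum_apply]
  simp only [LinearMap.comp_apply, LinearEquiv.coe_coe, LinearEquiv.apply_symm_apply,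
    LinearMap.proj_apply, LinearMap.single_apply, Pi.single_eq_same, LinearEquiv.symm_apply_apply]
  rw [← map_sum, Finset.univ_sum_single, LinearEquiv.symm_apply_apply]
  rfl

/-- `F⁽¹⁾_* R` is a direct summand of a finite power of `F⁽⁰⁾_* R`: this may be checked after the
flat base changes to the completed stalks, with which `F^e_*` commutes. -/
theorem nonempty_frobSplitting (hF : IsFFinite p R) (hab : IsSetup p R a b) :
    Nonempty (FrobSplitting p R a b) := by
  have := hF.1
  have hfp (e : ℕ) : Module.FinitePresentation R (FrobPush p e R) := by
    have := finite_frobPush hF e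
    exact Module.finitePresentation_of_finite R _
  have htop : factorIdeal R (FrobPush p (a + 1 * b) R) (FrobPush p a R) = ⊤ := by
    by_contra hne
    obtain ⟨P, hP, hle⟩ := Ideal.exists_le_maximal _ hne
    have := hP.isPrime
    have : IsNoetherianRing (Localization.AtPrime P) :=
      IsLocalization.isNoetherianRing P.primeCompl _ inferInstance
    have : Module.Flat R (complStalk R P) :=
      Module.Flat.trans R (Localization.AtPrime P) (complStalk R P)
    obtain ⟨k, Φ, Ψ, hΦΨ⟩ := exists_complStalk_splitting hF hab P
    let e0 := (isBaseChange_frobAlg_complStalk hF P a).equiv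
    let e1 := (isBaseChange_frobAlg_complStalk hF P (a + 1 * b)).equiv
    refine not_factorIdeal_le _ _ (complStalk R P)
      (RingHom.ker (AdicCompletion.evalOneₐ
        (IsLocalRing.maximalIdeal (Localization.AtPrime P))).toRingHom) (RingHom.ker_ne_top _)
      (fun i => e0.symm.toLinearMap ∘ₗ Φ i ∘ₗ e1.toLinearMap)
      (fun i => e1.symm.toLinearMap ∘ₗ Ψ i ∘ₗ e0.toLinearMap) ?_ (hle.trans fun r hr => ?_)
    · refine LinearMap.ext fun x => ?_
      rw [LinearMap.sum_apply]
      simp only [LinearMap.comp_apply, LinearEquiv.coe_coe, LinearEquiv.apply_symm_apply]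
      have h1 := LinearMap.congr_fun hΦΨ (e1 x)
      rw [LinearMap.sum_apply] at h1
      simp only [LinearMap.comp_apply, LinearMap.id_apply] at h1
      rw [← map_sum, h1, LinearEquiv.symm_apply_apply]
      rfl
    · change AdicCompletion.evalOneₐ _ (algebraMap (Localization.AtPrime P) (complStalk R P)
        (algebraMap R _ r)) = 0
      rw [AlgHom.commutes]
      refine Ideal.Quotient.eq_zero_iff_mem.2 ?_
      exact (IsLocalization.AtPrime.to_map_mem_maximal_iff _ P r).2 hr
  obtain ⟨k, ψ, φ, h⟩ := exists_sum_comp_eq_id _ _ htop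
  refine ⟨⟨k, fun i => ⟨(φ i).toAddMonoidHom, (mem_frobHom_iff p R _ _ _).2 ⟨φ i, fun _ => rfl⟩⟩,
    fun i => (ψ i).toAddMonoidHom, fun i => (mem_frobHom_iff p R _ _ _).2 ⟨ψ i, fun _ => rfl⟩, ?_⟩⟩
  refine AddMonoidHom.ext fun x => ?_
  refine (AddMonoidHom.finsetSum_apply (N := R) _ Finset.univ x).trans ?_
  have h1 := LinearMap.congr_fun h (show FrobPush p (a + 1 * b) R from x)
  exact (LinearMap.sum_apply _ _ _).symm.trans h1

end Existence

end FRep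
end

noncomputable section
namespace FRep

/-! ### Homology classes, `Ext` and local cohomology in terms of cocycles -/

section HomologyClass
open CategoryTheory Limits

variable {R : Type u} [CommRing R] {ι : Type*} {c : ComplexShape ι}
  (L : HomologicalComplex (ModuleCat.{u} R) c) (i n j : ι)

/-- A cycle, as an element of `L.cycles n`. -/
def toCycle (hj : c.next n = j) : LinearMap.ker (L.d n j).hom →ₗ[R] L.cycles n :=
  (L.liftCycles (ModuleCat.ofHom (LinearMap.ker (L.d n j).hom).subtype) j hj
    (ModuleCat.hom_ext (LinearMap.ext fun x => x.2))).hom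

theorem iCycles_toCycle (hj : c.next n = j) (z : LinearMap.ker (L.d n j).hom) :
    (L.iCycles n).hom (toCycle L n j hj z) = z :=
  LinearMap.congr_fun (ModuleCat.hom_ext_iff.1 (L.liftCycles_i
    (ModuleCat.ofHom (LinearMap.ker (L.d n j).hom).subtype) j hj
    (ModuleCat.hom_ext (LinearMap.ext fun x => x.2)))) z

theorem iCycles_injective : Function.Injective (L.iCycles n).hom :=
  (ModuleCat.mono_iff_injective (L.iCycles n)).1 inferInstance

theorem toCycle_surjective (hj : c.next n = j) : Function.Surjective (toCycle L n j hj) :=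
  fun y => ⟨⟨(L.iCycles n).hom y,
    LinearMap.congr_fun (ModuleCat.hom_ext_iff.1 (L.iCycles_d n j)) y⟩,
    iCycles_injective L n (iCycles_toCycle L n j hj _)⟩

/-- The class of a cycle in the homology of a complex of modules. -/
def homologyClass (hj : c.next n = j) : LinearMap.ker (L.d n j).hom →ₗ[R] L.homology n :=
  (L.homologyπ n).hom ∘ₗ toCycle L n j hj

theorem homologyClass_surjective (hj : c.next n = j) :
    Function.Surjective (homologyClass L n j hj) :=
  ((ModuleCat.epi_iff_surjective (L.homologyπ n)).1 inferInstance).comp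
    (toCycle_surjective L n j hj)

theorem homologyClass_eq_zero_iff (hi : c.prev n = i) (hj : c.next n = j)
    (z : LinearMap.ker (L.d n j).hom) :
    homologyClass L n j hj z = 0 ↔ ∃ y, (L.d i n).hom y = z := by
  have hex : (ShortComplex.mk (L.toCycles i n) (L.homologyπ n)
      (L.toCycles_comp_homologyπ i n)).Exact :=
    ShortComplex.exact_of_g_is_cokernel _ (L.homologyIsCokernel i n hi)
  have hd (y : L.X i) : (L.iCycles n).hom ((L.toCycles i n).hom y) = (L.d i n).hom y :=
    LinearMap.congr_fun (ModuleCat.hom_ext_iff.1 (L.toCycles_i i n)) y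
  constructor
  · intro h
    obtain ⟨y, hy⟩ := (ShortComplex.moduleCat_exact_iff _).1 hex _ h
    refine ⟨y, (hd y).symm.trans (Eq.trans ?_ (iCycles_toCycle L n j hj z))⟩
    exact congrArg _ hy
  · rintro ⟨y, hy⟩
    have : (L.toCycles i n).hom y = toCycle L n j hj z :=
      iCycles_injective L n ((hd y).trans (hy.trans (iCycles_toCycle L n j hj z).symm))
    refine (congrArg (L.homologyπ n).hom this).symm.trans ?_
    exact LinearMap.congr_fun (ModuleCat.hom_ext_iff.1 (L.toCycles_comp_homologyπ i n)) y

variable {L} in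
theorem homologyMap_homologyClass {L' : HomologicalComplex (ModuleCat.{u} R) c} (φ : L ⟶ L')
    (hj : c.next n = j) (z : LinearMap.ker (L.d n j).hom) (z' : LinearMap.ker (L'.d n j).hom)
    (h : (φ.f n).hom z = z') :
    (HomologicalComplex.homologyMap φ n).hom (homologyClass L n j hj z) =
      homologyClass L' n j hj z' := by
  have h1 := LinearMap.congr_fun (ModuleCat.hom_ext_iff.1
    (HomologicalComplex.homologyπ_naturality φ n)) (toCycle L n j hj z)
  have h2 : (HomologicalComplex.cyclesMap φ n).hom (toCycle L n j hj z) = toCycle L' n j hj z' := by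
    refine iCycles_injective L' n ?_
    rw [iCycles_toCycle, ← h, ← iCycles_toCycle L n j hj z]
    exact LinearMap.congr_fun (ModuleCat.hom_ext_iff.1 (HomologicalComplex.cyclesMap_i φ n)) _
  exact h1.trans (congrArg (L'.homologyπ n).hom h2)

end HomologyClass

section Ext
open CategoryTheory Limits

variable {R : Type u} [CommRing R]

theorem comp_inv_of_comm {C : Type*} [Category* C] {A B A₁ B₁ A₂ B₂ : C} (a : A ⟶ B) (p : B ⟶ B₁)
    (q : A ⟶ A₁) (m : A₁ ⟶ B₁) (u : A₂ ≅ A₁) (w : B₂ ≅ B₁) (ψ : A₂ ⟶ B₂) (h1 : a ≫ p = q ≫ m)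
    (h2 : u.hom ≫ m = ψ ≫ w.hom) : a ≫ p ≫ w.inv = (q ≫ u.inv) ≫ ψ := by
  rw [reassoc_of% h1, Category.assoc]
  congr 1
  rw [Iso.comp_inv_eq, Category.assoc, ← h2, Iso.inv_hom_id_assoc]

/-- The computation of `Ext` by a projective resolution is natural in the first argument. -/
theorem ext_map_isoExt {X Y : ModuleCat.{u} R} (f : X ⟶ Y) (P : ProjectiveResolution X)
    (Q : ProjectiveResolution Y) (φ : P.complex ⟶ Q.complex)
    (comm : φ.f 0 ≫ Q.π.f 0 = P.π.f 0 ≫ f) (N : ModuleCat.{u} R) (n : ℕ) :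
    ((Ext R (ModuleCat.{u} R) n).map f.op).app N ≫ (P.isoExt n N).hom =
      (Q.isoExt n N).hom ≫ HomologicalComplex.homologyMap
        ((HomologicalComplex.unopFunctor _ _).map
          ((((linearYoneda R (ModuleCat.{u} R)).obj N).rightOp.mapHomologicalComplex _).map
            φ).op) n := by
  have h1 := ProjectiveResolution.isoLeftDerivedObj_inv_naturality f P Q φ comm
    ((linearYoneda R (ModuleCat.{u} R)).obj N).rightOp n
  let F := ((linearYoneda R (ModuleCat.{u} R)).obj N).rightOp
  let φ' := (F.mapHomologicalComplex (ComplexShape.down ℕ)).map φ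
  let ψ := (HomologicalComplex.unopFunctor _ _).map φ'.op
  have h2 := HomologicalComplex.homologyOp_hom_naturality ψ n
  have h1' : ((F.leftDerived n).map f).unop ≫ (P.isoLeftDerivedObj F n).inv.unop =
      (Q.isoLeftDerivedObj F n).inv.unop ≫ (HomologicalComplex.homologyMap φ' n).unop :=
    congrArg Quiver.Hom.unop h1
  have h2' : (HomologicalComplex.homologyUnop ((F.mapHomologicalComplex _).obj Q.complex) n).hom ≫
      (HomologicalComplex.homologyMap φ' n).unop = HomologicalComplex.homologyMap ψ n ≫
      (HomologicalComplex.homologyUnop ((F.mapHomologicalComplex _).obj P.complex) n).hom :=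
    congrArg Quiver.Hom.unop h2
  exact comp_inv_of_comm _ _ _ _ _ _ _ h1' h2'

/-- The differential of the complex `Hom(P, N)`. -/
def homD {X : ModuleCat.{u} R} (P : ProjectiveResolution X) (N : Type u) [AddCommGroup N]
    [Module R N] (k : ℕ) : (P.complex.X k →ₗ[R] N) →ₗ[R] (P.complex.X (k + 1) →ₗ[R] N) :=
  LinearMap.lcomp R N (P.complex.d (k + 1) k).hom

/-- The coboundaries of the complex `Hom(P, N)`. -/
def homB {X : ModuleCat.{u} R} (P : ProjectiveResolution X) (N : Type u) [AddCommGroup N]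
    [Module R N] : (k : ℕ) → Submodule R (P.complex.X k →ₗ[R] N)
  | 0 => ⊥
  | k + 1 => LinearMap.range (homD P N k)

variable {X : ModuleCat.{u} R} (P : ProjectiveResolution X) (N : Type u) [AddCommGroup N]
    [Module R N]

/-- The cocycles of `Hom(P, N)`, as cycles of Mathlib's complex of morphisms. -/
def homCocycle (k : ℕ) : LinearMap.ker (homD P N k) →ₗ[R]
    LinearMap.ker ((P.complex.linearYonedaObj R (ModuleCat.of R N)).d k (k + 1)).hom where
  toFun z := ⟨(ModuleCat.ofHom z.1 : P.complex.X k ⟶ ModuleCat.of R N), ModuleCat.hom_ext z.2⟩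
  map_add' _ _ := rfl
  map_smul' _ _ := rfl

/-- The class of a cocycle of `Hom(P, N)` in `Ext X N`. -/
def extClass (k : ℕ) : LinearMap.ker (homD P N k) →ₗ[R]
    ((Ext R (ModuleCat.{u} R) k).obj (Opposite.op X)).obj (ModuleCat.of R N) :=
  (P.isoExt (R := R) k (ModuleCat.of R N)).inv.hom ∘ₗ
    homologyClass (P.complex.linearYonedaObj R (ModuleCat.of R N)) k (k + 1) (by simp) ∘ₗ
      homCocycle P N k

theorem extClass_surjective (k : ℕ) : Function.Surjective (extClass P N k) := by
  intro x
  obtain ⟨z, hz⟩ := homologyClass_surjective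
    (P.complex.linearYonedaObj R (ModuleCat.of R N)) k (k + 1) (by simp)
    ((P.isoExt (R := R) k (ModuleCat.of R N)).hom.hom x)
  refine ⟨⟨(show P.complex.X k ⟶ ModuleCat.of R N from z.1).hom, ModuleCat.hom_ext_iff.1 z.2⟩, ?_⟩
  refine (congrArg (P.isoExt (R := R) k (ModuleCat.of R N)).inv.hom hz).trans ?_
  exact LinearMap.congr_fun (ModuleCat.hom_ext_iff.1
    (P.isoExt (R := R) k (ModuleCat.of R N)).hom_inv_id) x

theorem extClass_eq_zero_iff (k : ℕ) (z : LinearMap.ker (homD P N k)) :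
    extClass P N k z = 0 ↔ z.1 ∈ homB P N k := by
  have h1 (y) : (P.isoExt (R := R) k (ModuleCat.of R N)).inv.hom y = 0 ↔ y = 0 :=
    map_eq_zero_iff _ ((ModuleCat.mono_iff_injective _).1 inferInstance)
  refine (h1 _).trans ?_
  cases k with
  | zero =>
    refine (homologyClass_eq_zero_iff _ 0 0 1 (by simp) (by simp) _).trans ?_
    have hd : (P.complex.linearYonedaObj R (ModuleCat.of R N)).d 0 0 = 0 :=
      HomologicalComplex.shape _ _ _ (by simp)
    rw [hd]
    constructor
    · rintro ⟨y, hy⟩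
      exact (congrArg ModuleCat.Hom.hom hy).symm
    · intro h
      obtain rfl : z = 0 := Subtype.ext ((Submodule.mem_bot R).1 h)
      exact ⟨0, rfl⟩
  | succ k =>
    refine (homologyClass_eq_zero_iff _ k (k + 1) (k + 1 + 1) (by simp) (by simp) _).trans ?_
    constructor
    · rintro ⟨y, hy⟩
      exact ⟨ModuleCat.Hom.hom y, congrArg ModuleCat.Hom.hom hy⟩
    · rintro ⟨y, hy⟩
      exact ⟨ModuleCat.ofHom y, ModuleCat.hom_ext hy⟩

variable {P} {N} in
theorem ext_map_extClass {Y : ModuleCat.{u} R} (f : X ⟶ Y)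
    (Q : ProjectiveResolution Y) (φ : P.complex ⟶ Q.complex)
    (comm : φ.f 0 ≫ Q.π.f 0 = P.π.f 0 ≫ f) (k : ℕ) (z : LinearMap.ker (homD Q N k))
    (z' : LinearMap.ker (homD P N k)) (h : z.1 ∘ₗ (φ.f k).hom = z'.1) :
    (((Ext R (ModuleCat.{u} R) k).map f.op).app (ModuleCat.of R N)).hom (extClass Q N k z) =
      extClass P N k z' := by
  have h1 := ext_map_isoExt f P Q φ comm (ModuleCat.of R N) k
  refine ((ModuleCat.mono_iff_injective (P.isoExt (R := R) k (ModuleCat.of R N)).hom).1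
    inferInstance) ?_
  refine (LinearMap.congr_fun (ModuleCat.hom_ext_iff.1 h1) _).trans ?_
  refine Eq.trans ?_ (LinearMap.congr_fun (ModuleCat.hom_ext_iff.1
    (P.isoExt (R := R) k (ModuleCat.of R N)).inv_hom_id) _).symm
  refine (congrArg _ (LinearMap.congr_fun (ModuleCat.hom_ext_iff.1
    (Q.isoExt (R := R) k (ModuleCat.of R N)).inv_hom_id) _)).trans ?_
  exact homologyMap_homologyClass k (k + 1) _ _ _ _ (ModuleCat.hom_ext h)

theorem homD_comp {Y : ModuleCat.{u} R} (Q : ProjectiveResolution Y) (φ : P.complex ⟶ Q.complex)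
    (k : ℕ) (z : Q.complex.X k →ₗ[R] N) :
    homD P N k (z ∘ₗ (φ.f k).hom) = homD Q N k z ∘ₗ (φ.f (k + 1)).hom := by
  refine LinearMap.ext fun x => congrArg z ?_
  exact (LinearMap.congr_fun (ModuleCat.hom_ext_iff.1 (φ.comm (k + 1) k)) x).symm

end Ext

section LocalCohomology
open CategoryTheory Limits

variable {R : Type u} [CommRing R] (I : Ideal R)

/-- A projective resolution of `R ⧸ I ^ t`. -/
def powResolution (t : ℕ) : ProjectiveResolution (ModuleCat.of R (R ⧸ I ^ t)) :=
  projectiveResolution _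

/-- The projection `R ⧸ I ^ s → R ⧸ I ^ t`. -/
def powProj {t s : ℕ} (h : t ≤ s) : ModuleCat.of R (R ⧸ I ^ s) ⟶ ModuleCat.of R (R ⧸ I ^ t) :=
  ModuleCat.ofHom (Submodule.mapQ _ _ LinearMap.id (Ideal.pow_le_pow_right h))

/-- A lift of the projection `R ⧸ I ^ s → R ⧸ I ^ t` to the resolutions. -/
def powLift {t s : ℕ} (h : t ≤ s) : (powResolution I s).complex ⟶ (powResolution I t).complex :=
  ProjectiveResolution.lift (powProj I h) _ _

theorem powLift_comm {t s : ℕ} (h : t ≤ s) :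
    (powLift I h).f 0 ≫ (powResolution I t).π.f 0 = (powResolution I s).π.f 0 ≫ powProj I h :=
  ProjectiveResolution.lift_commutes_zero _ _ _

variable (N : Type u) [AddCommGroup N] [Module R N] (k : ℕ)

/-- The pullback of cocycles along `powLift`. -/
def cocycleMap {t s : ℕ} (h : t ≤ s) : LinearMap.ker (homD (powResolution I t) N k) →ₗ[R]
    LinearMap.ker (homD (powResolution I s) N k) :=
  LinearMap.restrict (LinearMap.lcomp R N ((powLift I h).f k).hom) fun z hz => by
    refine (homD_comp _ N _ (powLift I h) k z).trans ?_
    rw [LinearMap.mem_ker.1 hz, LinearMap.zero_comp]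

theorem coe_cocycleMap {t s : ℕ} (h : t ≤ s) (z) :
    (cocycleMap I N k h z).1 = z.1 ∘ₗ ((powLift I h).f k).hom := rfl

/-- The class in `H^k_I(N)` of a cocycle of `Hom(P, N)`, where `P` is the resolution of
`R ⧸ I ^ t`. -/
def localClass (t : ℕ) : LinearMap.ker (homD (powResolution I t) N k) →ₗ[R]
    (localCohomology I k).obj (ModuleCat.of R N) :=
  ((colimit.ι (localCohomology.diagram (localCohomology.idealPowersDiagram I) k)
    (Opposite.op (Opposite.op t))).app (ModuleCat.of R N)).hom ∘ₗ extClass (powResolution I t) N k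

theorem diagram_map_extClass {t s : ℕ} (h : t ≤ s) (f : Opposite.op (Opposite.op t) ⟶
      Opposite.op (Opposite.op s)) (z : LinearMap.ker (homD (powResolution I t) N k)) :
    (((localCohomology.diagram (localCohomology.idealPowersDiagram I) k).map f).app
      (ModuleCat.of R N)).hom (extClass (powResolution I t) N k z) =
        extClass (powResolution I s) N k (cocycleMap I N k h z) :=
  ext_map_extClass (powProj I h) (powResolution I t) (powLift I h) (powLift_comm I h) k z _ rfl

theorem localClass_cocycleMap {t s : ℕ} (h : t ≤ s)
    (z : LinearMap.ker (homD (powResolution I t) N k)) :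
    localClass I N k s (cocycleMap I N k h z) = localClass I N k t z := by
  let f : Opposite.op (Opposite.op t) ⟶ Opposite.op (Opposite.op s) := (homOfLE h).op.op
  refine (congrArg _ (diagram_map_extClass I N k h f z)).symm.trans ?_
  have := colimit.w (localCohomology.diagram (localCohomology.idealPowersDiagram I) k) f
  exact LinearMap.congr_fun (ModuleCat.hom_ext_iff.1 (NatTrans.congr_app this (ModuleCat.of R N))) _

/-- The evaluation of the colimit defining local cohomology. -/
def isColimitLocalCohomology := isColimitOfPreserves ((evaluation _ _).obj (ModuleCat.of R N))
  (colimit.isColimit (localCohomology.diagram (localCohomology.idealPowersDiagram I) k))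

instance : PreservesFilteredColimitsOfSize.{0, 0} (forget (ModuleCat.{u} R)) :=
  preservesFilteredColimitsOfSize_of_univLE.{u, u} _

theorem exists_localClass_eq (x : (localCohomology I k).obj (ModuleCat.of R N)) :
    ∃ t z, localClass I N k t z = x := by
  obtain ⟨⟨⟨t⟩⟩, y, hy⟩ := Concrete.isColimit_exists_rep _ (isColimitLocalCohomology I N k) x
  obtain ⟨z, rfl⟩ := extClass_surjective (powResolution I t) N k y
  exact ⟨t, z, hy⟩

/-- A cocycle has trivial class in `H^k_I(N)` if and only if it becomes a coboundary on the
resolution of some `R ⧸ I ^ s` with `s ≥ t`. -/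
theorem localClass_eq_zero_iff (t : ℕ) (z : LinearMap.ker (homD (powResolution I t) N k)) :
    localClass I N k t z = 0 ↔
      ∃ (s : ℕ) (h : t ≤ s), z.1 ∘ₗ ((powLift I h).f k).hom ∈ homB (powResolution I s) N k := by
  constructor
  · intro h
    obtain ⟨⟨⟨s⟩⟩, f, g, hfg⟩ := (Concrete.isColimit_rep_eq_iff_exists _
      (isColimitLocalCohomology I N k) (i := Opposite.op (Opposite.op t))
      (j := Opposite.op (Opposite.op t)) (extClass (powResolution I t) N k z) 0).1
        (by exact h.trans (map_zero _).symm)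
    have hts : t ≤ s := leOfHom f.unop.unop
    refine ⟨s, hts, ?_⟩
    rw [← coe_cocycleMap, ← extClass_eq_zero_iff, ← diagram_map_extClass I N k hts f]
    exact hfg.trans (map_zero _)
  · rintro ⟨s, h, hz⟩
    rw [← localClass_cocycleMap I N k h]
    rw [← coe_cocycleMap, ← extClass_eq_zero_iff] at hz
    exact (congrArg _ hz).trans (LinearMap.map_zero ((colimit.ι (localCohomology.diagram
      (localCohomology.idealPowersDiagram I) k) (Opposite.op (Opposite.op s))).app
        (ModuleCat.of R N)).hom)

end LocalCohomology
end FRep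
end

noncomputable section
namespace FRep

/-! ### Dimension shifting -/

section Shift

variable {R : Type*} [CommRing R] {A B C : ℕ → Type*}
  [∀ k, AddCommGroup (A k)] [∀ k, Module R (A k)]
  [∀ k, AddCommGroup (B k)] [∀ k, Module R (B k)]
  [∀ k, AddCommGroup (C k)] [∀ k, Module R (C k)]

/-- The coboundaries of a sequence of linear maps. -/
def bdry (d : ∀ k, A k →ₗ[R] A (k + 1)) : (k : ℕ) → Submodule R (A k)
  | 0 => ⊥
  | k + 1 => LinearMap.range (d k)

/-- A short exact sequence `0 → A → B → C → 0` of complexes of modules; that `A` and `C` are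
complexes follows from the same property of `B`. -/
structure ComplexSES (dA : ∀ k, A k →ₗ[R] A (k + 1)) (dB : ∀ k, B k →ₗ[R] B (k + 1))
    (dC : ∀ k, C k →ₗ[R] C (k + 1)) where
  /-- the inclusion -/
  i : ∀ k, A k →ₗ[R] B k
  /-- the projection -/
  p : ∀ k, B k →ₗ[R] C k
  d_d : ∀ k x, dB (k + 1) (dB k x) = 0
  i_d : ∀ k x, i (k + 1) (dA k x) = dB k (i k x)
  p_d : ∀ k x, p (k + 1) (dB k x) = dC k (p k x)
  i_injective : ∀ k, Function.Injective (i k)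
  p_surjective : ∀ k, Function.Surjective (p k)
  exact : ∀ k x, p k x = 0 ↔ ∃ y, i k y = x

namespace ComplexSES

variable {dA : ∀ k, A k →ₗ[R] A (k + 1)} {dB : ∀ k, B k →ₗ[R] B (k + 1)}
  {dC : ∀ k, C k →ₗ[R] C (k + 1)} (s : ComplexSES dA dB dC) (k : ℕ)

theorem p_i (x : A k) : s.p k (s.i k x) = 0 := (s.exact k _).2 ⟨x, rfl⟩

/-- The elements of `B` lying over a cocycle of `C`. The cocycles of `C` in degree `k`, and, where
`B` is exact, the cocycles of `A` in degree `k + 1`, are quotients of it by `toC` and `toA`. -/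
def preCocycles : Submodule R (B k) := LinearMap.ker (dC k ∘ₗ s.p k)

/-- The cocycle of `C` under an element of `preCocycles`. -/
def toC : s.preCocycles k →ₗ[R] LinearMap.ker (dC k) := (s.p k).restrict fun _ h => h

theorem toC_surjective : Function.Surjective (s.toC k) := by
  rintro ⟨c, hc⟩
  obtain ⟨b, rfl⟩ := s.p_surjective k c
  exact ⟨⟨b, hc⟩, rfl⟩

theorem exists_i_eq (b : s.preCocycles k) : ∃ a, s.i (k + 1) a = dB k b.1 :=
  (s.exact (k + 1) _).1 ((s.p_d k b.1).trans b.2)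

/-- The connecting homomorphism, on the level of cocycles: `b` goes to the element of `A` whose
image in `B` is the coboundary of `b`. -/
def toA : s.preCocycles k →ₗ[R] LinearMap.ker (dA (k + 1)) where
  toFun b := ⟨(s.exists_i_eq k b).choose, s.i_injective _ (by
    rw [s.i_d, (s.exists_i_eq k b).choose_spec, s.d_d, map_zero])⟩
  map_add' b b' := Subtype.ext (s.i_injective _ (by
    refine (s.exists_i_eq k (b + b')).choose_spec.trans ?_
    rw [Submodule.coe_add, Submodule.coe_add, map_add, map_add]
    exact congrArg₂ (· + ·) (s.exists_i_eq k b).choose_spec.symm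
      (s.exists_i_eq k b').choose_spec.symm))
  map_smul' r b := Subtype.ext (s.i_injective _ (by
    refine (s.exists_i_eq k (r • b)).choose_spec.trans ?_
    rw [Submodule.coe_smul, Submodule.coe_smul, map_smul, map_smul]
    exact congrArg (r • ·) (s.exists_i_eq k b).choose_spec.symm))

theorem i_toA (b : s.preCocycles k) : s.i (k + 1) (s.toA k b).1 = dB k b.1 :=
  (s.exists_i_eq k b).choose_spec

theorem toA_surjective (hB : LinearMap.ker (dB (k + 1)) ≤ LinearMap.range (dB k)) :
    Function.Surjective (s.toA k) := by
  rintro ⟨a, ha⟩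
  have h : dB (k + 1) (s.i (k + 1) a) = 0 := by rw [← s.i_d, ha, map_zero]
  obtain ⟨b, hb⟩ := hB h
  refine ⟨⟨b, ?_⟩, Subtype.ext (s.i_injective _ ?_)⟩
  · change dC k (s.p k b) = 0
    rw [← s.p_d, hb, s.p_i]
  · rw [i_toA, hb]

/-- The connecting homomorphism kills the classes of those cocycles of `C` which lift to a cocycle
of `B`. -/
theorem toA_mem_range_iff (b : s.preCocycles k) :
    (s.toA k b).1 ∈ LinearMap.range (dA k) ↔ ∃ z : LinearMap.ker (dB k), s.p k z.1 = s.p k b.1 := by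
  constructor
  · rintro ⟨a, ha⟩
    refine ⟨⟨b.1 - s.i k a, ?_⟩, ?_⟩
    · rw [LinearMap.mem_ker, map_sub, ← s.i_toA, ← ha, s.i_d, sub_self]
    · rw [map_sub, s.p_i, sub_zero]
  · rintro ⟨z, hz⟩
    obtain ⟨a, ha⟩ := (s.exact k (b.1 - z.1)).1 (by rw [map_sub, hz, sub_self])
    refine ⟨a, s.i_injective _ ?_⟩
    rw [s.i_d, ha, map_sub, z.2, sub_zero, i_toA]

/-- Where `B` is exact, only the coboundaries of `C` lift to cocycles of `B`. -/
theorem mem_range_dC_iff (hB : LinearMap.ker (dB (k + 1)) ≤ LinearMap.range (dB k))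
    (b : B (k + 1)) : (∃ z : LinearMap.ker (dB (k + 1)), s.p (k + 1) z.1 = s.p (k + 1) b) ↔
      s.p (k + 1) b ∈ LinearMap.range (dC k) := by
  constructor
  · rintro ⟨z, hz⟩
    obtain ⟨y, hy⟩ := hB z.2
    exact ⟨s.p k y, by rw [← hz, ← hy, s.p_d]⟩
  · rintro ⟨c, hc⟩
    obtain ⟨y, rfl⟩ := s.p_surjective k c
    exact ⟨⟨dB k y, s.d_d k y⟩, by rw [← hc, ← s.p_d]⟩

end ComplexSES

/-- Two modules which are colimits of quotients of the same directed system, by the same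
relations, are isomorphic. -/
theorem nonempty_equiv_of_presentations {Q : ℕ → Type*} [∀ t, AddCommGroup (Q t)]
    [∀ t, Module R (Q t)] (tr : ∀ {t s : ℕ}, t ≤ s → Q t →ₗ[R] Q s) {T V : Type*}
    [AddCommGroup T] [Module R T] [AddCommGroup V] [Module R V] (τ : ∀ t, Q t →ₗ[R] T)
    (w : ∀ t, Q t →ₗ[R] V) (hτ : ∀ {t s : ℕ} (h : t ≤ s) q, τ s (tr h q) = τ t q)
    (hw : ∀ {t s : ℕ} (h : t ≤ s) q, w s (tr h q) = w t q) (sτ : ∀ x, ∃ t q, τ t q = x)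
    (sw : ∀ x, ∃ t q, w t q = x) (hτw : ∀ t q, τ t q = 0 ↔ w t q = 0) :
    Nonempty (T ≃ₗ[R] V) := by
  let τ' := DirectSum.toModule R ℕ T τ
  let w' := DirectSum.toModule R ℕ V w
  have key (x) : ∃ t q, τ t q = τ' x ∧ w t q = w' x := by
    induction x using DirectSum.induction_on with
    | zero => exact ⟨0, 0, by simp, by simp⟩
    | of t q =>
      exact ⟨t, q, (DirectSum.toModule_lof R t q).symm, (DirectSum.toModule_lof R t q).symm⟩
    | add x y hx hy =>
      obtain ⟨t, q, h1, h2⟩ := hx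
      obtain ⟨t', q', h1', h2'⟩ := hy
      refine ⟨max t t', tr (le_max_left _ _) q + tr (le_max_right _ _) q', ?_, ?_⟩
      · rw [map_add, map_add, hτ, hτ, h1, h1']
      · rw [map_add, map_add, hw, hw, h2, h2']
  have hker : LinearMap.ker τ' = LinearMap.ker w' := by
    ext x
    obtain ⟨t, q, h1, h2⟩ := key x
    rw [LinearMap.mem_ker, LinearMap.mem_ker, ← h1, ← h2, hτw]
  have sτ' : Function.Surjective τ' := fun x => by
    obtain ⟨t, q, rfl⟩ := sτ x
    exact ⟨DirectSum.lof R ℕ Q t q, DirectSum.toModule_lof R t q⟩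
  have sw' : Function.Surjective w' := fun x => by
    obtain ⟨t, q, rfl⟩ := sw x
    exact ⟨DirectSum.lof R ℕ Q t q, DirectSum.toModule_lof R t q⟩
  exact ⟨(τ'.quotKerEquivOfSurjective sτ').symm ≪≫ₗ Submodule.quotEquivOfEq _ _ hker ≪≫ₗ
    w'.quotKerEquivOfSurjective sw'⟩

end Shift

section HomShift
open CategoryTheory

variable {R : Type u} [CommRing R] {X : ModuleCat.{u} R} (P : ProjectiveResolution X)
  {M E C : Type u} [AddCommGroup M] [Module R M] [AddCommGroup E] [Module R E]
  [AddCommGroup C] [Module R C]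

/-- The complexes `Hom(P, M)`, `Hom(P, E)`, `Hom(P, C)` for a short exact sequence
`0 → M → E → C → 0`. -/
def homSES (i : M →ₗ[R] E) (p : E →ₗ[R] C) (hi : Function.Injective i)
    (hp : Function.Surjective p) (hip : Function.Exact i p) :
    ComplexSES (homD P M) (homD P E) (homD P C) where
  i k := i.compRight R
  p k := p.compRight R
  d_d k z := LinearMap.ext fun x => by
    have h := LinearMap.congr_fun (ModuleCat.hom_ext_iff.1
      (P.complex.d_comp_d (k + 1 + 1) (k + 1) k)) x
    exact (congrArg z h).trans (map_zero z)
  i_d _ _ := rfl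
  p_d _ _ := rfl
  i_injective k z z' h := LinearMap.ext fun x => hi (LinearMap.congr_fun h x)
  p_surjective k z := by
    have : Module.Projective R (P.complex.X k) :=
      (IsProjective.iff_projective _).2 (P.projective k)
    exact Module.projective_lifting_property p z hp
  exact k z := by
    constructor
    · intro h
      refine ⟨(LinearEquiv.ofInjective i hi).symm.toLinearMap ∘ₗ z.codRestrict (LinearMap.range i)
        fun x => (hip _).1 (LinearMap.congr_fun h x), LinearMap.ext fun x => ?_⟩
      exact congrArg Subtype.val ((LinearEquiv.ofInjective i hi).apply_symm_apply _)
    · rintro ⟨y, rfl⟩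
      exact LinearMap.ext fun x => (hip _).2 ⟨y x, rfl⟩

/-- If `E` is injective, the complex `Hom(P, E)` is exact in positive degrees. -/
theorem ker_homD_le_of_baer (hE : Module.Baer R E) (k : ℕ) :
    LinearMap.ker (homD P E (k + 1)) ≤ LinearMap.range (homD P E k) := by
  intro z hz
  let d := (P.complex.d (k + 1) k).hom
  have hd : LinearMap.ker d ≤ LinearMap.ker z := by
    intro x hx
    obtain ⟨y, rfl⟩ := (ShortComplex.moduleCat_exact_iff _).1 (P.exact_succ k) x hx
    exact LinearMap.congr_fun hz y
  obtain ⟨h, hh⟩ := hE.extension_property ((LinearMap.ker d).liftQ d le_rfl)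
    (LinearMap.ker_eq_bot.1 (Submodule.ker_liftQ_eq_bot _ _ _ le_rfl))
    ((LinearMap.ker d).liftQ z hd)
  exact ⟨h, LinearMap.ext fun x => LinearMap.congr_fun hh ((LinearMap.ker d).mkQ x)⟩

end HomShift

section LocalShift
open CategoryTheory

variable {R : Type u} [CommRing R] (I : Ideal R)
  {M E C N : Type u} [AddCommGroup M] [Module R M] [AddCommGroup E] [Module R E]
  [AddCommGroup C] [Module R C] [AddCommGroup N] [Module R N]

variable (N) in
/-- The submodule of elements killed by a power of the ideal `I`. -/
def powTorsion : Submodule R N where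
  carrier := {x | ∃ t, ∀ r ∈ I ^ t, r • x = 0}
  zero_mem' := ⟨0, fun r _ => smul_zero r⟩
  add_mem' := by
    rintro x y ⟨t, ht⟩ ⟨s, hs⟩
    exact ⟨max t s, fun r hr => by
      rw [smul_add, ht r (Ideal.pow_le_pow_right (le_max_left _ _) hr),
        hs r (Ideal.pow_le_pow_right (le_max_right _ _) hr), add_zero]⟩
  smul_mem' := by
    rintro c x ⟨t, ht⟩
    exact ⟨t, fun r hr => by rw [smul_comm, ht r hr, smul_zero]⟩

/-- The restriction of a linear map to the `I`-power torsion submodules. -/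
def powTorsionMap (p : E →ₗ[R] C) : powTorsion I E →ₗ[R] powTorsion I C :=
  p.restrict fun x ⟨t, ht⟩ => ⟨t, fun r hr => by rw [← map_smul, ht r hr, map_zero]⟩

theorem exists_augmentation_eq_one (t : ℕ) : ∃ x : (powResolution I t).complex.X 0,
    ((powResolution I t).π.f 0).hom x = (Ideal.Quotient.mk (I ^ t) 1) :=
  (ModuleCat.epi_iff_surjective ((powResolution I t).π.f 0)).1 inferInstance _

/-- A lift of `1 ∈ R ⧸ I ^ t` to the resolution of `R ⧸ I ^ t`. -/
def powGen (t : ℕ) : (powResolution I t).complex.X 0 := (exists_augmentation_eq_one I t).choose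

theorem augmentation_powGen (t : ℕ) : ((powResolution I t).π.f 0).hom (powGen I t) =
    (Ideal.Quotient.mk (I ^ t) 1) :=
  (exists_augmentation_eq_one I t).choose_spec

theorem cocycle_eq_zero_of_augmentation {t : ℕ}
    (z : LinearMap.ker (homD (powResolution I t) N 0)) (x : (powResolution I t).complex.X 0)
    (hx : ((powResolution I t).π.f 0).hom x = 0) : z.1 x = 0 := by
  obtain ⟨y, rfl⟩ := (ShortComplex.moduleCat_exact_iff _).1 (powResolution I t).exact₀ x hx
  exact LinearMap.congr_fun z.2 y

/-- The value of a `0`-cocycle at the generator. -/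
def evalGen (t : ℕ) : LinearMap.ker (homD (powResolution I t) N 0) →ₗ[R] powTorsion I N where
  toFun z := ⟨z.1 (powGen I t), t, fun r hr => by
    rw [← map_smul]
    refine cocycle_eq_zero_of_augmentation I z _ ?_
    rw [map_smul, augmentation_powGen]
    refine (Submodule.Quotient.mk_eq_zero (I ^ t)).2 ?_
    exact Ideal.mul_mem_right _ _ hr⟩
  map_add' _ _ := rfl
  map_smul' _ _ := rfl

theorem evalGen_injective (t : ℕ) : Function.Injective (evalGen I (N := N) t) := by
  refine (injective_iff_map_eq_zero _).2 fun z hz => Subtype.ext (LinearMap.ext fun x => ?_)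
  have hz : z.1 (powGen I t) = 0 := congrArg Subtype.val hz
  obtain ⟨r, hr⟩ := Ideal.Quotient.mk_surjective (((powResolution I t).π.f 0).hom x)
  have h := cocycle_eq_zero_of_augmentation I z (x - r • powGen I t) (by
    rw [map_sub, map_smul, augmentation_powGen, sub_eq_zero]
    refine hr.symm.trans ?_
    exact congrArg (Ideal.Quotient.mk (I ^ t)) (mul_one r).symm)
  rw [map_sub, map_smul, hz, smul_zero, sub_zero] at h
  exact h

theorem exists_evalGen_eq (t : ℕ) (x : powTorsion I N) (hx : ∀ r ∈ I ^ t, r • x.1 = 0) :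
    ∃ z, evalGen I t z = x := by
  let g : (R ⧸ I ^ t) →ₗ[R] N := (I ^ t).liftQ (LinearMap.toSpanSingleton R N x.1) hx
  refine ⟨⟨g ∘ₗ ((powResolution I t).π.f 0).hom, LinearMap.ext fun y => ?_⟩, Subtype.ext ?_⟩
  · have h := LinearMap.congr_fun (ModuleCat.hom_ext_iff.1
      (powResolution I t).complex_d_comp_π_f_zero) y
    exact (congrArg g h).trans (map_zero g)
  · refine (congrArg g (augmentation_powGen I t)).trans ?_
    exact one_smul R x.1

theorem evalGen_cocycleMap {t s : ℕ} (h : t ≤ s)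
    (z : LinearMap.ker (homD (powResolution I t) N 0)) :
    evalGen I s (cocycleMap I N 0 h z) = evalGen I t z := by
  refine Subtype.ext (sub_eq_zero.1 ?_)
  change z.1 _ - z.1 _ = 0
  rw [← map_sub]
  refine cocycle_eq_zero_of_augmentation I z _ ?_
  refine (map_sub _ _ _).trans (sub_eq_zero.2 (Eq.trans ?_ (augmentation_powGen I t).symm))
  refine (LinearMap.congr_fun (ModuleCat.hom_ext_iff.1 (powLift_comm I h)) _).trans ?_
  exact congrArg (powProj I h).hom (augmentation_powGen I s)

variable (N) in
theorem nonempty_localCohomology_zero_equiv :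
    Nonempty ((localCohomology I 0).obj (ModuleCat.of R N) ≃ₗ[R] powTorsion I N) := by
  refine nonempty_equiv_of_presentations (fun h => cocycleMap I N 0 h) (localClass I N 0)
    (evalGen I) (localClass_cocycleMap I N 0) (evalGen_cocycleMap I) (exists_localClass_eq I N 0)
    (fun x => ?_) fun t z => ?_
  · obtain ⟨t, ht⟩ := x.2
    exact ⟨t, exists_evalGen_eq I t x ht⟩
  · rw [localClass_eq_zero_iff]
    constructor
    · rintro ⟨s, h, hz⟩
      rw [← evalGen_cocycleMap I h, show cocycleMap I N 0 h z = 0 from Subtype.ext hz, map_zero]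
    · intro hz
      obtain rfl := evalGen_injective I t (hz.trans (map_zero _).symm)
      exact ⟨t, le_rfl, zero_mem _⟩

variable {i : M →ₗ[R] E} {p : E →ₗ[R] C} (hi : Function.Injective i)
    (hp : Function.Surjective p) (hip : Function.Exact i p)

/-- The pullback of `homSES.preCocycles` along the lifts between the resolutions. -/
def overMap (k : ℕ) {t s : ℕ} (h : t ≤ s) :
    (homSES (powResolution I t) i p hi hp hip).preCocycles k →ₗ[R]
      (homSES (powResolution I s) i p hi hp hip).preCocycles k :=
  LinearMap.restrict (LinearMap.lcomp R E ((powLift I h).f k).hom) fun b hb =>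
    (cocycleMap I C k h ⟨p ∘ₗ b, hb⟩).2

theorem toC_overMap (k : ℕ) {t s : ℕ} (h : t ≤ s)
    (b : (homSES (powResolution I t) i p hi hp hip).preCocycles k) :
    (homSES (powResolution I s) i p hi hp hip).toC k (overMap I hi hp hip k h b) =
      cocycleMap I C k h ((homSES (powResolution I t) i p hi hp hip).toC k b) :=
  rfl

theorem toA_overMap (k : ℕ) {t s : ℕ} (h : t ≤ s)
    (b : (homSES (powResolution I t) i p hi hp hip).preCocycles k) :
    (homSES (powResolution I s) i p hi hp hip).toA k (overMap I hi hp hip k h b) =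
      cocycleMap I M (k + 1) h ((homSES (powResolution I t) i p hi hp hip).toA k b) := by
  refine Subtype.ext ((homSES (powResolution I s) i p hi hp hip).i_injective (k + 1) ?_)
  refine (ComplexSES.i_toA _ k _).trans ?_
  refine (homD_comp _ E _ (powLift I h) k b.1).trans ?_
  have h1 := (homSES (powResolution I t) i p hi hp hip).i_toA k b
  exact congrArg (fun z => z ∘ₗ ((powLift I h).f (k + 1)).hom) h1.symm

/-- Dimension shifting in positive degrees: `H^(k+2)_I(M) ≅ H^(k+1)_I(C)` for a short exact sequence
`0 → M → E → C → 0` with `E` injective. Both are presented by the elements of `Hom(P, E)` that lie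
over a cocycle of `Hom(P, C)`. -/
theorem nonempty_localCohomology_succ_equiv (hi : Function.Injective i) (hp : Function.Surjective p)
    (hip : Function.Exact i p) (hE : Module.Baer R E) (k : ℕ) :
    Nonempty ((localCohomology I (k + 2)).obj (ModuleCat.of R M) ≃ₗ[R]
      (localCohomology I (k + 1)).obj (ModuleCat.of R C)) := by
  refine nonempty_equiv_of_presentations (fun h => overMap I hi hp hip (k + 1) h)
    (fun t => localClass I M (k + 2) t ∘ₗ (homSES (powResolution I t) i p hi hp hip).toA (k + 1))
    (fun t => localClass I C (k + 1) t ∘ₗ (homSES (powResolution I t) i p hi hp hip).toC (k + 1))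
    (fun h q => ?_) (fun h q => ?_) (fun x => ?_) (fun x => ?_) fun t q => ?_
  · rw [LinearMap.comp_apply, toA_overMap]
    exact localClass_cocycleMap I M (k + 2) h _
  · rw [LinearMap.comp_apply, toC_overMap]
    exact localClass_cocycleMap I C (k + 1) h _
  · obtain ⟨t, z, rfl⟩ := exists_localClass_eq I M (k + 2) x
    obtain ⟨q, rfl⟩ := (homSES (powResolution I t) i p hi hp hip).toA_surjective (k + 1)
      (ker_homD_le_of_baer _ hE _) z
    exact ⟨t, q, rfl⟩
  · obtain ⟨t, z, rfl⟩ := exists_localClass_eq I C (k + 1) x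
    obtain ⟨q, rfl⟩ := (homSES (powResolution I t) i p hi hp hip).toC_surjective (k + 1) z
    exact ⟨t, q, rfl⟩
  · rw [LinearMap.comp_apply, LinearMap.comp_apply, localClass_eq_zero_iff, localClass_eq_zero_iff]
    refine exists_congr fun s => exists_congr fun h => ?_
    rw [← coe_cocycleMap I M (k + 2), ← coe_cocycleMap I C (k + 1), ← toA_overMap, ← toC_overMap]
    exact ((homSES (powResolution I s) i p hi hp hip).toA_mem_range_iff (k + 1) _).trans
      ((homSES (powResolution I s) i p hi hp hip).mem_range_dC_iff k
        (ker_homD_le_of_baer _ hE _) _)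

/-- Dimension shifting to degree `0`: `H^1_I(M)` is the cokernel of `Γ_I(E) → Γ_I(C)`. -/
theorem nonempty_localCohomology_one_equiv (hi : Function.Injective i) (hp : Function.Surjective p)
    (hip : Function.Exact i p) (hE : Module.Baer R E) :
    Nonempty ((localCohomology I 1).obj (ModuleCat.of R M) ≃ₗ[R]
      (powTorsion I C ⧸ LinearMap.range (powTorsionMap I p))) := by
  refine nonempty_equiv_of_presentations (fun h => overMap I hi hp hip 0 h)
    (fun t => localClass I M 1 t ∘ₗ (homSES (powResolution I t) i p hi hp hip).toA 0)
    (fun t => (LinearMap.range (powTorsionMap I p)).mkQ ∘ₗ evalGen I t ∘ₗ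
      (homSES (powResolution I t) i p hi hp hip).toC 0)
    (fun h q => ?_) (fun h q => ?_) (fun x => ?_) (fun x => ?_) fun t q => ?_
  · rw [LinearMap.comp_apply, toA_overMap]
    exact localClass_cocycleMap I M 1 h _
  · rw [LinearMap.comp_apply, LinearMap.comp_apply, toC_overMap, evalGen_cocycleMap]
    rfl
  · obtain ⟨t, z, rfl⟩ := exists_localClass_eq I M 1 x
    obtain ⟨q, rfl⟩ := (homSES (powResolution I t) i p hi hp hip).toA_surjective 0
      (ker_homD_le_of_baer _ hE _) z
    exact ⟨t, q, rfl⟩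
  · obtain ⟨y, rfl⟩ := Submodule.mkQ_surjective _ x
    obtain ⟨t, ht⟩ := y.2
    obtain ⟨z, rfl⟩ := exists_evalGen_eq I t y ht
    obtain ⟨q, rfl⟩ := (homSES (powResolution I t) i p hi hp hip).toC_surjective 0 z
    exact ⟨t, q, rfl⟩
  · rw [LinearMap.comp_apply, LinearMap.comp_apply, localClass_eq_zero_iff, LinearMap.comp_apply,
      Submodule.mkQ_apply, Submodule.Quotient.mk_eq_zero]
    constructor
    · rintro ⟨s, h, hs⟩
      rw [← coe_cocycleMap I M 1, ← toA_overMap] at hs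
      obtain ⟨z, hz⟩ := ((homSES (powResolution I s) i p hi hp hip).toA_mem_range_iff 0 _).1 hs
      refine ⟨evalGen I s z, ?_⟩
      rw [← evalGen_cocycleMap I h, ← toC_overMap]
      exact Subtype.ext (LinearMap.congr_fun hz (powGen I s))
    · rintro ⟨e, he⟩
      obtain ⟨s', hs'⟩ := e.2
      obtain ⟨z, rfl⟩ := exists_evalGen_eq I (max t s') e
        fun r hr => hs' r (Ideal.pow_le_pow_right (le_max_right _ _) hr)
      refine ⟨max t s', le_max_left _ _, ?_⟩
      rw [← coe_cocycleMap I M 1, ← toA_overMap]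
      refine ((homSES (powResolution I (max t s')) i p hi hp hip).toA_mem_range_iff 0 _).2 ⟨z, ?_⟩
      rw [← evalGen_cocycleMap I (le_max_left t s'), ← toC_overMap] at he
      let pz : LinearMap.ker (homD (powResolution I (max t s')) C 0) := ⟨p ∘ₗ z.1, by
        rw [LinearMap.mem_ker]
        have h1 : homD (powResolution I (max t s')) C 0 (p ∘ₗ z.1) = p ∘ₗ
          (homD (powResolution I (max t s')) E 0 z.1) := rfl
        rw [h1, z.2, LinearMap.comp_zero]⟩
      exact congrArg Subtype.val (evalGen_injective I _ (a₁ := pz) he)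

end LocalShift
end FRep
end

noncomputable section
namespace FRep

/-! ### Injective modules and torsion -/

section BaerTorsion

variable {R : Type u} [CommRing R] {N : Type u} [AddCommGroup N] [Module R N]

theorem mem_powTorsion_span_singleton {f : R} {x : N} :
    x ∈ powTorsion (Ideal.span {f}) N ↔ ∃ k, f ^ k • x = 0 := by
  refine exists_congr fun k => ?_
  rw [Ideal.span_singleton_pow]
  constructor
  · exact fun h => h _ (Ideal.mem_span_singleton_self _)
  · intro h r hr
    obtain ⟨c, rfl⟩ := Ideal.mem_span_singleton'.1 hr
    rw [mul_smul, h, smul_zero]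

/-- The `I`-power torsion of an injective module over a noetherian ring is injective: a map into
it, defined on an ideal `𝔞`, vanishes on the intersection of `𝔞` with a power of `I`, by the
Artin–Rees lemma; so its extension to `R` with values in the ambient injective module can be chosen
to vanish on a power of `I`. -/
theorem baer_powTorsion [IsNoetherianRing R] (I : Ideal R) (hN : Module.Baer R N) :
    Module.Baer R (powTorsion I N) := by
  intro 𝔞 g
  -- as `𝔞` is finitely generated, one power of `I` kills the whole image of `g`
  let K : ℕ →o Submodule R 𝔞 :=
    { toFun := fun t =>
        { carrier := {x | ∀ r ∈ I ^ t, r • g x = 0}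
          zero_mem' := fun r _ => by rw [map_zero, smul_zero]
          add_mem' := fun hx hy r hr => by rw [map_add, smul_add, hx r hr, hy r hr, add_zero]
          smul_mem' := fun c x hx r hr => by rw [map_smul, smul_comm, hx r hr, smul_zero] }
      monotone' := fun t s h x hx r hr => hx r (Ideal.pow_le_pow_right h hr) }
  obtain ⟨t, ht⟩ := monotone_stabilizes_iff_noetherian.2 (inferInstance : IsNoetherian R 𝔞) K
  have hgt (x : 𝔞) (r : R) (hr : r ∈ I ^ t) : r • g x = 0 := by
    obtain ⟨s, hs⟩ := (g x).2
    have h1 : x ∈ K (max t s) := fun r hr => Subtype.ext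
      (hs r (Ideal.pow_le_pow_right (le_max_right _ _) hr))
    rw [← ht _ (le_max_left _ _)] at h1
    exact h1 r hr
  obtain ⟨k, hk⟩ := Ideal.exists_pow_inf_eq_pow_smul I 𝔞
  have hle : I ^ (k + t) ⊓ 𝔞 ≤ (LinearMap.ker g).map 𝔞.subtype := by
    have h1 := hk (k + t) (Nat.le_add_right _ _)
    rw [Nat.add_sub_cancel_left, smul_eq_mul, Ideal.mul_top] at h1
    rw [h1]
    refine Submodule.smul_le.2 fun r hr a ha => ⟨r • ⟨a, ha.2⟩, ?_, rfl⟩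
    exact (map_smul g r _).trans (hgt _ r hr)
  let φ : 𝔞 →ₗ[R] R ⧸ I ^ (k + t) := (I ^ (k + t)).mkQ ∘ₗ 𝔞.subtype
  have hφ : LinearMap.ker φ ≤ LinearMap.ker ((powTorsion I N).subtype ∘ₗ g) := by
    intro x hx
    obtain ⟨y, hy, hyx⟩ := hle ⟨(Submodule.Quotient.mk_eq_zero _).1 hx, x.2⟩
    obtain rfl := Subtype.ext hyx
    exact congrArg Subtype.val hy
  obtain ⟨h, hh⟩ := hN.extension_property ((LinearMap.ker φ).liftQ φ le_rfl)
    (LinearMap.ker_eq_bot.1 (Submodule.ker_liftQ_eq_bot _ _ _ le_rfl))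
    ((LinearMap.ker φ).liftQ _ hφ)
  refine ⟨(h ∘ₗ (I ^ (k + t)).mkQ).codRestrict (powTorsion I N) fun x => ⟨k + t, fun r hr => ?_⟩,
    fun x hx => Subtype.ext ?_⟩
  · rw [← map_smul]
    refine (congrArg h ?_).trans (map_zero h)
    exact (Submodule.Quotient.mk_eq_zero _).2 (Ideal.mul_mem_right _ _ hr)
  · exact LinearMap.congr_fun hh ((LinearMap.ker φ).mkQ ⟨x, hx⟩)

/-- On an injective module `N`, multiplication by `f` is bijective modulo `f`-power torsion. -/
theorem bijective_smul_quotient_powTorsion [IsNoetherianRing R] (hN : Module.Baer R N) (f : R) :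
    Function.Bijective (fun x : N ⧸ powTorsion (Ideal.span {f}) N => f • x) := by
  constructor
  · refine (injective_iff_map_eq_zero
      (LinearMap.lsmul R (N ⧸ powTorsion (Ideal.span {f}) N) f)).2 fun x hx => ?_
    obtain ⟨x, rfl⟩ := Submodule.mkQ_surjective _ x
    have hx : f • x ∈ powTorsion (Ideal.span {f}) N := (Submodule.Quotient.mk_eq_zero _).1 hx
    obtain ⟨k, hk⟩ := mem_powTorsion_span_singleton.1 hx
    refine (Submodule.Quotient.mk_eq_zero _).2 (mem_powTorsion_span_singleton.2 ⟨k + 1, ?_⟩)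
    rw [pow_succ, mul_smul, hk]
  · intro x
    obtain ⟨x, rfl⟩ := Submodule.mkQ_surjective _ x
    -- choose `l` such that `r • f ^ l = 0` whenever `r • f ^ (l + 1) = 0`; then the assignment
    -- `f ^ (l + 1) ↦ f ^ l • x` extends to `R`, and divides `f ^ l • x` by `f ^ (l + 1)`
    let K : ℕ →o Ideal R :=
      { toFun := fun l => LinearMap.ker (LinearMap.mulLeft R (f ^ l))
        monotone' := fun l m h r hr => by
          rw [LinearMap.mem_ker, LinearMap.mulLeft_apply] at hr ⊢
          obtain ⟨c, rfl⟩ := Nat.exists_eq_add_of_le h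
          rw [pow_add, mul_right_comm, hr, zero_mul] }
    obtain ⟨l, hl⟩ := monotone_stabilizes_iff_noetherian.2 (inferInstance : IsNoetherian R R) K
    let φ : R →ₗ[R] R := LinearMap.mulLeft R (f ^ (l + 1))
    have hφ : LinearMap.ker φ ≤ LinearMap.ker (LinearMap.toSpanSingleton R N (f ^ l • x)) := by
      intro r hr
      have h1 : r ∈ K l := by
        rw [hl (l + 1) (Nat.le_succ l)]
        exact hr
      have h2 : f ^ l * r = 0 := h1
      rw [LinearMap.mem_ker, LinearMap.toSpanSingleton_apply, smul_smul, mul_comm, h2, zero_smul]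
    obtain ⟨h, hh⟩ := hN.extension_property ((LinearMap.ker φ).liftQ φ le_rfl)
      (LinearMap.ker_eq_bot.1 (Submodule.ker_liftQ_eq_bot _ _ _ le_rfl))
      ((LinearMap.ker φ).liftQ _ hφ)
    have h1 : h (f ^ (l + 1) * 1) = (1 : R) • f ^ l • x :=
      LinearMap.congr_fun hh ((LinearMap.ker φ).mkQ 1)
    rw [one_smul, ← smul_eq_mul, map_smul] at h1
    refine ⟨Submodule.mkQ _ (h 1), (Submodule.Quotient.eq _).2
      (mem_powTorsion_span_singleton.2 ⟨l, ?_⟩)⟩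
    rw [smul_sub, smul_smul, ← pow_succ, h1, sub_self]

end BaerTorsion

/-! ### The Čech complex of a module over a commutative ring -/

section CechLinear

variable {R : Type u} [CommRing R] {n : ℕ} (f : Fin n → R)
  (N : Type v) [AddCommGroup N] [Module R N]

/-- The localization map `N[1 / f_S] → N[1 / f_T]` for `S ⊆ T`; zero if `S ⊈ T`. -/
def cechRes (S T : Finset (Fin n)) : CechLoc f N S →ₗ[R] CechLoc f N T :=
  if h : S ⊆ T then LocalizedModule.lift _ (LocalizedModule.mkLinearMap _ N) (cech_isUnit f N h)
  else 0

variable {f N} in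
theorem cechRes_mk_one {S T : Finset (Fin n)} (h : S ⊆ T) (x : N) :
    cechRes f N S T (LocalizedModule.mk x 1) = LocalizedModule.mk x 1 := by
  rw [cechRes, dif_pos h]
  exact LinearMap.congr_fun (LocalizedModule.lift_comp _ (LocalizedModule.mkLinearMap _ N)
    (cech_isUnit f N h)) x

variable {f N} in
theorem cechRes_cechRes {S T U : Finset (Fin n)} (h : S ⊆ T) (h' : T ⊆ U) (x : CechLoc f N S) :
    cechRes f N T U (cechRes f N S T x) = cechRes f N S U x := by
  have : cechRes f N T U ∘ₗ cechRes f N S T = cechRes f N S U := by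
    refine IsLocalizedModule.ext (Submonoid.powers (∏ i ∈ S, f i))
      (LocalizedModule.mkLinearMap _ N) (cech_isUnit f N (h.trans h')) (LinearMap.ext fun x => ?_)
    simp only [LinearMap.comp_apply, LocalizedModule.mkLinearMap_apply]
    rw [cechRes_mk_one h, cechRes_mk_one h', cechRes_mk_one (h.trans h')]
  exact LinearMap.congr_fun this x

/-- The sign of the component of the Čech differential from `T \ {j}` to `T`. -/
def cechSign (R : Type u) [CommRing R] (T : Finset (Fin n)) (j : Fin n) : R :=
  (-1) ^ (T.filter (· < j)).card

variable (R) in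
theorem cechSign_mul_self (T : Finset (Fin n)) (j : Fin n) :
    cechSign R T j * cechSign R T j = 1 := by
  rw [cechSign, ← mul_pow]
  simp

variable (R) in
theorem cechSign_erase_of_le {T : Finset (Fin n)} {i j : Fin n} (h : i ≤ j) :
    cechSign R (T.erase j) i = cechSign R T i := by
  rw [cechSign, cechSign]
  congr 2
  ext k
  simp only [Finset.mem_filter, Finset.mem_erase]
  constructor
  · exact fun h' => ⟨h'.1.2, h'.2⟩
  · exact fun h' => ⟨⟨(h'.2.trans_le h).ne, h'.1⟩, h'.2⟩

variable (R) in
theorem cechSign_erase_of_lt {T : Finset (Fin n)} {i j : Fin n} (hi : i ∈ T) (h : i < j) :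
    cechSign R (T.erase i) j = -cechSign R T j := by
  rw [cechSign, cechSign, Finset.filter_erase]
  have hm : i ∈ T.filter (· < j) := Finset.mem_filter.2 ⟨hi, h⟩
  rw [← Finset.card_erase_add_one hm, pow_succ, mul_neg_one, neg_neg]

variable (R) in
theorem cechSign_mul_anticomm {T : Finset (Fin n)} {i j : Fin n} (hi : i ∈ T) (hj : j ∈ T)
    (h : i ≠ j) :
    cechSign R T j * cechSign R (T.erase j) i = -(cechSign R T i * cechSign R (T.erase i) j) := by
  rcases lt_or_gt_of_ne h with h | h
  · rw [cechSign_erase_of_le R h.le, cechSign_erase_of_lt R hi h]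
    ring
  · rw [cechSign_erase_of_le R h.le, cechSign_erase_of_lt R hj h]
    ring

/-- The Čech differential on all families indexed by subsets, without regard to degrees. -/
def cechFull : (∀ S, CechLoc f N S) →ₗ[R] (∀ S, CechLoc f N S) :=
  LinearMap.pi fun T => ∑ j ∈ T, cechSign R T j • (cechRes f N (T.erase j) T ∘ₗ LinearMap.proj _)

theorem cechFull_apply (y : ∀ S, CechLoc f N S) (T : Finset (Fin n)) :
    cechFull f N y T = ∑ j ∈ T, cechSign R T j • cechRes f N (T.erase j) T (y (T.erase j)) := by
  simp only [cechFull, LinearMap.pi_apply, LinearMap.sum_apply, LinearMap.smul_apply,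
    LinearMap.comp_apply, LinearMap.proj_apply]

theorem cechFull_cechFull (y : ∀ S, CechLoc f N S) : cechFull f N (cechFull f N y) = 0 := by
  funext T
  let g (j i : Fin n) : CechLoc f N T := (cechSign R T j * cechSign R (T.erase j) i) •
    cechRes f N ((T.erase j).erase i) T (y ((T.erase j).erase i))
  have h1 : cechFull f N (cechFull f N y) T = ∑ j ∈ T, ∑ i ∈ T.erase j, g j i := by
    rw [cechFull_apply]
    refine Finset.sum_congr rfl fun j _ => ?_
    rw [cechFull_apply, map_sum, Finset.smul_sum]
    refine Finset.sum_congr rfl fun i _ => ?_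
    rw [map_smul, smul_smul, cechRes_cechRes (Finset.erase_subset _ _) (Finset.erase_subset _ _)]
  rw [h1, Finset.sum_sigma']
  refine Finset.sum_involution (fun x _ => ⟨x.2, x.1⟩) ?_ ?_ ?_ ?_
  · rintro ⟨j, i⟩ hx
    simp only [Finset.mem_sigma, Finset.mem_erase] at hx
    simp only [g]
    rw [cechSign_mul_anticomm R hx.2.2 hx.1 hx.2.1, Finset.erase_right_comm, neg_smul,
      neg_add_cancel]
  · rintro ⟨j, i⟩ hx _ h
    simp only [Finset.mem_sigma, Finset.mem_erase] at hx
    exact hx.2.1 (congrArg Sigma.fst h)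
  · rintro ⟨j, i⟩ hx
    simp only [Finset.mem_sigma, Finset.mem_erase] at hx ⊢
    exact ⟨hx.2.2, hx.2.1.symm, hx.1⟩
  · rintro ⟨j, i⟩ _
    rfl

/-- Extension by zero of a family in degree `k`. -/
def cechExt (k : ℕ) : CechTerm f N k →ₗ[R] ∀ S, CechLoc f N S :=
  LinearMap.pi fun S => if h : S.card = k then
    LinearMap.proj (φ := fun S : {S : Finset (Fin n) // S.card = k} => CechLoc f N S.1) ⟨S, h⟩
    else 0

theorem cechExt_of_eq {k : ℕ} (x : CechTerm f N k) {S : Finset (Fin n)} (h : S.card = k) :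
    cechExt f N k x S = x ⟨S, h⟩ := by
  simp only [cechExt, LinearMap.pi_apply, dif_pos h, LinearMap.proj_apply]

theorem cechExt_of_ne {k : ℕ} (x : CechTerm f N k) {S : Finset (Fin n)} (h : S.card ≠ k) :
    cechExt f N k x S = 0 := by
  simp only [cechExt, LinearMap.pi_apply, dif_neg h, LinearMap.zero_apply]

/-- Restriction of a family to degree `k`. -/
def cechRestr (k : ℕ) : (∀ S, CechLoc f N S) →ₗ[R] CechTerm f N k :=
  LinearMap.pi fun S => LinearMap.proj S.1

/-- The `R`-linear Čech differential. -/
def cechL (k : ℕ) : CechTerm f N k →ₗ[R] CechTerm f N (k + 1) :=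
  cechRestr f N (k + 1) ∘ₗ cechFull f N ∘ₗ cechExt f N k

theorem cechFull_cechExt (k : ℕ) (x : CechTerm f N k) :
    cechFull f N (cechExt f N k x) = cechExt f N (k + 1) (cechL f N k x) := by
  funext T
  by_cases hT : T.card = k + 1
  · rw [cechExt_of_eq f N _ hT]
    rfl
  · rw [cechExt_of_ne f N _ hT, cechFull_apply]
    refine Finset.sum_eq_zero fun j hj => ?_
    rw [cechExt_of_ne, map_zero, smul_zero]
    rw [Finset.card_erase_of_mem hj]
    have := Finset.card_pos.2 ⟨j, hj⟩
    omega

theorem cechL_cechL (k : ℕ) (x : CechTerm f N k) : cechL f N (k + 1) (cechL f N k x) = 0 := by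
  change cechRestr f N _ (cechFull f N (cechExt f N (k + 1) (cechL f N k x))) = 0
  rw [← cechFull_cechExt, cechFull_cechFull, map_zero]

theorem cechL_cechRestr (k : ℕ) (y : ∀ S, CechLoc f N S) :
    cechL f N k (cechRestr f N k y) = cechRestr f N (k + 1) (cechFull f N y) := by
  funext T
  change cechFull f N (cechExt f N k (cechRestr f N k y)) T.1 = cechFull f N y T.1
  rw [cechFull_apply, cechFull_apply]
  refine Finset.sum_congr rfl fun j hj => ?_
  rw [cechExt_of_eq f N _ (by rw [Finset.card_erase_of_mem hj, T.2, Nat.add_sub_cancel])]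
  rfl

/-! ### Exactness properties of the Čech complex -/

variable {f N}

theorem cech_pow_smul_bijective (T : Finset (Fin n)) (k : ℕ) :
    Function.Bijective fun x : CechLoc f N T => (∏ i ∈ T, f i) ^ k • x :=
  (Module.End.isUnit_iff _).1 (IsLocalizedModule.map_units (LocalizedModule.mkLinearMap
    (Submonoid.powers (∏ i ∈ T, f i)) N) ⟨(∏ i ∈ T, f i) ^ k,
      pow_mem (Submonoid.mem_powers _) k⟩)

theorem exists_pow_smul_eq_mk_one {S : Finset (Fin n)} (x : CechLoc f N S) :
    ∃ (k : ℕ) (m : N), (∏ i ∈ S, f i) ^ k • x = LocalizedModule.mk m 1 := by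
  induction x using LocalizedModule.induction_on with
  | h m s =>
    obtain ⟨k, hk⟩ := s.2
    refine ⟨k, m, ?_⟩
    rw [LocalizedModule.smul'_mk]
    have h1 : (∏ i ∈ S, f i) ^ k • m = s • m := congrArg (· • m) hk
    rw [h1]
    exact LocalizedModule.mk_cancel s m

theorem cech_mk_one_eq_zero_iff {S : Finset (Fin n)} (m : N) :
    (LocalizedModule.mk m 1 : CechLoc f N S) = 0 ↔ ∃ k : ℕ, (∏ i ∈ S, f i) ^ k • m = 0 := by
  rw [← LocalizedModule.zero_mk 1, LocalizedModule.mk_eq]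
  constructor
  · rintro ⟨⟨_, k, rfl⟩, hk⟩
    rw [one_smul, smul_zero, smul_zero] at hk
    exact ⟨k, hk⟩
  · rintro ⟨k, hk⟩
    refine ⟨⟨_, k, rfl⟩, ?_⟩
    rw [one_smul, smul_zero, smul_zero]
    exact hk

theorem bijective_cechRes_insert {j : Fin n} (hj : Function.Bijective fun x : N => f j • x)
    {S : Finset (Fin n)} (hS : j ∉ S) : Function.Bijective (cechRes f N S (insert j S)) := by
  have hjk (k : ℕ) : Function.Bijective fun x : N => f j ^ k • x := by
    induction k with
    | zero =>
      simp only [pow_zero, one_smul]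
      exact Function.bijective_id
    | succ k ih =>
      simp only [pow_succ, mul_smul]
      exact ih.comp hj
  have hprod : ∏ i ∈ insert j S, f i = f j * ∏ i ∈ S, f i := Finset.prod_insert hS
  have hpow (k : ℕ) : (∏ i ∈ insert j S, f i) ^ k = f j ^ k * (∏ i ∈ S, f i) ^ k := by
    rw [hprod, mul_pow]
  constructor
  · refine (injective_iff_map_eq_zero _).2 fun x hx => ?_
    obtain ⟨k, m, hm⟩ := exists_pow_smul_eq_mk_one x
    have h1 : (LocalizedModule.mk m 1 : CechLoc f N (insert j S)) = 0 := by
      rw [← cechRes_mk_one (Finset.subset_insert j S), ← hm, map_smul, hx, smul_zero]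
    obtain ⟨l, hl⟩ := (cech_mk_one_eq_zero_iff m).1 h1
    rw [hpow, mul_smul] at hl
    refine (cech_pow_smul_bijective S k).1 ?_
    change _ • x = _ • 0
    rw [hm, smul_zero, cech_mk_one_eq_zero_iff]
    exact ⟨l, (hjk l).1 (hl.trans (smul_zero _).symm)⟩
  · intro y
    obtain ⟨k, m, hm⟩ := exists_pow_smul_eq_mk_one y
    obtain ⟨m', rfl⟩ := (hjk k).2 m
    obtain ⟨x, hx⟩ := (cech_pow_smul_bijective (f := f) S k).2 (LocalizedModule.mk m' 1)
    refine ⟨x, (cech_pow_smul_bijective (insert j S) k).1 ?_⟩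
    refine Eq.trans ?_ hm.symm
    have h1 := congrArg (fun c : R => c • cechRes f N S (insert j S) x) (hpow k)
    refine h1.trans ?_
    have hx : (∏ i ∈ S, f i) ^ k • x = LocalizedModule.mk m' 1 := hx
    rw [mul_smul, ← map_smul, hx, cechRes_mk_one (Finset.subset_insert j S),
      LocalizedModule.smul'_mk]

/-- If some `f j` acts bijectively, the Čech complex is contractible. The homotopy `z` below is
the inverse of the localization maps `N[1 / f_S] → N[1 / f_(S ∪ {j})]`. -/
theorem ker_cechL_le_of_bijective {j : Fin n} (hj : Function.Bijective fun x : N => f j • x)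
    (k : ℕ) : LinearMap.ker (cechL f N (k + 1)) ≤ LinearMap.range (cechL f N k) := by
  intro x hx
  let y := cechExt f N (k + 1) x
  have hy : cechFull f N y = 0 := by
    rw [cechFull_cechExt, LinearMap.mem_ker.1 hx, map_zero]
  have hz (S : Finset (Fin n)) : ∃ z : CechLoc f N S, (j ∈ S → z = 0) ∧ (j ∉ S →
      cechRes f N S (insert j S) z = cechSign R (insert j S) j • y (insert j S)) := by
    by_cases hS : j ∈ S
    · exact ⟨0, fun _ => rfl, fun h => (h hS).elim⟩
    · obtain ⟨z, hz⟩ := (bijective_cechRes_insert hj hS).2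
        (cechSign R (insert j S) j • y (insert j S))
      exact ⟨z, fun h => (hS h).elim, fun _ => hz⟩
  choose z hz0 hz1 using hz
  let w := y - cechFull f N z
  have hw : cechFull f N w = 0 := by rw [map_sub, hy, cechFull_cechFull, sub_zero]
  -- if a family vanishes at the sets containing `j`, its differential at such a set has one term
  have single (v : ∀ S, CechLoc f N S) (hv : ∀ S, j ∈ S → v S = 0) (T : Finset (Fin n))
      (hT : j ∈ T) : cechFull f N v T =
        cechSign R T j • cechRes f N (T.erase j) T (v (T.erase j)) := by
    rw [cechFull_apply]
    refine Finset.sum_eq_single_of_mem j hT fun i _ hij => ?_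
    rw [hv _ (Finset.mem_erase.2 ⟨hij.symm, hT⟩), map_zero, smul_zero]
  have hw0 (T : Finset (Fin n)) (hT : j ∈ T) : w T = 0 := by
    change y T - cechFull f N z T = 0
    rw [single z hz0 T hT, sub_eq_zero]
    have h1 := hz1 (T.erase j) (Finset.notMem_erase j T)
    rw [Finset.insert_erase hT] at h1
    rw [h1, smul_smul, cechSign_mul_self, one_smul]
  have hw1 : w = 0 := by
    funext T
    by_cases hT : j ∈ T
    · exact hw0 T hT
    · have h1 := single w hw0 (insert j T) (Finset.mem_insert_self j T)
      rw [hw, Finset.erase_insert hT] at h1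
      refine (bijective_cechRes_insert hj hT).1 ?_
      have h2 := congrArg (cechSign R (insert j T) j • ·) h1
      rw [smul_smul, cechSign_mul_self, one_smul] at h2
      rw [← h2]
      simp
  refine ⟨cechRestr f N k z, ?_⟩
  rw [cechL_cechRestr, ← sub_eq_zero.1 hw1]
  funext S
  exact cechExt_of_eq f N x S.2

theorem subsingleton_cechTerm_of_torsion (h : ∀ (i : Fin n) (x : N), ∃ k, f i ^ k • x = 0)
    (k : ℕ) : Subsingleton (CechTerm f N (k + 1)) := by
  refine ⟨fun x y => funext fun S => ?_⟩
  have hS (z : CechLoc f N S.1) : z = 0 := by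
    have hpos : 0 < S.1.card := by rw [S.2]; exact Nat.succ_pos k
    obtain ⟨i, hi⟩ := Finset.card_pos.1 hpos
    obtain ⟨l, m, hm⟩ := exists_pow_smul_eq_mk_one z
    refine (cech_pow_smul_bijective S.1 l).1 ?_
    change _ • z = _ • 0
    rw [hm, smul_zero, cech_mk_one_eq_zero_iff]
    obtain ⟨l, hl⟩ := h i m
    refine ⟨l, ?_⟩
    rw [← Finset.mul_prod_erase _ _ hi, mul_comm, mul_pow, mul_smul, hl, smul_zero]
  rw [hS (x S), hS (y S)]

end CechLinear

section CechSES

variable {R : Type u} [CommRing R] {n : ℕ} (f : Fin n → R)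
  {M E C : Type u} [AddCommGroup M] [Module R M] [AddCommGroup E] [Module R E]
  [AddCommGroup C] [Module R C]

/-- The map on Čech complexes induced by a linear map. -/
def cechMap (g : M →ₗ[R] E) (k : ℕ) : CechTerm f M k →ₗ[R] CechTerm f E k :=
  LinearMap.pi fun S => IsLocalizedModule.map (Submonoid.powers (∏ i ∈ S.1, f i))
    (LocalizedModule.mkLinearMap _ M) (LocalizedModule.mkLinearMap _ E) g ∘ₗ LinearMap.proj S

theorem cechRes_map (g : M →ₗ[R] E) {S T : Finset (Fin n)} (h : S ⊆ T) (x : CechLoc f M S) :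
    IsLocalizedModule.map (Submonoid.powers (∏ i ∈ T, f i)) (LocalizedModule.mkLinearMap _ M)
      (LocalizedModule.mkLinearMap _ E) g (cechRes f M S T x) = cechRes f E S T
    (IsLocalizedModule.map (Submonoid.powers (∏ i ∈ S, f i)) (LocalizedModule.mkLinearMap _ M)
      (LocalizedModule.mkLinearMap _ E) g x) := by
  have : IsLocalizedModule.map (Submonoid.powers (∏ i ∈ T, f i)) (LocalizedModule.mkLinearMap _ M)
      (LocalizedModule.mkLinearMap _ E) g ∘ₗ cechRes f M S T = cechRes f E S T ∘ₗ
    (IsLocalizedModule.map (Submonoid.powers (∏ i ∈ S, f i)) (LocalizedModule.mkLinearMap _ M)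
      (LocalizedModule.mkLinearMap _ E) g) := by
    refine IsLocalizedModule.ext (Submonoid.powers (∏ i ∈ S, f i))
      (LocalizedModule.mkLinearMap _ M) (cech_isUnit f E h) (LinearMap.ext fun x => ?_)
    simp only [LinearMap.comp_apply, LocalizedModule.mkLinearMap_apply]
    rw [cechRes_mk_one h, IsLocalizedModule.map_LocalizedModules,
      IsLocalizedModule.map_LocalizedModules, cechRes_mk_one h]
  exact LinearMap.congr_fun this x

theorem cechMap_cechL (g : M →ₗ[R] E) (k : ℕ) (x : CechTerm f M k) :
    cechMap f g (k + 1) (cechL f M k x) = cechL f E k (cechMap f g k x) := by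
  funext T
  change IsLocalizedModule.map _ _ _ g (cechFull f M (cechExt f M k x) T.1) =
    cechFull f E (cechExt f E k (cechMap f g k x)) T.1
  rw [cechFull_apply, cechFull_apply, map_sum]
  refine Finset.sum_congr rfl fun j hj => ?_
  have hc : (T.1.erase j).card = k := by
    rw [Finset.card_erase_of_mem hj, T.2, Nat.add_sub_cancel]
  rw [map_smul, cechRes_map f g (Finset.erase_subset j T.1), cechExt_of_eq f _ _ hc,
    cechExt_of_eq f _ _ hc]
  rfl

/-- The short exact sequence of Čech complexes attached to a short exact sequence of modules. -/
def cechSES (i : M →ₗ[R] E) (p : E →ₗ[R] C) (hi : Function.Injective i)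
    (hp : Function.Surjective p) (hip : Function.Exact i p) :
    ComplexSES (cechL f M) (cechL f E) (cechL f C) where
  i := cechMap f i
  p := cechMap f p
  d_d := cechL_cechL f E
  i_d := cechMap_cechL f i
  p_d := cechMap_cechL f p
  i_injective k x y h := funext fun S => IsLocalizedModule.map_injective
    (Submonoid.powers (∏ i ∈ S.1, f i)) (LocalizedModule.mkLinearMap _ M)
      (LocalizedModule.mkLinearMap _ E) i hi (congrFun h S)
  p_surjective k x := by
    choose y hy using fun S : {S : Finset (Fin n) // S.card = k} =>
      IsLocalizedModule.map_surjective
        (Submonoid.powers (∏ i ∈ S.1, f i))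
          (LocalizedModule.mkLinearMap (Submonoid.powers (∏ i ∈ S.1, f i)) E)
          (LocalizedModule.mkLinearMap _ C) p hp (x S)
    exact ⟨y, funext hy⟩
  exact k x := by
    have h (S : {S : Finset (Fin n) // S.card = k}) := IsLocalizedModule.map_exact
      (Submonoid.powers (∏ i ∈ S.1, f i))
      (LocalizedModule.mkLinearMap (Submonoid.powers (∏ i ∈ S.1, f i)) M)
      (LocalizedModule.mkLinearMap (Submonoid.powers (∏ i ∈ S.1, f i)) E)
      (LocalizedModule.mkLinearMap (Submonoid.powers (∏ i ∈ S.1, f i)) C) i p hip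
    constructor
    · intro hx
      choose y hy using fun S : {S : Finset (Fin n) // S.card = k} =>
        (h S (x S)).1 (congrFun hx S)
      exact ⟨y, funext hy⟩
    · rintro ⟨y, rfl⟩
      exact funext fun S => (h S _).2 ⟨y S, rfl⟩

/-- In a short exact sequence of complexes, the middle one is exact where the outer ones are. -/
theorem ComplexSES.ker_le_range {A B C : ℕ → Type*}
    [∀ k, AddCommGroup (A k)] [∀ k, Module R (A k)]
    [∀ k, AddCommGroup (B k)] [∀ k, Module R (B k)]
    [∀ k, AddCommGroup (C k)] [∀ k, Module R (C k)]
    {dA : ∀ k, A k →ₗ[R] A (k + 1)} {dB : ∀ k, B k →ₗ[R] B (k + 1)}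
    {dC : ∀ k, C k →ₗ[R] C (k + 1)} (s : ComplexSES dA dB dC) (k : ℕ)
    (hA : LinearMap.ker (dA (k + 1)) ≤ LinearMap.range (dA k))
    (hC : LinearMap.ker (dC (k + 1)) ≤ LinearMap.range (dC k)) :
    LinearMap.ker (dB (k + 1)) ≤ LinearMap.range (dB k) := by
  intro x hx
  have h1 : dC (k + 1) (s.p (k + 1) x) = 0 := by rw [← s.p_d, hx, map_zero]
  obtain ⟨c, hc⟩ := hC h1
  obtain ⟨b, rfl⟩ := s.p_surjective k c
  obtain ⟨a, ha⟩ := (s.exact (k + 1) (x - dB k b)).1 (by rw [map_sub, s.p_d, hc, sub_self])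
  have h2 : dA (k + 1) a = 0 := by
    refine s.i_injective _ ?_
    rw [s.i_d, ha, map_sub, s.d_d, hx, sub_zero, map_zero]
  obtain ⟨a', rfl⟩ := hA h2
  refine ⟨b + s.i k a', ?_⟩
  rw [map_add, ← s.i_d, ha, add_sub_cancel]

/-- The Čech complex of an injective module `N` over a noetherian ring is exact in positive
degrees: by induction on the number of `f j` that do not act locally nilpotently, using the exact
sequence of `f j`-power torsion, `0 → Γ → N → N ⧸ Γ → 0`, in which `Γ` is injective and `f j` acts
bijectively on `N ⧸ Γ`. -/
theorem ker_cechL_le_of_baer [IsNoetherianRing R] (A : Finset (Fin n)) (N : Type u)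
    [AddCommGroup N] [Module R N] (hN : Module.Baer R N)
    (h : ∀ i ∉ A, ∀ x : N, ∃ k, f i ^ k • x = 0) (k : ℕ) :
    LinearMap.ker (cechL f N (k + 1)) ≤ LinearMap.range (cechL f N k) := by
  induction A using Finset.induction_on generalizing N with
  | empty =>
    intro x _
    have := subsingleton_cechTerm_of_torsion (f := f) (N := N)
      (fun i => h i (Finset.notMem_empty i)) k
    exact ⟨0, Subsingleton.elim _ _⟩
  | insert j A _ ih =>
    let Γ := powTorsion (Ideal.span {f j}) N
    refine (cechSES f Γ.subtype Γ.mkQ Γ.subtype_injective Γ.mkQ_surjective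
      (LinearMap.exact_subtype_mkQ Γ)).ker_le_range k
      (ih Γ (baer_powTorsion _ hN) fun i hi x => ?_)
      (ker_cechL_le_of_bijective (bijective_smul_quotient_powTorsion hN (f j)) k)
    by_cases hij : i = j
    · obtain ⟨l, hl⟩ := mem_powTorsion_span_singleton.1 x.2
      exact ⟨l, Subtype.ext (hij ▸ hl)⟩
    · obtain ⟨l, hl⟩ := h i (by simp [hij, hi]) x.1
      exact ⟨l, Subtype.ext hl⟩

end CechSES

end FRep
end

noncomputable section
namespace FRep

/-! ### Local cohomology and the Čech complex -/

section CechZero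

variable {R : Type u} [CommRing R] {n : ℕ} (f : Fin n → R)
  (N : Type u) [AddCommGroup N] [Module R N]

/-- The map from `N` to the `0`-th term of the Čech complex. -/
def cechZero : N →ₗ[R] CechTerm f N 0 :=
  LinearMap.pi fun S => LocalizedModule.mkLinearMap (Submonoid.powers (∏ i ∈ S.1, f i)) N

variable {N}

theorem cechZero_bijective : Function.Bijective (cechZero f N) := by
  have hprod : ∏ i ∈ (∅ : Finset (Fin n)), f i = 1 := Finset.prod_empty
  constructor
  · refine (injective_iff_map_eq_zero _).2 fun x hx => ?_
    obtain ⟨k, hk⟩ := (cech_mk_one_eq_zero_iff x).1 (congrFun hx ⟨∅, rfl⟩)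
    simpa using hk
  · intro x
    obtain ⟨k, m, hm⟩ := exists_pow_smul_eq_mk_one (x ⟨∅, rfl⟩)
    refine ⟨m, funext fun S => ?_⟩
    obtain ⟨S, hS⟩ := S
    obtain rfl := Finset.card_eq_zero.1 hS
    refine hm.symm.trans ?_
    have h1 : (∏ i ∈ (∅ : Finset (Fin n)), f i) ^ k = 1 := by rw [hprod, one_pow]
    exact (congrArg (fun c : R => c • x ⟨∅, rfl⟩) h1).trans (one_smul R _)

theorem cechL_cechZero_apply (x : N) (i : Fin n) :
    cechL f N 0 (cechZero f N x) ⟨{i}, Finset.card_singleton i⟩ =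
      cechSign R {i} i • LocalizedModule.mk x 1 := by
  change cechFull f N (cechExt f N 0 (cechZero f N x)) {i} = _
  rw [cechFull_apply, Finset.sum_singleton, cechExt_of_eq f N _ (by simp)]
  congr 1
  exact cechRes_mk_one (Finset.erase_subset i {i}) x

/-- The kernel of the `0`-th Čech differential consists of the `I`-power torsion elements, where
`I` is the ideal generated by the `f i`. -/
theorem cechL_cechZero_eq_zero_iff {I : Ideal R} (hI : Ideal.span (Set.range f) = I) (x : N) :
    cechL f N 0 (cechZero f N x) = 0 ↔ x ∈ powTorsion I N := by
  have h1 : cechL f N 0 (cechZero f N x) = 0 ↔ ∀ i, ∃ k, f i ^ k • x = 0 := by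
    have h2 (i : Fin n) : cechL f N 0 (cechZero f N x) ⟨{i}, Finset.card_singleton i⟩ = 0 ↔
        ∃ k, f i ^ k • x = 0 := by
      have h3 : cechSign R {i} i • (LocalizedModule.mk x 1 : CechLoc f N {i}) = 0 ↔
          (LocalizedModule.mk x 1 : CechLoc f N {i}) = 0 := by
        constructor
        · intro h
          have h4 := congrArg (cechSign R {i} i • ·) h
          simpa only [smul_smul, cechSign_mul_self, one_smul, smul_zero] using h4
        · intro h
          rw [h, smul_zero]
      rw [cechL_cechZero_apply, h3, cech_mk_one_eq_zero_iff, Finset.prod_singleton]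
    refine ⟨fun h i => (h2 i).1 (congrFun h _), fun h => funext fun T => ?_⟩
    obtain ⟨T, hT⟩ := T
    obtain ⟨i, rfl⟩ := Finset.card_eq_one.1 hT
    exact (h2 i).2 (h i)
  rw [h1]
  let J : Ideal R := LinearMap.ker (LinearMap.toSpanSingleton R N x)
  constructor
  · intro h
    have h2 : I ≤ J.radical := by
      rw [← hI, Ideal.span_le]
      rintro _ ⟨i, rfl⟩
      exact h i
    obtain ⟨t, ht⟩ := Ideal.exists_pow_le_of_le_radical_of_fg h2
      (hI ▸ Submodule.fg_span (Set.finite_range f))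
    exact ⟨t, fun r hr => ht hr⟩
  · rintro ⟨t, ht⟩ i
    exact ⟨t, ht _ (Ideal.pow_mem_pow (hI ▸ Ideal.subset_span ⟨i, rfl⟩) t)⟩

/-- The `I`-power torsion is the kernel of the `0`-th Čech differential. -/
def powTorsionEquiv {I : Ideal R} (hI : Ideal.span (Set.range f) = I) :
    powTorsion I N ≃ₗ[R] LinearMap.ker (cechL f N 0) :=
  LinearEquiv.ofBijective ((cechZero f N).restrict fun x hx =>
    (cechL_cechZero_eq_zero_iff f hI x).2 hx) <| by
    constructor
    · intro x y h
      exact Subtype.ext ((cechZero_bijective f).1 (congrArg Subtype.val h))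
    · rintro ⟨z, hz⟩
      obtain ⟨x, rfl⟩ := (cechZero_bijective f).2 z
      exact ⟨⟨x, (cechL_cechZero_eq_zero_iff f hI x).1 hz⟩, rfl⟩

theorem coe_powTorsionEquiv {I : Ideal R} (hI : Ideal.span (Set.range f) = I)
    (x : powTorsion I N) : (powTorsionEquiv f hI x).1 = cechZero f N x.1 := rfl

theorem cechMap_cechZero {C : Type u} [AddCommGroup C] [Module R C] (p : N →ₗ[R] C) (x : N) :
    cechMap f p 0 (cechZero f N x) = cechZero f C (p x) :=
  funext fun _ => IsLocalizedModule.map_apply _ _ _ p x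

end CechZero

section Comparison

/-- Two quotients of the same module by the same submodule are isomorphic. -/
theorem nonempty_equiv_of_surjective {R Q T V : Type*} [CommRing R] [AddCommGroup Q] [Module R Q]
    [AddCommGroup T] [Module R T] [AddCommGroup V] [Module R V] (τ : Q →ₗ[R] T) (w : Q →ₗ[R] V)
    (sτ : Function.Surjective τ) (sw : Function.Surjective w) (h : ∀ q, τ q = 0 ↔ w q = 0) :
    Nonempty (T ≃ₗ[R] V) :=
  ⟨(τ.quotKerEquivOfSurjective sτ).symm ≪≫ₗ Submodule.quotEquivOfEq _ _ (Submodule.ext fun x => by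
    rw [LinearMap.mem_ker, LinearMap.mem_ker, h]) ≪≫ₗ
    w.quotKerEquivOfSurjective sw⟩

variable {R : Type u} [CommRing R] {n : ℕ} (f : Fin n → R)

/-- The `R`-linear Čech cohomology of `N`. -/
abbrev CechCohomologyL (N : Type u) [AddCommGroup N] [Module R N] (k : ℕ) : Type u :=
  LinearMap.ker (cechL f N k) ⧸ (bdry (cechL f N) k).comap (LinearMap.ker (cechL f N k)).subtype

theorem exists_baer_embedding (M : Type u) [AddCommGroup M] [Module R M] :
    ∃ (E : Type u) (_ : AddCommGroup E) (_ : Module R E) (i : M →ₗ[R] E),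
      Function.Injective i ∧ Module.Baer R E := by
  have := ModuleCat.enoughInjectives.{u} (R := R)
  let E := CategoryTheory.Injective.under (ModuleCat.of R M)
  have : CategoryTheory.Injective (ModuleCat.of R E) :=
    inferInstanceAs (CategoryTheory.Injective E)
  have := Module.injective_module_of_injective_object R E
  exact ⟨E, inferInstance, inferInstance, (CategoryTheory.Injective.ι (ModuleCat.of R M)).hom,
    (ModuleCat.mono_iff_injective _).1 inferInstance, Module.Baer.of_injective ‹_›⟩

/-- Local cohomology is Čech cohomology: both are computed by shifting dimensions along a short
exact sequence `0 → M → E → C → 0` with `E` injective, until degree `0`, where both are the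
`I`-power torsion. -/
theorem nonempty_localCohomology_equiv_cech [IsNoetherianRing R] {I : Ideal R}
    (hI : Ideal.span (Set.range f) = I) (k : ℕ) (M : Type u) [AddCommGroup M] [Module R M] :
    Nonempty ((localCohomology I k).obj (ModuleCat.of R M) ≃ₗ[R] CechCohomologyL f M k) := by
  induction k generalizing M with
  | zero =>
    obtain ⟨e⟩ := nonempty_localCohomology_zero_equiv I M
    refine ⟨e ≪≫ₗ powTorsionEquiv f hI ≪≫ₗ (Submodule.quotEquivOfEqBot _ ?_).symm⟩
    rw [bdry, eq_bot_iff]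
    exact fun x hx => Subtype.ext hx
  | succ k ih =>
    obtain ⟨E, _, _, i, hi, hE⟩ := exists_baer_embedding (R := R) M
    let p := (LinearMap.range i).mkQ
    have hp : Function.Surjective p := Submodule.mkQ_surjective _
    have hip : Function.Exact i p := LinearMap.exact_map_mkQ_range i
    let s := cechSES f i p hi hp hip
    have hB (k : ℕ) := ker_cechL_le_of_baer f Finset.univ E hE
      (fun i hi => (hi (Finset.mem_univ i)).elim) k
    have hmem (k : ℕ) (q : s.preCocycles k) :
        ((bdry (cechL f M) (k + 1)).comap (LinearMap.ker (cechL f M (k + 1))).subtype).mkQ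
          (s.toA k q) = 0 ↔
        ∃ z : LinearMap.ker (cechL f E k), cechMap f p k z.1 = cechMap f p k q.1 :=
      (Submodule.Quotient.mk_eq_zero _).trans (s.toA_mem_range_iff k q)
    cases k with
    | zero =>
      obtain ⟨e⟩ := nonempty_localCohomology_one_equiv I hi hp hip hE
      obtain ⟨e'⟩ := nonempty_equiv_of_surjective
        ((LinearMap.range (powTorsionMap I p)).mkQ ∘ₗ (powTorsionEquiv f hI).symm.toLinearMap ∘ₗ
          s.toC 0)
        (((bdry (cechL f M) 1).comap (LinearMap.ker (cechL f M 1)).subtype).mkQ ∘ₗ s.toA 0)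
        ((Submodule.mkQ_surjective _).comp ((powTorsionEquiv f hI).symm.surjective.comp
          (s.toC_surjective 0)))
        ((Submodule.mkQ_surjective _).comp (s.toA_surjective 0 (hB 0))) fun q => by
          refine Iff.trans ?_ (hmem 0 q).symm
          refine (Submodule.Quotient.mk_eq_zero _).trans ?_
          constructor
          · rintro ⟨x, hx⟩
            refine ⟨powTorsionEquiv f hI x, ?_⟩
            have hx : powTorsionMap I p x = (powTorsionEquiv f hI).symm (s.toC 0 q) := hx
            have h1 := congrArg (powTorsionEquiv f hI) hx
            rw [LinearEquiv.apply_symm_apply] at h1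
            rw [coe_powTorsionEquiv, cechMap_cechZero]
            exact congrArg Subtype.val h1
          · rintro ⟨z, hz⟩
            refine ⟨(powTorsionEquiv f hI).symm z, (powTorsionEquiv f hI).injective ?_⟩
            change _ = powTorsionEquiv f hI ((powTorsionEquiv f hI).symm (s.toC 0 q))
            rw [LinearEquiv.apply_symm_apply]
            refine Subtype.ext ?_
            rw [coe_powTorsionEquiv]
            refine Eq.trans ?_ hz
            refine (cechMap_cechZero f p _).symm.trans ?_
            exact congrArg (fun z : LinearMap.ker (cechL f E 0) => cechMap f p 0 z.1)
              ((powTorsionEquiv f hI).apply_symm_apply z)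
      exact ⟨e ≪≫ₗ e'⟩
    | succ k =>
      obtain ⟨e⟩ := nonempty_localCohomology_succ_equiv I hi hp hip hE k
      obtain ⟨e'⟩ := ih (E ⧸ LinearMap.range i)
      obtain ⟨e''⟩ := nonempty_equiv_of_surjective
        (((bdry (cechL f (E ⧸ LinearMap.range i)) (k + 1)).comap
          (LinearMap.ker (cechL f (E ⧸ LinearMap.range i) (k + 1))).subtype).mkQ ∘ₗ s.toC (k + 1))
        (((bdry (cechL f M) (k + 2)).comap (LinearMap.ker (cechL f M (k + 2))).subtype).mkQ ∘ₗ
          s.toA (k + 1))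
        ((Submodule.mkQ_surjective _).comp (s.toC_surjective (k + 1)))
        ((Submodule.mkQ_surjective _).comp (s.toA_surjective (k + 1) (hB (k + 1)))) fun q => by
          refine Iff.trans ?_ (hmem (k + 1) q).symm
          refine (Submodule.Quotient.mk_eq_zero _).trans ?_
          exact (s.mem_range_dC_iff k (hB k) q.1).symm
      exact ⟨e ≪≫ₗ e' ≪≫ₗ e''⟩

end Comparison

section CechModule

variable (p : ℕ) [Fact p.Prime] {R : Type u} [CommRing R] (a b : ℕ) {n : ℕ} (f : Fin n → R)
variable (M : Type u) [AddCommGroup M] [Module R M] [Module (DPhi p R a b) M]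
variable [IsScalarTower R (DPhi p R a b) M]

/-- The `𝒟⁽⁰⁾⟨Φ⟩`-linear Čech differential is the `R`-linear one. -/
theorem cechD_eq_cechL (k : ℕ) (x : CechTerm f M k) : cechD p a b f M k x = cechL f M k x := by
  funext T
  change _ = cechFull f M (cechExt f M k x) T.1
  rw [cechFull_apply, ← Finset.sum_coe_sort, cechD, LinearMap.pi_apply, LinearMap.sum_apply]
  refine Finset.sum_congr rfl fun j _ => ?_
  rw [cechExt_of_eq f M x (by rw [Finset.card_erase_of_mem j.2, T.2, Nat.add_sub_cancel]), cechSign]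
  have hres (y) : locMap p R a b M _ _ (cech_isUnit f M (Finset.erase_subset j.1 T.1)) y =
      cechRes f M (T.1.erase j) T.1 y := by
    rw [cechRes, dif_pos (Finset.erase_subset j.1 T.1)]
    rfl
  rcases Nat.even_or_odd (T.1.filter (· < j.1)).card with h | h
  · rw [h.neg_one_pow, h.neg_one_pow, one_smul, one_smul]
    exact hres _
  · rw [h.neg_one_pow, h.neg_one_pow, neg_smul, neg_smul, one_smul, one_smul]
    exact congrArg Neg.neg (hres _)

theorem cechD_comp_cechD (k : ℕ) : cechD p a b f M (k + 1) ∘ₗ cechD p a b f M k = 0 :=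
  LinearMap.ext fun x => by
    rw [LinearMap.comp_apply, cechD_eq_cechL, cechD_eq_cechL, cechL_cechL, LinearMap.zero_apply]

theorem mem_cechB_iff (k : ℕ) (x : CechTerm f M k) :
    x ∈ cechB p a b f M k ↔ x ∈ bdry (cechL f M) k := by
  cases k with
  | zero => rfl
  | succ k =>
    constructor
    · rintro ⟨y, rfl⟩
      exact ⟨y, (cechD_eq_cechL p a b f M k y).symm⟩
    · rintro ⟨y, rfl⟩
      exact ⟨y, cechD_eq_cechL p a b f M k y⟩

/-- A cocycle of the `R`-linear Čech complex, as a cocycle of the complex of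
`𝒟⁽⁰⁾⟨Φ⟩`-modules. -/
def cechCocycle (k : ℕ) : LinearMap.ker (cechL f M k) →ₗ[R] LinearMap.ker (cechD p a b f M k) where
  toFun z := ⟨z.1, (cechD_eq_cechL p a b f M k z.1).trans z.2⟩
  map_add' _ _ := rfl
  map_smul' _ _ := rfl

theorem nonempty_cechCohomologyL_equiv (k : ℕ) :
    Nonempty (CechCohomologyL f M k ≃ₗ[R] CechCohomology p a b f M k) := by
  refine nonempty_equiv_of_surjective (Submodule.mkQ _)
    ((((cechB p a b f M k).comap (LinearMap.ker (cechD p a b f M k)).subtype).mkQ.restrictScalars R)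
      ∘ₗ cechCocycle p a b f M k) (Submodule.mkQ_surjective _) ?_ fun q => ?_
  · refine (Submodule.mkQ_surjective _).comp fun z => ?_
    exact ⟨⟨z.1, (cechD_eq_cechL p a b f M k z.1).symm.trans z.2⟩, rfl⟩
  · refine (Submodule.Quotient.mk_eq_zero _).trans (Iff.trans ?_
      (Submodule.Quotient.mk_eq_zero _).symm)
    exact (mem_cechB_iff p a b f M k q.1).symm

variable {p a b M}

/-- Čech cohomology modules of a finitely generated unit module are finitely generated unit. -/
theorem isFGU_cechCohomology [CharP R p] (hF : IsFFinite p R) (hb : 0 < b)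
    (σ : FrobSplitting p R a b) (hM : IsFGU p R a b M) (k : ℕ) :
    IsFGU p R a b (CechCohomology p a b f M k) := by
  have := hM.1
  obtain ⟨D⟩ := (isUnitModule_iff_nonempty_descent σ M).1 hM.2
  have hfin (k : ℕ) : Module.Finite (DPhi p R a b) (CechTerm f M k) := by
    have (S : {S : Finset (Fin n) // S.card = k}) :
        Module.Finite (DPhi p R a b) (CechLoc f M S.1) := D.finite_away hF hb _
    exact Module.Finite.pi
  let E (k : ℕ) : Descent σ (CechTerm f M k) := Descent.pi fun S => D.localize _
  have hker (i) (x) (hx : x ∈ LinearMap.ker (cechD p a b f M k)) :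
      (E k).Ψ i x ∈ LinearMap.ker (cechD p a b f M k) := by
    rw [LinearMap.mem_ker] at hx ⊢
    rw [(E k).map_Ψ (E (k + 1)), hx, map_zero]
  have hB (i) (x) (hx : x ∈ cechB p a b f M k) : (E k).Ψ i x ∈ cechB p a b f M k := by
    cases k with
    | zero =>
      obtain rfl : x = 0 := hx
      rw [map_zero]
      exact zero_mem _
    | succ k =>
      obtain ⟨y, rfl⟩ := hx
      exact ⟨(E k).Ψ i y, (E k).map_Ψ (E (k + 1)) _ i y⟩
  have := (E k).finite_submodule hF _ hker
  exact ⟨inferInstance, (isUnitModule_iff_nonempty_descent σ _).2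
    ⟨((E k).restrict _ hker).quotient _ fun i x hx => hB i x.1 hx⟩⟩

end CechModule

section Transport

variable {p : ℕ} {R : Type u} [CommRing R] {a b : ℕ}

/-- An `R`-linear isomorphism with a `𝒟⁽⁰⁾⟨Φ⟩`-module transports the structure. -/
theorem exists_module_of_equiv {T H : Type u} [AddCommGroup T] [Module R T] [AddCommGroup H]
    [Module R H] [Module (DPhi p R a b) H] [IsScalarTower R (DPhi p R a b) H] (e : T ≃ₗ[R] H) :
    ∃ inst : Module (DPhi p R a b) T, IsScalarTower R (DPhi p R a b) T ∧
      Nonempty (T ≃ₗ[DPhi p R a b] H) := by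
  let _ : SMul (DPhi p R a b) T := ⟨fun d x => e.symm (d • e x)⟩
  have hsmul (d : DPhi p R a b) (x : T) : e (d • x) = d • e x := e.apply_symm_apply _
  let _ : Module (DPhi p R a b) T :=
    Function.Injective.module (DPhi p R a b) e.toAddEquiv.toAddMonoidHom e.injective hsmul
  refine ⟨inferInstance, ⟨fun r d x => e.injective ?_⟩, ⟨{ e.toAddEquiv with map_smul' := hsmul }⟩⟩
  rw [hsmul (r • d) x, e.map_smul r, hsmul d x, smul_assoc]

theorem IsFGU.of_equiv (σ : FrobSplitting p R a b) {T H : Type u} [AddCommGroup T]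
    [AddCommGroup H] [Module (DPhi p R a b) T] [Module (DPhi p R a b) H]
    (e : T ≃ₗ[DPhi p R a b] H) (hH : IsFGU p R a b H) : IsFGU p R a b T := by
  have := hH.1
  obtain ⟨D⟩ := (isUnitModule_iff_nonempty_descent σ H).1 hH.2
  exact ⟨Module.Finite.equiv e.symm, (isUnitModule_iff_nonempty_descent σ T).2 ⟨D.ofEquiv e.symm⟩⟩

end Transport

end FRep
end

theorem mainTheorem7 {p : ℕ} [Fact p.Prime] {R : Type u} [CommRing R] [CharP R p]
    (hF : FRep.IsFFinite p R) (hR : FRep.IsCLFFRT p R) {a b : ℕ} (hab : FRep.IsSetup p R a b) :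
    FRep.IsFGU p R a b R ∧
    (∀ (M : Type u) [AddCommGroup M] [Module R M] [Module (FRep.DPhi p R a b) M]
      [IsScalarTower R (FRep.DPhi p R a b) M],
      (∀ W : Submonoid R,
        FRep.IsLocStructure p R a b M W (FRep.locModule p R a b M W) ∧
        (∀ inst : Module (FRep.DPhi p R a b) (LocalizedModule W M),
          FRep.IsLocStructure p R a b M W inst → inst = FRep.locModule p R a b M W) ∧
        (FRep.IsUnitModule p R a b M → FRep.IsUnitModule p R a b (LocalizedModule W M))) ∧
      (FRep.IsFGU p R a b M →
        ∀ f : R, FRep.IsFGU p R a b (LocalizedModule (Submonoid.powers f) M)) ∧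
      (∀ (I : Ideal R) (i : ℕ) (n : ℕ) (f : Fin n → R), Ideal.span (Set.range f) = I →
        (∀ k : ℕ, FRep.cechD p a b f M (k + 1) ∘ₗ FRep.cechD p a b f M k = 0) ∧
        ∃ inst : Module (FRep.DPhi p R a b) ((localCohomology I i).obj (ModuleCat.of R M)),
          IsScalarTower R (FRep.DPhi p R a b) ((localCohomology I i).obj (ModuleCat.of R M)) ∧
          Nonempty ((localCohomology I i).obj (ModuleCat.of R M) ≃ₗ[FRep.DPhi p R a b]
            FRep.CechCohomology p a b f M i) ∧
          (FRep.IsFGU p R a b M →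
            FRep.IsFGU p R a b ((localCohomology I i).obj (ModuleCat.of R M))))) := by
  obtain ⟨σ⟩ := FRep.nonempty_frobSplitting hF hab
  have := hF.1
  refine ⟨FRep.isFGU_self σ, fun M _ _ _ _ => ⟨fun W => ⟨FRep.isLocStructure_locModule p R a b M W,
    FRep.eq_locModule p R a b M W, fun hM => ?_⟩, fun hM f => ?_, fun I i n f hI =>
      ⟨FRep.cechD_comp_cechD p a b f M, ?_⟩⟩⟩
  · obtain ⟨D⟩ := (FRep.isUnitModule_iff_nonempty_descent σ M).1 hM
    exact (FRep.isUnitModule_iff_nonempty_descent σ _).2 ⟨D.localize W⟩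
  · have := hM.1
    obtain ⟨D⟩ := (FRep.isUnitModule_iff_nonempty_descent σ M).1 hM.2
    exact ⟨D.finite_away hF hab.1 f,
      (FRep.isUnitModule_iff_nonempty_descent σ _).2 ⟨D.localize _⟩⟩
  · obtain ⟨e⟩ := FRep.nonempty_localCohomology_equiv_cech f hI i M
    obtain ⟨e'⟩ := FRep.nonempty_cechCohomologyL_equiv p a b f M i
    obtain ⟨inst, h, ⟨g⟩⟩ := FRep.exists_module_of_equiv (p := p) (a := a) (b := b) (e ≪≫ₗ e')
    exact ⟨inst, h, ⟨g⟩, fun hM =>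
      .of_equiv σ g (FRep.isFGU_cechCohomology f hF hab.1 σ hM i)⟩
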